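/- Setting. Let $E$ be an elliptic curve over $\overline{\mathbb{Q}}$ without complex multiplication, i.e. $\mathrm{End}(E)=\mathbb{Z}$. Fix a symmetric very ample line bundle $\mathcal{L}$ on $E$, of degree $d\ge 3$, and let $h$ be the $\mathcal{L}$-canonical Néron–Tate height on $E(\overline{\mathbb{Q}})$; explicitly, for a Weierstrass equation of $E$, $h(P)=\frac d2\lim_{n\to\infty}4^{-n}h_{\mathrm{Weil}}(x([2^n]P))$, where $h_{\mathrm{Weil}}$ is the absolute logarithmic Weil height. On $E^n(\overline{\mathbb{Q}})$ put $h(x_1,\dots,x_n)=\max_i h(x_i)$ and $\|x\|=h(x)^{1/2}$. A set has bounded height if $h$ is bounded on it; the norm of such a set is the square root of the supremum of $h$ on it (and $0$ for the empty set). For $\varepsilon\ge0$ let $\mathcal{O}_\varepsilon=\{\xi\in E^n(\overline{\mathbb{Q}}):\|\xi\|\le\varepsilon\}$, and for $F\subseteq E^n(\overline{\mathbb{Q}})$ let $F_\varepsilon=F+\mathcal{O}_\varepsilon$. For $V,F\subseteq E^n(\overline{\mathbb{Q}})$ and an integer $r\ge1$ let $$S_r(V,F)=V\cap\bigcup_{\operatorname{cod}B\ge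 r}(B+F),$$ where $B$ runs over all abelian subvarieties of $E^n$ of codimension at least $r$ (so $S_r(V,F)=\emptyset$ for $r>n$). Let $C\subset E^g$ be an irreducible algebraic curve over $\overline{\mathbb{Q}}$ (identified with its set of $\overline{\mathbb{Q}}$-points) that is transverse, i.e. not contained in any translate of a proper algebraic subgroup of $E^g$. The division group of a subgroup $H\subseteq E(\overline{\mathbb{Q}})$ is the group of all points with a nonzero integral multiple in $H$. Theorem. Let $r\ge1$. (i) Let $\Gamma\subseteq E^g(\overline{\mathbb{Q}})$ be a subgroup of finite rank, let $\Gamma_0\subseteq E(\overline{\mathbb{Q}})$ be its saturated module, i.e. the division group of the subgroup generated by all coordinates of elements of $\Gamma$, let $s$ be the rank of $\Gamma_0$, and let $\gamma=(\gamma_1,\dots,\gamma_s)$ consist of $s$ linearly independent elements of $\Gamma_0$. Then, for every $\varepsilon\ge0$, the map $x\mapsto(x,\gamma)$ defines an injection $$S_r(C,\Gamma_\varepsilon)\hookrightarrow S_r(C\times\gamma,\mathcal{O}_\varepsilon).$$ (ii) Let $p=(p_1,\dots,p_s)\in E^s(\overline{\mathbb{Q}})$ with $p_1,\dots,p_s$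 linearly independent over $\mathbb{Z}$, and let $\Gamma_p$ be the division group of $\langle p_1,\dots,p_s\rangle$. There exist reals $c_p>0$ and $\varepsilon_p>0$ such that $$c_p^2\sum_i|b_i|^2\|p_i\|^2\le\Big\|\sum_i b_i(p_i-\xi_i)-b\zeta\Big\|^2\qquad(*)$$ for all integers $b_1,\dots,b_s,b$ with $|b|\le\max_i|b_i|$ and all $\xi_1,\dots,\xi_s,\zeta\in E(\overline{\mathbb{Q}})$ of norm at most $\varepsilon_p$. Let $c_p,\varepsilon_p>0$ be any reals satisfying $(*)$, let $\varepsilon_3>0$ be such that $S_2(C\times p,\mathcal{O}_{\varepsilon_3})$ has bounded height, and let $K_3$ be the norm of this set. If $r\ge2$ and $0\le\varepsilon\le\min(\varepsilon_p,\varepsilon_3)$, then the map $(x,p)\mapsto x$ defines an injection $$S_r(C\times p,\mathcal{O}_\varepsilon)\hookrightarrow S_r\big(C,(\Gamma_p^g)_{\varepsilon K_4}\big),\qquad K_4=(g+s)\max\Big(1,\frac{g(K_3+\varepsilon)}{c_p\min_i\|p_i\|}\Big)$$ (for $s=0$ the quotient in $K_4$ is read as $0$). -/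

import Mathlib

open scoped Pointwise

namespace EllipticPower

/-- The field of algebraic numbers. -/
abbrev Qbar : Type := AlgebraicClosure ℚ

noncomputable instance instDecidableEqQbar : DecidableEq Qbar := Classical.decEq _

/-- The group `E^n(Q̄)`, for the elliptic curve `E` with Weierstrass equation `W`. -/
abbrev EPow (W : WeierstrassCurve Qbar) (n : ℕ) : Type := Fin n → W.toAffine.Point

/-! ### The Zariski topology on `E^n(Q̄)` -/

/-- Homogeneous coordinates `[X : Y : Z]` of a point of `E ⊆ ℙ²`; the zero of the group law is
`[0 : 1 : 0]`. -/
noncomputable def coords {W : WeierstrassCurve Qbar} : W.toAffine.Point → Fin 3 → Qbar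
  | .zero => ![0, 1, 0]
  | .some x y _ => ![x, y, 1]

/-- The value of a polynomial in the `n` blocks of variables `X_i, Y_i, Z_i` at the chosen
homogeneous coordinates of a point of `E^n`. -/
noncomputable def evalAt {W : WeierstrassCurve Qbar} {n : ℕ}
    (F : MvPolynomial (Fin n × Fin 3) Qbar) (x : EPow W n) : Qbar :=
  MvPolynomial.eval (fun q => coords (x q.1) q.2) F

/-- `F` is multihomogeneous: homogeneous in each of the `n` blocks of variables, with degree `m i`
in the block `i`. -/
def IsMultihomogeneous {n : ℕ} (F : MvPolynomial (Fin n × Fin 3) Qbar) (m : Fin n → ℕ) : Prop :=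
  MvPolynomial.IsWeightedHomogeneous
    (fun q : Fin n × Fin 3 => (Pi.single q.1 1 : Fin n → ℕ)) F m

/-- The Zariski topology on `E^n(Q̄) ⊆ (ℙ²)^n`: the sets where a multihomogeneous polynomial does
not vanish form a basis of open sets. -/
instance zariski (W : WeierstrassCurve Qbar) (n : ℕ) : TopologicalSpace (EPow W n) :=
  TopologicalSpace.generateFrom
    {U | ∃ (F : MvPolynomial (Fin n × Fin 3) Qbar) (m : Fin n → ℕ),
      IsMultihomogeneous F m ∧ U = {x : EPow W n | evalAt F x ≠ 0}}

/-- An algebraic subgroup of `E^n`. -/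
def IsAlgebraicSubgroup {W : WeierstrassCurve Qbar} {n : ℕ} (B : AddSubgroup (EPow W n)) : Prop :=
  IsClosed (B : Set (EPow W n))

/-- An abelian (equivalently, semi-abelian) subvariety of `E^n`: an irreducible algebraic
subgroup. -/
def IsAbelianSubvariety {W : WeierstrassCurve Qbar} {n : ℕ} (B : AddSubgroup (EPow W n)) : Prop :=
  IsAlgebraicSubgroup B ∧ IsIrreducible (B : Set (EPow W n))

/-- The subset `B` of `E^n` has codimension at least `r`, that is `dim B + r ≤ n`. -/
def CodimGE {W : WeierstrassCurve Qbar} {n : ℕ} (B : Set (EPow W n)) (r : ℕ) : Prop :=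
  topologicalKrullDim B + (r : WithBot ℕ∞) ≤ (n : WithBot ℕ∞)

/-- An irreducible algebraic curve in `E^n`. -/
structure IsCurve {W : WeierstrassCurve Qbar} {n : ℕ} (C : Set (EPow W n)) : Prop where
  isClosed : IsClosed C
  isIrreducible : IsIrreducible C
  dim_eq_one : topologicalKrullDim C = 1

/-- `C` is transverse: it is not contained in any translate of a proper algebraic subgroup. -/
def IsTransverse {W : WeierstrassCurve Qbar} {n : ℕ} (C : Set (EPow W n)) : Prop :=
  ∀ B : AddSubgroup (EPow W n), IsAlgebraicSubgroup B → B ≠ ⊤ →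
    ∀ a : EPow W n, ¬ C ⊆ {a} + (B : Set (EPow W n))

/-! ### Endomorphisms of `E` -/

/-- `f : E → E` is a morphism of varieties: around every point it is given by three homogeneous
polynomials of the same degree in the homogeneous coordinates. -/
def IsRegularMap {W : WeierstrassCurve Qbar} (f : W.toAffine.Point → W.toAffine.Point) : Prop :=
  ∀ P : W.toAffine.Point, ∃ (F : Fin 3 → MvPolynomial (Fin 3) Qbar) (m : ℕ),
    (∀ i, (F i).IsHomogeneous m) ∧
    (∃ i, MvPolynomial.eval (coords P) (F i) ≠ 0) ∧
    ∀ Q : W.toAffine.Point, (∃ i, MvPolynomial.eval (coords Q) (F i) ≠ 0) →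
      ∃ c : Qbar, c ≠ 0 ∧ ∀ i, MvPolynomial.eval (coords Q) (F i) = c * coords (f Q) i

/-- `E` has no complex multiplication: `End(E) = ℤ`. -/
def NoCM (W : WeierstrassCurve Qbar) : Prop :=
  ∀ f : W.toAffine.Point →+ W.toAffine.Point, IsRegularMap f → ∃ n : ℤ, ∀ P, f P = n • P

/-! ### Heights -/

/-- The absolute logarithmic Weil height of the `x`-coordinate, a point of `ℙ¹`. -/
noncomputable def xHeight {W : WeierstrassCurve Qbar} : W.toAffine.Point → ℝ
  | .zero => 0
  | .some x _ _ => NumberField.absLogHeight₁ x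

/-- The canonical Néron–Tate height on `E(Q̄)` of a symmetric line bundle of degree `d`. It depends
on the line bundle only through `d`, and the function `x` belongs to a symmetric line bundle of
degree two, so it is `d / 2` times the Tate limit of the height of the `x`-coordinate. -/
noncomputable def canonicalHeight {W : WeierstrassCurve Qbar} (d : ℕ) (P : W.toAffine.Point) : ℝ :=
  (d : ℝ) / 2 * Filter.limUnder Filter.atTop (fun n : ℕ => xHeight ((2 ^ n : ℕ) • P) / (4 : ℝ) ^ n)

/-- The height on `E(Q̄)^n`: the maximum of the heights of the coordinates. -/
noncomputable def powHeight {W : WeierstrassCurve Qbar} {n : ℕ} (d : ℕ) (x : EPow W n) : ℝ :=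
  ⨆ i, canonicalHeight d (x i)

/-- The semi-norm `‖P‖` on `E(Q̄)`. -/
noncomputable def ptNorm {W : WeierstrassCurve Qbar} (d : ℕ) (P : W.toAffine.Point) : ℝ :=
  √(canonicalHeight d P)

/-- The semi-norm `‖x‖` on `E(Q̄)^n`. -/
noncomputable def powNorm {W : WeierstrassCurve Qbar} {n : ℕ} (d : ℕ) (x : EPow W n) : ℝ :=
  √(powHeight d x)

/-- The set `S` has bounded height. -/
def HasBoundedHeight {W : WeierstrassCurve Qbar} {n : ℕ} (d : ℕ) (S : Set (EPow W n)) : Prop :=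
  BddAbove (powHeight d '' S)

/-- The norm of a set: the square root of the supremum of the heights of its elements. -/
noncomputable def setNorm {W : WeierstrassCurve Qbar} {n : ℕ} (d : ℕ) (S : Set (EPow W n)) : ℝ :=
  √(sSup (powHeight d '' S))

/-- `O_ε`, the points of `E^n(Q̄)` of norm at most `ε`. -/
def smallPoints (W : WeierstrassCurve Qbar) (n d : ℕ) (ε : ℝ) : Set (EPow W n) :=
  {ξ | powNorm d ξ ≤ ε}

/-- `F_ε = F + O_ε`. -/
def thicken {W : WeierstrassCurve Qbar} {n : ℕ} (d : ℕ) (F : Set (EPow W n)) (ε : ℝ) :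
    Set (EPow W n) :=
  F + smallPoints W n d ε

/-! ### The sets `S_r(V, F)` -/

/-- `S_r(V, F)`: the points of `V` in the union of the `B + F`, over all abelian subvarieties `B`
of `E^n` of codimension at least `r`. -/
def S {W : WeierstrassCurve Qbar} {n : ℕ} (r : ℕ) (V F : Set (EPow W n)) : Set (EPow W n) :=
  V ∩ ⋃ (B : AddSubgroup (EPow W n)) (_ : IsAbelianSubvariety B)
    (_ : CodimGE (B : Set (EPow W n)) r), (B : Set (EPow W n)) + F

/-- `C × p ⊆ E^(g+s)`. -/
def prodPoint {W : WeierstrassCurve Qbar} {g s : ℕ} (C : Set (EPow W g)) (p : EPow W s) :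
    Set (EPow W (g + s)) :=
  (fun x : EPow W g => Fin.append x p) '' C

/-- The projection `(x, y) ↦ x` from `E^(g+s)` to `E^g`. -/
def projFirst {W : WeierstrassCurve Qbar} {g s : ℕ} (z : EPow W (g + s)) : EPow W g :=
  fun i => z (Fin.castAdd s i)

/-! ### Subgroups of finite rank -/

/-- The division group of a subgroup `H`: the elements having a nonzero multiple in `H`. -/
def divisionGroup {A : Type*} [AddCommGroup A] (H : AddSubgroup A) : AddSubgroup A where
  carrier := {P | ∃ N : ℤ, N ≠ 0 ∧ N • P ∈ H}
  zero_mem' := ⟨1, one_ne_zero, by simp⟩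
  add_mem' := by
    rintro a b ⟨M, hM, ha⟩ ⟨N, hN, hb⟩
    refine ⟨M * N, mul_ne_zero hM hN, ?_⟩
    have h1 : (M * N) • (a + b) = N • (M • a) + M • (N • b) := by
      rw [smul_add, smul_smul, smul_smul, mul_comm N M]
    rw [h1]
    exact H.add_mem (H.zsmul_mem ha N) (H.zsmul_mem hb M)
  neg_mem' := by
    rintro a ⟨N, hN, ha⟩
    exact ⟨N, hN, by rw [smul_neg]; exact H.neg_mem ha⟩

/-- The subgroup of `E(Q̄)` generated by the coordinates of the elements of `Γ ⊆ E^g(Q̄)`. -/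
noncomputable def coordinateGroup {W : WeierstrassCurve Qbar} {g : ℕ} (Γ : AddSubgroup (EPow W g)) :
    AddSubgroup W.toAffine.Point :=
  AddSubgroup.closure {P | ∃ y ∈ Γ, ∃ i, P = y i}

/-- The saturated module `Γ₀ ⊆ E(Q̄)` of `Γ`, for `End(E) = ℤ`: the division group of the
coordinates group of `Γ`. -/
noncomputable def saturatedModule {W : WeierstrassCurve Qbar} {g : ℕ} (Γ : AddSubgroup (EPow W g)) :
    AddSubgroup W.toAffine.Point :=
  divisionGroup (coordinateGroup Γ)

/-- The division group `Γ_p` of the point `p = (p_1, …, p_s)`. -/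
noncomputable def pointDivisionGroup {W : WeierstrassCurve Qbar} {s : ℕ} (p : EPow W s) :
    AddSubgroup W.toAffine.Point :=
  divisionGroup (AddSubgroup.closure (Set.range p))

/-- The power `H^g ⊆ E^g(Q̄)` of a subgroup `H ⊆ E(Q̄)`. -/
def groupPow {W : WeierstrassCurve Qbar} (H : AddSubgroup W.toAffine.Point) (g : ℕ) :
    Set (EPow W g) :=
  {y | ∀ i, y i ∈ H}

/-- `γ_1, …, γ_s` is a maximal free set of `M`: `M` has rank `s`, and the `γ_i` are linearly
independent elements of `M`. -/
structure IsMaximalFreeSet {W : WeierstrassCurve Qbar} {s : ℕ}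
    (M : AddSubgroup W.toAffine.Point) (γ : EPow W s) : Prop where
  rank_eq : Module.rank ℤ M = (s : Cardinal)
  mem : ∀ i, γ i ∈ M
  linearIndependent : LinearIndependent ℤ γ

/-! ### The constants attached to `p` -/

/-- `c` and `ε₀` are positive reals with
`c ∑ |b_i|² ‖p_i‖² ≤ ‖∑ b_i (p_i - ξ_i) - b ζ‖²` for all integers `b_1, …, b_s, b` with
`|b| ≤ max |b_i|` and all points `ξ_1, …, ξ_s, ζ` of norm at most `ε₀`. -/
structure AreConstants {W : WeierstrassCurve Qbar} {s : ℕ} (d : ℕ) (p : EPow W s) (c ε₀ : ℝ) :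
    Prop where
  c_pos : 0 < c
  ε₀_pos : 0 < ε₀
  bound : ∀ (b : Fin s → ℤ) (b' : ℤ), (∃ i, |b'| ≤ |b i|) →
    ∀ (ξ : EPow W s) (ζ : W.toAffine.Point), (∀ i, ptNorm d (ξ i) ≤ ε₀) → ptNorm d ζ ≤ ε₀ →
      c * ∑ i, |(b i : ℝ)| ^ 2 * ptNorm d (p i) ^ 2 ≤
        ptNorm d (∑ i, b i • (p i - ξ i) - b' • ζ) ^ 2

/-- `K₄ = (g + s) max(1, g (K₃ + ε) / (c_p min ‖p_i‖))`. -/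
noncomputable def K₄ {W : WeierstrassCurve Qbar} {s : ℕ} (d g : ℕ) (p : EPow W s)
    (K₃ cp ε : ℝ) : ℝ :=
  ((g : ℝ) + s) * max 1 (g * (K₃ + ε) / (cp * ⨅ i, ptNorm d (p i)))

end EllipticPower

open EllipticPower

/-! ### Heights in extensions of number fields -/

namespace NumberField

open Height

variable {K L : Type*} [Field K] [NumberField K] [Field L] [NumberField L]

/-! Both inclusions are linear algebra over ℤ once two facts are available. The geometric fact:
since End(E) = ℤ, an abelian subvariety of codimension at least r satisfies at least r independent
integral relations between its coordinates (`exists_relations`,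
`exists_matrix_of_abelianSubvariety`), and the solutions of a system of relations solved for some
coordinates lie, up to torsion, in an abelian subvariety of at most the expected dimension
(`exists_abelianSubvariety_of_relations`). The arithmetic fact: ‖·‖ is a seminorm vanishing on
torsion, so torsion errors cost nothing, and it is bounded below by a multiple of max |b_i| on
combinations ∑ b_i p_i of independent points (`exists_pos_mul_abs_le_ptNorm_sum`).

For (i), let x = b + y + ξ with b ∈ B, y ∈ Γ and ξ small. A common multiple of the coordinates of y
lies in the span of γ, so the relations satisfied by b become relations satisfied by (b + y, γ), in
the same number (`exists_abelianSubvariety_append`). Hence (x, γ) is a point of an abelian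
subvariety of codimension at least r, plus torsion, plus (ξ, 0).

For (ii), let (x, p) = b + (ξ', ξ'') with b ∈ B, and write the relations of B as a matrix (M | Ψ).
Inequality (*) forces M to have independent rows: a combination killing M would be a relation
between the p_k - ξ''_k. Multiplying by the adjugate of a maximal minor of largest absolute value
gives (L | Φ), where L contains the scalar block a and has all entries at most |a|
(`Matrix.exists_mul_dominant`); (*) then bounds the entries of Φ by |a| κ, with κ the quotient
inside K₄. Dividing by a at the pivot coordinates yields y ∈ Γ_p^g with Ly = -Φp, and η of norm at
most ε(g + sκ) with Lη = Lξ' + Φξ''. Finally x - y - η solves L, so it lies in an abelian subvariety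
up to torsion (`exists_mem_groupPow_add`).

The height fact rests on the invariance of heights under field extension, the formulas for x(P + Q)
and x(P - Q), Tate's limit and Northcott's theorem. The geometric fact rests on Chevalley's theorem:
projections of abelian subvarieties are closed. A coordinate which is not free on B is then, up to a
multiple, a homomorphism of free ones with closed graph; such homomorphisms E → E are regular
(`isRegularMap_of_isClosed_graph`), hence multiplications by integers. -/

lemma prod_infinitePlace_pow_mult (f : InfinitePlace K → ℝ) :
    ∏ v : InfinitePlace K, f v ^ v.mult = ∏ φ : K →+* ℂ, f (InfinitePlace.mk φ) := by
  classical
  rw [← Finset.prod_fiberwise Finset.univ InfinitePlace.mk (fun φ => f (InfinitePlace.mk φ))]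
  refine Finset.prod_congr rfl fun v _ => ?_
  rw [Finset.prod_congr rfl (g := fun _ => f v), Finset.prod_const,
    InfinitePlace.card_filter_mk_eq]
  intro φ hφ
  rw [(Finset.mem_filter.mp hφ).2]

/-- Once φ makes ℂ a K-algebra, the extensions of φ to L are the K-algebra homomorphisms L → ℂ, and
there are [L : K] of these by separability. -/
lemma card_filter_comp_algebraMap_eq [Algebra K L] (φ : K →+* ℂ) [DecidableEq (K →+* ℂ)] :
    (Finset.univ.filter fun ψ : L →+* ℂ => ψ.comp (algebraMap K L) = φ).card =
      Module.finrank K L := by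
  classical
  let _ : Algebra K ℂ := φ.toAlgebra
  rw [← AlgHom.card K L ℂ, ← Fintype.card_subtype]
  refine Fintype.card_congr
    { toFun := fun ψ => { ψ.1 with commutes' := fun r => RingHom.congr_fun ψ.2 r }
      invFun := fun ψ => ⟨ψ.toRingHom, RingHom.ext fun r => ψ.commutes r⟩
      left_inv := fun ψ => rfl
      right_inv := fun ψ => rfl }

lemma prod_embeddings_comp_algebraMap [Algebra K L] (f : (K →+* ℂ) → ℝ) :
    ∏ ψ : L →+* ℂ, f (ψ.comp (algebraMap K L)) =
      (∏ φ : K →+* ℂ, f φ) ^ Module.finrank K L := by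
  classical
  rw [← Finset.prod_fiberwise Finset.univ (fun ψ : L →+* ℂ => ψ.comp (algebraMap K L)),
    ← Finset.prod_pow]
  refine Finset.prod_congr rfl fun φ _ => ?_
  rw [Finset.prod_congr rfl (g := fun _ => f φ), Finset.prod_const]
  · congr 1
    convert card_filter_comp_algebraMap_eq φ
  · intro ψ hψ
    rw [(Finset.mem_filter.mp hψ).2]

/-- The height of the quotient of two algebraic integers, in terms of the complex embeddings and
the norm of the ideal that the integers generate. -/
lemma mulHeight₁_div_mul_absNorm {a b : 𝓞 K} (hb : b ≠ 0) :
    mulHeight₁ ((a : K) / b) * (Ideal.span {a, b}).absNorm =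
      ∏ φ : K →+* ℂ, max ‖φ a‖ ‖φ b‖ := by
  have hx : ![a, b] ≠ 0 := fun h => hb (by simpa using congrFun h 1)
  have hx' : ![(a : K), (b : K)] ≠ 0 := fun h => hb (by
    have := congrFun h 1
    simpa using this)
  have hfin := absNorm_mul_finprod_finitePlace_eq_one hx
  rw [Matrix.range_cons_cons_empty] at hfin
  have hcast : ∀ i, ((![a, b] i : 𝓞 K) : K) = ![(a : K), (b : K)] i := by
    intro i; fin_cases i <;> rfl
  simp_rw [hcast] at hfin
  rw [mulHeight₁_div_eq_mulHeight, NumberField.mulHeight_eq hx', mul_assoc,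
    mul_comm (finprod _), hfin, mul_one,
    prod_infinitePlace_pow_mult (fun v => ⨆ i, v (![(a : K), (b : K)] i))]
  refine Finset.prod_congr rfl fun φ _ => ?_
  apply le_antisymm
  · refine ciSup_le fun i => ?_
    fin_cases i <;> simp
  · refine max_le ?_ ?_
    · exact Finite.le_ciSup_of_le 0 (by simp)
    · exact Finite.le_ciSup_of_le 1 (by simp)

lemma exists_eq_div_of_ringOfIntegers (x : K) : ∃ a b : 𝓞 K, b ≠ 0 ∧ x = (a : K) / b := by
  obtain ⟨a, b, hb, h⟩ := IsFractionRing.div_surjective (A := 𝓞 K) x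
  exact ⟨a, b, nonZeroDivisors.ne_zero hb, h.symm⟩

/-- Write x = a/b with integers a, b. In `mulHeight₁_div_mul_absNorm` the product over embeddings
and the norm of the ideal (a, b) are both raised to the power [L : K] on passing to L; hence so is
the height. No analysis of places above a given one is needed. -/
lemma mulHeight₁_algebraMap [Algebra K L] (x : K) :
    mulHeight₁ (algebraMap K L x) = mulHeight₁ x ^ Module.finrank K L := by
  obtain ⟨a, b, hb, rfl⟩ := exists_eq_div_of_ringOfIntegers x
  set a' := algebraMap (𝓞 K) (𝓞 L) a with ha'
  set b' := algebraMap (𝓞 K) (𝓞 L) b with hb'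
  have hinj : Function.Injective (algebraMap (𝓞 K) (𝓞 L)) := FaithfulSMul.algebraMap_injective _ _
  have hb'0 : b' ≠ 0 := by
    rw [hb']; exact fun h => hb (hinj (by simpa using h))
  have hcoe : ∀ c : 𝓞 K, algebraMap K L (c : K) = ((algebraMap (𝓞 K) (𝓞 L) c : 𝓞 L) : L) :=
    fun c => rfl
  have h1 := mulHeight₁_div_mul_absNorm (a := a) hb
  have h2 := mulHeight₁_div_mul_absNorm (a := a') hb'0
  have h3 : Ideal.span {a', b'} = (Ideal.span {a, b}).map (algebraMap (𝓞 K) (𝓞 L)) := by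
    rw [Ideal.map_span, Set.image_pair]
  have h4 : Module.finrank (𝓞 K) (𝓞 L) = Module.finrank K L :=
    (IsFractionRing.finrank_eq (𝓞 K) K (𝓞 L) L).symm
  rw [h3, Ideal.absNorm_algebraMap, h4] at h2
  have h5 : ∏ φ : L →+* ℂ, max ‖φ a'‖ ‖φ b'‖ =
      (∏ φ : K →+* ℂ, max ‖φ a‖ ‖φ b‖) ^ Module.finrank K L := by
    rw [← prod_embeddings_comp_algebraMap (fun φ : K →+* ℂ => max ‖φ a‖ ‖φ b‖)]
    rfl
  have h6 : ((Ideal.span {a, b}).absNorm : ℝ) ≠ 0 := by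
    have : (Ideal.span {a, b}).absNorm ≠ 0 := by
      rw [Ne, Ideal.absNorm_eq_zero_iff]
      intro h
      apply hb
      have : b ∈ Ideal.span {a, b} := Ideal.subset_span (by simp)
      rw [h] at this
      simpa using this
    exact_mod_cast this
  rw [map_div₀, hcoe, hcoe]
  rw [h5, ← h1, mul_pow, Nat.cast_pow] at h2
  exact mul_right_cancel₀ (pow_ne_zero _ h6) h2

-- The absolute height is defined through ℚ(x); the tower ℚ ⊆ ℚ(x) ⊆ K allows any larger number
-- field, so that several points can be treated over a common one.
open IntermediateField in
lemma absLogHeight₁_eq_logHeight₁_div {F : Type*} [Field F] [CharZero F]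
    (K : IntermediateField ℚ F) [FiniteDimensional ℚ K] [NumberField K] (x : K) :
    absLogHeight₁ (x : F) = logHeight₁ x / Module.finrank ℚ K := by
  have hx : IsIntegral ℚ (x : F) := (Algebra.IsIntegral.isIntegral (R := ℚ) x).map K.val
  have : FiniteDimensional ℚ ℚ⟮(x : F)⟯ := adjoin.finiteDimensional hx
  have : NumberField ℚ⟮(x : F)⟯ := {}
  have hle : ℚ⟮(x : F)⟯ ≤ K := by simp
  let _ : Algebra ℚ⟮(x : F)⟯ K := (IntermediateField.inclusion hle).toRingHom.toAlgebra
  have : IsScalarTower ℚ ℚ⟮(x : F)⟯ K := IsScalarTower.of_algebraMap_eq' rfl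
  have h1 : algebraMap ℚ⟮(x : F)⟯ K (AdjoinSimple.gen ℚ (x : F)) = x := rfl
  have h2 := mulHeight₁_algebraMap (L := K) (AdjoinSimple.gen ℚ (x : F))
  rw [h1] at h2
  have h3 := Module.finrank_mul_finrank ℚ ℚ⟮(x : F)⟯ K
  have hpos : 0 < Module.finrank ℚ⟮(x : F)⟯ K := by
    by_contra h0
    have : Module.finrank ℚ K = 0 := by rw [← h3]; simp [Nat.eq_zero_of_not_pos h0]
    exact (Module.finrank_pos (R := ℚ) (M := K)).ne' this
  have hpos' : 0 < Module.finrank ℚ ℚ⟮(x : F)⟯ := Module.finrank_pos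
  rw [absLogHeight₁, absMulHeight₁, dif_pos hx, Real.log_rpow (mulHeight₁_pos _),
    logHeight₁_eq_log_mulHeight₁, h2, Real.log_pow, ← h3]
  push_cast
  field_simp

end NumberField

/-! ### The addition-and-subtraction map computes `x(P + Q)` and `x(P - Q)` -/

namespace WeierstrassCurve.Affine.Point

variable {F : Type*} [Field F] {W : WeierstrassCurve F}

lemma eval_addSubMap (v : Fin 3 → F) : (fun i => (addSubMap W i).eval v) =
    ![v 0 ^ 2 - W.b₄ * v 0 * v 2 - W.b₆ * v 1 * v 2 - W.b₈ * v 2 ^ 2,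
      2 * v 1 * v 0 + W.b₂ * v 0 * v 2 + W.b₄ * v 1 * v 2 + W.b₆ * v 2 ^ 2,
      v 1 ^ 2 - 4 * v 0 * v 2] := by
  funext i
  fin_cases i <;> simp [addSubMap]

variable [DecidableEq F]

/-- Duplication formula, with scale factor ψ² for ψ = 2y + a₁x + a₃. If ψ = 0 then 2P = 0, the last
two coordinates vanish, and the first one is nonzero because the quadratic map has no common zero on
the symmetric square. -/
lemma sym2x_add_self_eq_smul [W.IsElliptic] {x y : F} (h : W.toAffine.Nonsingular x y) :
    ∃ c : F, c ≠ 0 ∧ (some x y h + some x y h).sym2x 0 =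
      c • fun i => (addSubMap W i).eval ((some x y h).sym2x (some x y h)) := by
  have heq := (W.toAffine.equation_iff x y).mp h.1
  have hne := addSubMap_ne_zero W (sym2x_ne_zero (some x y h) (some x y h))
  rw [eval_addSubMap] at hne ⊢
  simp only [sym2x_some_some] at hne ⊢
  by_cases hy : y = W.toAffine.negY x y
  · rw [add_self_of_Y_eq hy]
    rw [Affine.negY] at hy
    have h2 : 2 * (x + x) * (x * x) + W.b₂ * (x * x) * 1 + W.b₄ * (x + x) * 1 + W.b₆ * 1 ^ 2 = 0 := by
      rw [b₂, b₄, b₆]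
      linear_combination (2 * y + W.a₁ * x + W.a₃) * hy - 4 * heq
    have h3 : (x + x) ^ 2 - 4 * (x * x) * 1 = 0 := by ring
    simp only [Matrix.cons_val_zero, Matrix.cons_val_one, Matrix.cons_val] at hne ⊢
    rw [h2, h3] at hne ⊢
    set u := (x * x) ^ 2 - W.b₄ * (x * x) * 1 - W.b₆ * (x + x) * 1 - W.b₈ * 1 ^ 2
    have hu : u ≠ 0 := by
      intro hu
      apply hne
      rw [hu]
      ext i; fin_cases i <;> rfl
    refine ⟨u⁻¹, inv_ne_zero hu, ?_⟩
    ext i; fin_cases i <;> simp [hu]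
  · rw [add_self_of_Y_ne hy]
    have hy' : 2 * y + W.a₁ * x + W.a₃ ≠ 0 := by
      intro h0; apply hy; rw [Affine.negY]; linear_combination h0
    have hy'' : y - W.toAffine.negY x y = 2 * y + W.a₁ * x + W.a₃ := by rw [Affine.negY]; ring
    obtain ⟨ψ, hψ⟩ : ∃ ψ, ψ = 2 * y + W.a₁ * x + W.a₃ := ⟨_, rfl⟩
    rw [← hψ] at hy' hy''
    refine ⟨(ψ ^ 2)⁻¹, inv_ne_zero (pow_ne_zero _ hy'), ?_⟩
    rw [sym2x_some_zero, slope_of_Y_ne rfl hy, hy'', Affine.addX]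
    ext i; fin_cases i
    · simp only [b₄, b₆, b₈, Fin.zero_eta, Matrix.cons_val_zero, Matrix.cons_val_one,
        Matrix.cons_val, Pi.smul_apply, smul_eq_mul]
      field_simp
      rw [hψ]
      linear_combination (-W.a₁ ^ 2 - 4 * W.a₂ - 8 * x) * heq
    · simp only [b₂, b₄, b₆, Fin.mk_one, Matrix.cons_val_zero, Matrix.cons_val_one,
        Matrix.cons_val, Pi.smul_apply, smul_eq_mul]
      field_simp
      rw [hψ]
      linear_combination 4 * heq
    · simp
      right; ring

/-- x(P + Q) and x(P - Q) are not separately functions of x(P) and x(Q), but their symmetric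
functions are. For x(P) ≠ x(Q) the chord formulas give the scale factor (x₁ - x₂)²; otherwise Q = ±P
and the pair {P + Q, P - Q} is {2P, 0}. -/
lemma sym2x_add_sub_eq_smul [W.IsElliptic] (P Q : W.toAffine.Point) :
    ∃ c : F, c ≠ 0 ∧ (P + Q).sym2x (P - Q) =
      c • fun i => (addSubMap W i).eval (P.sym2x Q) := by
  match P, Q with
  | 0, Q =>
    refine ⟨1, one_ne_zero, ?_⟩
    rw [zero_add, zero_sub, sym2x_neg_right, eval_addSubMap, one_smul]
    match Q with
    | 0 => ext i; fin_cases i <;> simp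
    | some x y h => ext i; fin_cases i <;> simp <;> ring
  | some x y h, 0 =>
    refine ⟨1, one_ne_zero, ?_⟩
    rw [add_zero, sub_zero, eval_addSubMap, one_smul]
    ext i; fin_cases i <;> simp <;> ring
  | some x₁ y₁ h₁, some x₂ y₂ h₂ =>
    by_cases hx : x₁ = x₂
    · rcases X_eq_iff.mp hx with h | h
      · rw [← h, sub_self]
        exact sym2x_add_self_eq_smul h₁
      · have h' : some x₂ y₂ h₂ = -some x₁ y₁ h₁ := by rw [h, neg_neg]
        rw [h', add_neg_cancel, sub_neg_eq_add, sym2x_comm, sym2x_neg_right]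
        exact sym2x_add_self_eq_smul h₁
    · have e₁ := (W.toAffine.equation_iff x₁ y₁).mp h₁.1
      have e₂ := (W.toAffine.equation_iff x₂ y₂).mp h₂.1
      have hd : x₁ - x₂ ≠ 0 := sub_ne_zero.mpr hx
      refine ⟨((x₁ - x₂) ^ 2)⁻¹, inv_ne_zero (pow_ne_zero _ hd), ?_⟩
      rw [eval_addSubMap, sub_eq_add_neg, neg_some, add_of_X_ne hx, add_of_X_ne hx,
        sym2x_some_some, sym2x_some_some, slope_of_X_ne hx, slope_of_X_ne hx, Affine.addX,
        Affine.addX, Affine.negY]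
      ext i; fin_cases i
      · simp only [b₄, b₆, b₈, Fin.zero_eta, Matrix.cons_val_zero, Matrix.cons_val_one,
          Matrix.cons_val, Pi.smul_apply, smul_eq_mul]
        field_simp
        -- The identity holds only modulo the two Weierstrass equations; these are the cofactors.
        linear_combination (y₁^2 + y₁*W.a₃ - 2*y₂^2 - 2*x₂*y₂*W.a₁ - 2*y₂*W.a₃ - x₂*W.a₁*W.a₃
          + x₁*y₁*W.a₁ + x₁*x₂*W.a₁^2 + x₁*W.a₁*W.a₃ - x₁^2*W.a₂ + 4*x₁*x₂*W.a₂ - 2*x₂^2*W.a₂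
          - x₁^3 + 2*x₁^2*x₂ + 2*x₁*x₂^2 - 2*x₂^3 - x₂^2*W.a₁^2 + x₁*W.a₄ + W.a₆) * e₁
          + (y₂^2 + x₂*y₂*W.a₁ + y₂*W.a₃ + x₂*W.a₁*W.a₃ + x₁*x₂*W.a₁^2 - x₁*W.a₁*W.a₃
          - 4*x₁^2*W.a₂ + 4*x₁*x₂*W.a₂ - x₂^2*W.a₂ - 4*x₁^3 + 2*x₁^2*x₂ + 2*x₁*x₂^2 - x₂^3
          - x₁^2*W.a₁^2 - 2*x₁*W.a₄ - W.a₆ + x₂*W.a₄) * e₂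
      · simp only [b₂, b₄, b₆, Fin.mk_one, Matrix.cons_val_zero, Matrix.cons_val_one,
          Matrix.cons_val, Pi.smul_apply, smul_eq_mul]
        field_simp
        linear_combination 2 * e₁ + 2 * e₂
      · simp only [Fin.reduceFinMk, Matrix.cons_val_zero, Matrix.cons_val_one,
          Matrix.cons_val, Pi.smul_apply, smul_eq_mul]
        field_simp
        ring

end WeierstrassCurve.Affine.Point

/-! ### Points over a number field -/

namespace EllipticPower

open WeierstrassCurve WeierstrassCurve.Affine Height NumberField

variable {W : WeierstrassCurve Qbar}

/-- The coefficients of `W` lie in the field `K`. -/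
structure CoeffsMem (W : WeierstrassCurve Qbar) (K : IntermediateField ℚ Qbar) : Prop where
  a₁ : W.a₁ ∈ K
  a₂ : W.a₂ ∈ K
  a₃ : W.a₃ ∈ K
  a₄ : W.a₄ ∈ K
  a₆ : W.a₆ ∈ K

lemma CoeffsMem.slope_mem {K : IntermediateField ℚ Qbar} (hW : CoeffsMem W K)
    {x₁ x₂ y₁ y₂ : Qbar} (hx₁ : x₁ ∈ K) (hx₂ : x₂ ∈ K) (hy₁ : y₁ ∈ K) (hy₂ : y₂ ∈ K) :
    W.toAffine.slope x₁ x₂ y₁ y₂ ∈ K := by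
  have hnum : ∀ n : ℕ, ((OfNat.ofNat (n + 2) : Qbar)) ∈ K := fun n => ofNat_mem K _
  have hneg : ∀ x y, x ∈ K → y ∈ K → W.toAffine.negY x y ∈ K := fun x y hx hy =>
    sub_mem (sub_mem (neg_mem hy) (mul_mem hW.a₁ hx)) hW.a₃
  unfold Affine.slope
  split_ifs
  · exact zero_mem K
  · refine div_mem ?_ (sub_mem hy₁ (hneg _ _ hx₁ hy₁))
    exact sub_mem (add_mem (add_mem (mul_mem (hnum 1) (pow_mem hx₁ 2))
      (mul_mem (mul_mem (hnum 0) hW.a₂) hx₁)) hW.a₄) (mul_mem hW.a₁ hy₁)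
  · exact div_mem (sub_mem hy₁ hy₂) (sub_mem hx₁ hx₂)

/-- The points of `E` with coordinates in `K`. -/
noncomputable def rationalPoints {K : IntermediateField ℚ Qbar} (hW : CoeffsMem W K) :
    AddSubgroup W.toAffine.Point where
  carrier := {P | ∀ j, coords P j ∈ K}
  zero_mem' := by
    intro j
    change (![0, 1, 0] : Fin 3 → Qbar) j ∈ K
    fin_cases j <;> simp
  neg_mem' := by
    rintro (_ | ⟨x, y, h⟩) hP
    · exact hP
    · intro j
      have hx := hP 0
      have hy := hP 1
      change (![x, W.toAffine.negY x y, 1] : Fin 3 → Qbar) j ∈ K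
      fin_cases j
      · exact hx
      · exact sub_mem (sub_mem (neg_mem hy) (mul_mem hW.a₁ hx)) hW.a₃
      · exact one_mem K
  add_mem' := by
    rintro (_ | ⟨x₁, y₁, h₁⟩) (_ | ⟨x₂, y₂, h₂⟩) hP hQ
    · exact hP
    · exact hQ
    · exact hP
    · have hx₁ := hP 0
      have hy₁ := hP 1
      have hx₂ := hQ 0
      have hy₂ := hQ 1
      by_cases hxy : x₁ = x₂ ∧ y₁ = W.toAffine.negY x₂ y₂
      · rw [Set.mem_ofPred_eq, Point.add_of_Y_eq hxy.1 hxy.2]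
        intro j
        change (![0, 1, 0] : Fin 3 → Qbar) j ∈ K
        fin_cases j <;> simp
      · rw [Set.mem_ofPred_eq, Point.add_some hxy]
        have hs := hW.slope_mem hx₁ hx₂ hy₁ hy₂
        have hX : W.toAffine.addX x₁ x₂ (W.toAffine.slope x₁ x₂ y₁ y₂) ∈ K :=
          sub_mem (sub_mem (sub_mem (add_mem (pow_mem hs 2) (mul_mem hW.a₁ hs)) hW.a₂) hx₁) hx₂
        have hY : W.toAffine.negAddY x₁ x₂ y₁ (W.toAffine.slope x₁ x₂ y₁ y₂) ∈ K :=
          add_mem (mul_mem hs (sub_mem hX hx₁)) hy₁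
        intro j
        fin_cases j
        · exact hX
        · exact sub_mem (sub_mem (neg_mem hY) (mul_mem hW.a₁ hX)) hW.a₃
        · exact one_mem K

lemma isIntegral_rat_qbar (x : Qbar) : IsIntegral ℚ x := by
  have h : IsAlgebraic ℚ x := by
    convert (AlgebraicClosure.isAlgebraic ℚ).isAlgebraic x
    · rfl
    · exact Subsingleton.elim _ _
  exact h.isIntegral

/-- Reduces statements about finitely many points to one number field, over which the error terms of
the height are uniform. -/
lemma exists_field_forall_mem_rationalPoints (T : Set W.toAffine.Point) (hT : T.Finite) :
    ∃ K : IntermediateField ℚ Qbar, FiniteDimensional ℚ K ∧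
      ∃ hW : CoeffsMem W K, ∀ P ∈ T, P ∈ rationalPoints hW := by
  let S : Set Qbar := {W.a₁, W.a₂, W.a₃, W.a₄, W.a₆} ∪ ⋃ P ∈ T, Set.range (coords P)
  have hS : S.Finite := (Set.toFinite _).union (hT.biUnion fun P _ => Set.finite_range _)
  have : Finite S := hS
  have hmem : ∀ x ∈ S, x ∈ IntermediateField.adjoin ℚ S :=
    fun x hx => IntermediateField.subset_adjoin ℚ S hx
  refine ⟨IntermediateField.adjoin ℚ S,
    IntermediateField.finiteDimensional_adjoin fun x _ => isIntegral_rat_qbar x,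
    ⟨hmem _ ?_, hmem _ ?_, hmem _ ?_, hmem _ ?_, hmem _ ?_⟩, fun P hP j => hmem _ ?_⟩
  on_goal 6 => exact Or.inr (Set.mem_biUnion hP ⟨j, rfl⟩)
  all_goals exact Or.inl (by simp)

/-- The curve `W`, as a curve over the field `K` of its coefficients. -/
noncomputable def CoeffsMem.descend {K : IntermediateField ℚ Qbar} (hW : CoeffsMem W K) :
    WeierstrassCurve K :=
  ⟨⟨_, hW.a₁⟩, ⟨_, hW.a₂⟩, ⟨_, hW.a₃⟩, ⟨_, hW.a₄⟩, ⟨_, hW.a₆⟩⟩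

lemma CoeffsMem.descend_map {K : IntermediateField ℚ Qbar} (hW : CoeffsMem W K) :
    hW.descend.map (algebraMap K Qbar) = W := rfl

lemma CoeffsMem.isElliptic_descend [W.IsElliptic] {K : IntermediateField ℚ Qbar}
    (hW : CoeffsMem W K) : hW.descend.IsElliptic := by
  refine ⟨isUnit_iff_ne_zero.mpr fun h => W.isUnit_Δ.ne_zero ?_⟩
  rw [← hW.descend_map, map_Δ, h, map_zero]

/-- Represents x(P) ∈ ℙ¹ over K, with infinity as [1 : 0]; the factor [K : ℚ] converts absolute
heights into heights over K. -/
lemma exists_lift_xRep {K : IntermediateField ℚ Qbar} {hW : CoeffsMem W K} [NumberField K]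
    {P : W.toAffine.Point} (hP : P ∈ rationalPoints hW) :
    ∃ a b : K, ![a, b] ≠ 0 ∧ P.xRep = ![(a : Qbar), (b : Qbar)] ∧
      xHeight P * Module.finrank ℚ K = logHeight ![a, b] := by
  have hpos : (Module.finrank ℚ K : ℝ) ≠ 0 := by
    exact_mod_cast (Module.finrank_pos (R := ℚ) (M := K)).ne'
  match P with
  | .zero =>
    refine ⟨1, 0, by simp, by simp [Point.xRep], ?_⟩
    rw [← logHeight₁_div_eq_logHeight]
    simp [xHeight]
  | .some x y h =>
    refine ⟨⟨x, hP 0⟩, 1, by simp, by simp [Point.xRep], ?_⟩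
    rw [← logHeight₁_eq_logHeight, xHeight,
      absLogHeight₁_eq_logHeight₁_div K ⟨x, hP 0⟩, div_mul_cancel₀ _ hpos]

lemma eval_addSubMap_descend {K : IntermediateField ℚ Qbar} (hW : CoeffsMem W K)
    (v : Fin 3 → K) (i : Fin 3) :
    (((addSubMap hW.descend i).eval v : K) : Qbar) =
      (addSubMap W i).eval fun j => (v j : Qbar) := by
  have h1 := congrFun (Point.eval_addSubMap (W := hW.descend) v) i
  have h2 := congrFun (Point.eval_addSubMap (W := W) fun j => (v j : Qbar)) i
  rw [h1, h2]
  have hb₂ : (hW.descend.b₂ : Qbar) = W.b₂ := (hW.descend.map_b₂ (algebraMap K Qbar)).symm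
  have hb₄ : (hW.descend.b₄ : Qbar) = W.b₄ := (hW.descend.map_b₄ (algebraMap K Qbar)).symm
  have hb₆ : (hW.descend.b₆ : Qbar) = W.b₆ := (hW.descend.map_b₆ (algebraMap K Qbar)).symm
  have hb₈ : (hW.descend.b₈ : Qbar) = W.b₈ := (hW.descend.map_b₈ (algebraMap K Qbar)).symm
  fin_cases i <;> simp [← hb₂, ← hb₄, ← hb₆, ← hb₈] <;> exact Or.inl (Or.inl rfl)

/-- The approximate parallelogram law. -/
lemma exists_abs_xHeight_add_sub_le [W.IsElliptic] {K : IntermediateField ℚ Qbar}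
    [FiniteDimensional ℚ K] (hW : CoeffsMem W K) :
    ∃ C : ℝ, ∀ P ∈ rationalPoints hW, ∀ Q ∈ rationalPoints hW,
      |xHeight (P + Q) + xHeight (P - Q) - 2 * xHeight P - 2 * xHeight Q| ≤ C := by
  have : NumberField K := {}
  have := hW.isElliptic_descend
  obtain ⟨C₁, hC₁⟩ := abs_logHeight_sym2_sub_le K
  obtain ⟨C₂, hC₂⟩ := abs_logHeight_addSubMap_sub_two_mul_logHeight_le hW.descend
  have hpos : (0 : ℝ) < Module.finrank ℚ K := by
    exact_mod_cast Module.finrank_pos (R := ℚ) (M := K)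
  -- The comparison of the symmetric square with the pair is used once for (P + Q, P - Q) and, the
  -- map being quadratic, with weight two for (P, Q): hence 3 C₁. The map itself contributes C₂.
  refine ⟨(3 * C₁ + C₂) / Module.finrank ℚ K, fun P hP Q hQ => ?_⟩
  obtain ⟨a, b, hab, hPx, hPh⟩ := exists_lift_xRep hP
  obtain ⟨c, d, hcd, hQx, hQh⟩ := exists_lift_xRep hQ
  obtain ⟨a', b', hab', hPx', hPh'⟩ := exists_lift_xRep (add_mem hP hQ)
  obtain ⟨c', d', hcd', hQx', hQh'⟩ := exists_lift_xRep (sub_mem hP hQ)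
  obtain ⟨u, hu, huv⟩ := Point.sym2x_add_sub_eq_smul P Q
  have h1 := hC₁ hab hcd
  have h2 := hC₁ hab' hcd'
  have h3 := hC₂ ![a * c, a * d + b * c, b * d]
  set v : Fin 3 → K := ![a * c, a * d + b * c, b * d] with hv
  set w : Fin 3 → K := ![a' * c', a' * d' + b' * c', b' * d'] with hw
  have hv' : P.sym2x Q = fun j => (v j : Qbar) := by
    funext j
    rw [Point.sym2x, hPx, hQx]
    fin_cases j <;> simp [hv]
  have hw' : (P + Q).sym2x (P - Q) = fun j => (w j : Qbar) := by
    funext j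
    rw [Point.sym2x, hPx', hQx']
    fin_cases j <;> simp [hw]
  have hw0 : w ≠ 0 := by
    intro h0
    apply Point.sym2x_ne_zero (P + Q) (P - Q)
    rw [hw', h0]
    funext j; simp
  -- The scale factor u is a priori in `Qbar`; as a quotient of coordinates in K it lies in K, so it
  -- does not change the height over K.
  have key : ∃ u' : K, u' ≠ 0 ∧ w = u' • fun i => (addSubMap hW.descend i).eval v := by
    have hj : ∀ j, (w j : Qbar) = u * ((addSubMap hW.descend j).eval v : K) := by
      intro j
      rw [eval_addSubMap_descend, ← hv']
      have := congrFun huv j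
      rw [hw'] at this
      exact this
    obtain ⟨i, hi⟩ := Function.ne_iff.mp hw0
    have hi0 : (((addSubMap hW.descend i).eval v : K) : Qbar) ≠ 0 := by
      intro h0
      apply hi
      have := hj i
      rw [h0, mul_zero] at this
      exact_mod_cast this
    have hu' : u = ((w i / (addSubMap hW.descend i).eval v : K) : Qbar) := by
      push_cast
      rw [hj i, mul_div_cancel_right₀ _ hi0]
    refine ⟨w i / (addSubMap hW.descend i).eval v, ?_, ?_⟩
    · intro h0
      apply hu
      rw [hu', h0]
      rfl
    · funext j
      have := hj j
      rw [hu'] at this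
      exact_mod_cast this
  obtain ⟨u', hu', hwu⟩ := key
  have h4 : logHeight w = logHeight fun i => (addSubMap hW.descend i).eval v := by
    rw [hwu, logHeight_smul_eq_logHeight _ hu']
  rw [← h4] at h3
  rw [← hPh, ← hQh] at h1
  rw [← hPh', ← hQh'] at h2
  rw [le_div_iff₀ hpos, ← abs_of_pos hpos, ← abs_mul]
  rw [abs_le] at h1 h2 h3 ⊢
  constructor <;> nlinarith [h1.1, h1.2, h2.1, h2.2, h3.1, h3.2]

end EllipticPower

/-! ### The canonical height -/

namespace EllipticPower

open Filter Topology

/-- Tate's telescoping argument: consecutive terms differ by at most C/4^(n+1), which sums to C/3 ≤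
C. -/
lemma exists_tendsto_div_four_pow {u : ℕ → ℝ} {C : ℝ} (hu : ∀ n, |u (n + 1) - 4 * u n| ≤ C) :
    ∃ L, Tendsto (fun n => u n / (4 : ℝ) ^ n) atTop (𝓝 L) ∧ |u 0 - L| ≤ C := by
  have hC : 0 ≤ C := (abs_nonneg _).trans (hu 0)
  have hd : ∀ n, dist (u n / (4 : ℝ) ^ n) (u (n + 1) / (4 : ℝ) ^ (n + 1)) ≤
      C / 4 * (1 / 4 : ℝ) ^ n := by
    intro n
    have h4 : (0 : ℝ) < 4 ^ n := by positivity
    rw [dist_comm, Real.dist_eq]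
    have : u (n + 1) / (4 : ℝ) ^ (n + 1) - u n / (4 : ℝ) ^ n =
        (u (n + 1) - 4 * u n) / (4 * 4 ^ n) := by
      rw [pow_succ]; field_simp
    rw [this, abs_div, abs_of_pos (by positivity : (0 : ℝ) < 4 * 4 ^ n), div_pow, one_pow,
      div_mul_div_comm, mul_one]
    gcongr
    exact hu n
  have hr : (1 / 4 : ℝ) < 1 := by norm_num
  obtain ⟨L, hL⟩ := cauchySeq_tendsto_of_complete (cauchySeq_of_le_geometric _ _ hr hd)
  refine ⟨L, hL, ?_⟩
  have := dist_le_of_le_geometric_of_tendsto₀ _ _ hr hd hL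
  rw [Real.dist_eq, pow_zero, div_one] at this
  have h3 : C / 4 / (1 - 1 / 4) = C / 3 := by ring
  linarith

variable {W : WeierstrassCurve Qbar}

lemma xHeight_nonneg (P : W.toAffine.Point) : 0 ≤ xHeight P := by
  obtain ⟨K, hK, hW, hP⟩ := exists_field_forall_mem_rationalPoints {P} (Set.finite_singleton P)
  have : NumberField K := {}
  obtain ⟨a, b, -, -, h⟩ := exists_lift_xRep (hP P rfl)
  have hpos : (0 : ℝ) < Module.finrank ℚ K := by
    exact_mod_cast Module.finrank_pos (R := ℚ) (M := K)
  have := Height.logHeight_nonneg ![a, b]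
  rw [← h] at this
  exact nonneg_of_mul_nonneg_left this hpos

lemma xHeight_zero : xHeight (0 : W.toAffine.Point) = 0 := rfl

/-- The Tate limit of the height of the `x`-coordinate. -/
noncomputable def tateHeight (P : W.toAffine.Point) : ℝ :=
  limUnder atTop (fun n : ℕ => xHeight ((2 ^ n : ℕ) • P) / (4 : ℝ) ^ n)

lemma canonicalHeight_eq (d : ℕ) (P : W.toAffine.Point) :
    canonicalHeight d P = d / 2 * tateHeight P := rfl

variable [W.IsElliptic]

/-- The approximate parallelogram law with Q = P compares h(2P) with 4h(P), since P - P has height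
zero. The bound C is uniform over K, as needed for Northcott's theorem. -/
lemma exists_tendsto_tateHeight {K : IntermediateField ℚ Qbar} [FiniteDimensional ℚ K]
    (hW : CoeffsMem W K) :
    ∃ C : ℝ, ∀ P ∈ rationalPoints hW,
      Tendsto (fun n : ℕ => xHeight ((2 ^ n : ℕ) • P) / (4 : ℝ) ^ n) atTop (𝓝 (tateHeight P)) ∧
        |xHeight P - tateHeight P| ≤ C := by
  obtain ⟨C, hC⟩ := exists_abs_xHeight_add_sub_le hW
  refine ⟨C, fun P hP => ?_⟩
  have hu : ∀ n : ℕ, |xHeight ((2 ^ (n + 1) : ℕ) • P) - 4 * xHeight ((2 ^ n : ℕ) • P)| ≤ C := by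
    intro n
    have h := hC _ (nsmul_mem hP (2 ^ n)) _ (nsmul_mem hP (2 ^ n))
    rw [sub_self, xHeight_zero, ← two_nsmul, ← mul_smul, ← pow_succ'] at h
    convert h using 2
    ring
  obtain ⟨L, hL, hL'⟩ :=
    exists_tendsto_div_four_pow (u := fun n => xHeight ((2 ^ n : ℕ) • P)) hu
  have : tateHeight P = L := hL.limUnder_eq
  rw [this]
  refine ⟨hL, ?_⟩
  simpa using hL'

lemma tendsto_tateHeight (P : W.toAffine.Point) :
    Tendsto (fun n : ℕ => xHeight ((2 ^ n : ℕ) • P) / (4 : ℝ) ^ n) atTop (𝓝 (tateHeight P)) := by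
  obtain ⟨K, hK, hW, hP⟩ := exists_field_forall_mem_rationalPoints {P} (Set.finite_singleton P)
  obtain ⟨C, hC⟩ := exists_tendsto_tateHeight hW
  exact (hC P (hP P rfl)).1

lemma tateHeight_nonneg (P : W.toAffine.Point) : 0 ≤ tateHeight P :=
  ge_of_tendsto' (tendsto_tateHeight P) fun n => div_nonneg (xHeight_nonneg _) (by positivity)

/-- The parallelogram law. -/
lemma tateHeight_add_add_tateHeight_sub (P Q : W.toAffine.Point) :
    tateHeight (P + Q) + tateHeight (P - Q) = 2 * tateHeight P + 2 * tateHeight Q := by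
  obtain ⟨K, hK, hW, hPQ⟩ :=
    exists_field_forall_mem_rationalPoints {P, Q} (Set.toFinite {P, Q})
  obtain ⟨C, hC⟩ := exists_abs_xHeight_add_sub_le hW
  have hP := hPQ P (by simp)
  have hQ := hPQ Q (by simp)
  have h1 := ((tendsto_tateHeight (P + Q)).add (tendsto_tateHeight (P - Q))).sub
    (((tendsto_tateHeight P).const_mul 2).add ((tendsto_tateHeight Q).const_mul 2))
  have h2 : Tendsto (fun n : ℕ => C * (1 / 4 : ℝ) ^ n) atTop (𝓝 (C * 0)) :=
    (tendsto_pow_atTop_nhds_zero_of_lt_one (by norm_num) (by norm_num)).const_mul C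
  rw [mul_zero] at h2
  refine sub_eq_zero.mp (tendsto_nhds_unique h1 (squeeze_zero_norm (fun n : ℕ => ?_) h2))
  · have h := hC _ (nsmul_mem hP (2 ^ n)) _ (nsmul_mem hQ (2 ^ n))
    rw [← nsmul_add, ← nsmul_sub] at h
    have h4 : (0 : ℝ) < 4 ^ n := by positivity
    have h5 : xHeight ((2 ^ n : ℕ) • (P + Q)) / 4 ^ n + xHeight ((2 ^ n : ℕ) • (P - Q)) / 4 ^ n -
        (2 * (xHeight ((2 ^ n : ℕ) • P) / 4 ^ n) + 2 * (xHeight ((2 ^ n : ℕ) • Q) / 4 ^ n)) =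
        (xHeight ((2 ^ n : ℕ) • (P + Q)) + xHeight ((2 ^ n : ℕ) • (P - Q)) -
          2 * xHeight ((2 ^ n : ℕ) • P) - 2 * xHeight ((2 ^ n : ℕ) • Q)) / (4 : ℝ) ^ n := by
      field_simp
      ring
    rw [Real.norm_eq_abs, div_pow, one_pow, mul_one_div, h5, abs_div, abs_of_pos h4]
    gcongr

end EllipticPower

/-! ### Functions satisfying the parallelogram law -/

section Parallelogram

variable {A : Type*} [AddCommGroup A] {q : A → ℝ}

lemma parallelogram_zero
    (hq : ∀ x y, q (x + y) + q (x - y) = 2 * q x + 2 * q y) : q 0 = 0 := by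
  have := hq 0 0
  simp only [add_zero, sub_zero] at this
  linarith

/-- Jordan–von Neumann: `h1 + h3 - h2` eliminates q(x + y - z) and q(x + z - y), and `h4` then
replaces q(y - z). -/
lemma parallelogram_polar_add
    (hq : ∀ x y, q (x + y) + q (x - y) = 2 * q x + 2 * q y)
    (x y z : A) :
    q (x + (y + z)) - q x - q (y + z) = (q (x + y) - q x - q y) + (q (x + z) - q x - q z) := by
  have h1 := hq (x + y) z
  have h2 := hq x (y - z)
  have h3 := hq (x + z) y
  have h4 := hq y z
  rw [show x + y + z = x + (y + z) by abel] at h1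
  rw [show x + (y - z) = x + y - z by abel, show x - (y - z) = x + z - y by abel] at h2
  rw [show x + z + y = x + (y + z) by abel] at h3
  linarith

lemma parallelogram_polar_zsmul
    (hq : ∀ x y, q (x + y) + q (x - y) = 2 * q x + 2 * q y)
    (x y : A) (n : ℤ) :
    q (x + n • y) - q x - q (n • y) = n * (q (x + y) - q x - q y) := by
  let f : A →+ ℝ := AddMonoidHom.mk' (fun y => q (x + y) - q x - q y)
    (parallelogram_polar_add hq x)
  have := map_zsmul f n y
  simpa [f] using this

lemma parallelogram_zsmul
    (hq : ∀ x y, q (x + y) + q (x - y) = 2 * q x + 2 * q y)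
    (x : A) (n : ℤ) : q (n • x) = n ^ 2 * q x := by
  have h2 : ∀ y, q (y + y) = 4 * q y := by
    intro y
    have := hq y y
    rw [sub_self, parallelogram_zero hq] at this
    linarith
  have h3 := parallelogram_polar_zsmul hq (n • x) x n
  have h4 := parallelogram_polar_zsmul hq x x n
  rw [add_comm (n • x) x] at h3
  rw [h2] at h3 h4
  linear_combination (1 / 2 : ℝ) * h3 + (n / 2 : ℝ) * h4

/-- Cauchy–Schwarz. On an abelian group only integral combinations mx + ny are available; their
positivity gives that of a quadratic polynomial at rational t by clearing denominators, then at real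
t by density, so its discriminant is not positive. -/
lemma parallelogram_polar_sq_le
    (hq : ∀ x y, q (x + y) + q (x - y) = 2 * q x + 2 * q y)
    (hq0 : ∀ x, 0 ≤ q x) (x y : A) :
    (q (x + y) - q x - q y) ^ 2 ≤ 4 * q x * q y := by
  set b := q (x + y) - q x - q y with hb
  have h_int : ∀ m n : ℤ, 0 ≤ (m : ℝ) ^ 2 * q x + m * n * b + n ^ 2 * q y := by
    intro m n
    have h1 := hq0 (n • y + m • x)
    have h2 := parallelogram_polar_zsmul hq (n • y) x m
    have h3 := parallelogram_polar_zsmul hq x y n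
    rw [add_comm (n • y) x] at h2
    rw [parallelogram_zsmul hq x, parallelogram_zsmul hq y] at h2
    rw [parallelogram_zsmul hq y, ← hb] at h3
    have h4 : q (n • y + m • x) = m ^ 2 * q x + m * n * b + n ^ 2 * q y := by
      linear_combination h2 + m * h3
    rwa [← h4]
  have hrat : ∀ t : ℚ, 0 ≤ q x * ((t : ℝ) * t) + b * t + q y := by
    intro t
    have h1 := h_int t.num t.den
    have hden : (0 : ℝ) < t.den := by exact_mod_cast t.den_pos
    have ht : (t : ℝ) = t.num / t.den := by exact_mod_cast (Rat.num_div_den t).symm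
    have h2 : q x * ((t : ℝ) * t) + b * t + q y =
        ((t.num : ℝ) ^ 2 * q x + t.num * ((t.den : ℤ) : ℝ) * b + ((t.den : ℤ) : ℝ) ^ 2 * q y) /
          (t.den : ℝ) ^ 2 := by
      rw [ht]
      push_cast
      field_simp
    rw [h2]
    positivity
  have hreal : ∀ t : ℝ, 0 ≤ q x * (t * t) + b * t + q y := by
    intro t
    refine Rat.isDenseEmbedding_coe_real.dense.induction_on
      (p := fun t : ℝ => 0 ≤ q x * (t * t) + b * t + q y) t ?_ hrat
    exact isClosed_le continuous_const (by fun_prop)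
  have := discrim_le_zero hreal
  rw [discrim] at this
  linarith

lemma parallelogram_sqrt_add_le
    (hq : ∀ x y, q (x + y) + q (x - y) = 2 * q x + 2 * q y)
    (hq0 : ∀ x, 0 ≤ q x) (x y : A) : √(q (x + y)) ≤ √(q x) + √(q y) := by
  rw [Real.sqrt_le_left (by positivity), add_sq, Real.sq_sqrt (hq0 x), Real.sq_sqrt (hq0 y)]
  have h1 := parallelogram_polar_sq_le hq hq0 x y
  have h2 : q (x + y) - q x - q y ≤ 2 * √(q x) * √(q y) := by
    refine le_of_sq_le_sq ?_ (by positivity)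
    rw [mul_pow, mul_pow, Real.sq_sqrt (hq0 x), Real.sq_sqrt (hq0 y)]
    linarith
  linarith

end Parallelogram

/-! ### The seminorm on points -/

namespace EllipticPower

variable {W : WeierstrassCurve Qbar}

lemma ptNorm_nonneg (d : ℕ) (P : W.toAffine.Point) : 0 ≤ ptNorm d P := Real.sqrt_nonneg _

variable [W.IsElliptic]

lemma canonicalHeight_add_add_canonicalHeight_sub (d : ℕ) (P Q : W.toAffine.Point) :
    canonicalHeight d (P + Q) + canonicalHeight d (P - Q) =
      2 * canonicalHeight d P + 2 * canonicalHeight d Q := by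
  simp only [canonicalHeight_eq]
  linear_combination (d : ℝ) / 2 * tateHeight_add_add_tateHeight_sub P Q

lemma canonicalHeight_nonneg (d : ℕ) (P : W.toAffine.Point) : 0 ≤ canonicalHeight d P := by
  rw [canonicalHeight_eq]
  have := tateHeight_nonneg P
  positivity

lemma ptNorm_add_le (d : ℕ) (P Q : W.toAffine.Point) :
    ptNorm d (P + Q) ≤ ptNorm d P + ptNorm d Q :=
  parallelogram_sqrt_add_le (canonicalHeight_add_add_canonicalHeight_sub d)
    (canonicalHeight_nonneg d) P Q

lemma ptNorm_zsmul (d : ℕ) (n : ℤ) (P : W.toAffine.Point) :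
    ptNorm d (n • P) = |(n : ℝ)| * ptNorm d P := by
  rw [ptNorm, parallelogram_zsmul (canonicalHeight_add_add_canonicalHeight_sub d),
    Real.sqrt_mul (sq_nonneg _), Real.sqrt_sq_eq_abs, ptNorm]

lemma ptNorm_zero (d : ℕ) : ptNorm d (0 : W.toAffine.Point) = 0 := by
  simpa using ptNorm_zsmul d 0 (0 : W.toAffine.Point)

lemma ptNorm_neg (d : ℕ) (P : W.toAffine.Point) : ptNorm d (-P) = ptNorm d P := by
  simpa using ptNorm_zsmul d (-1) P

lemma ptNorm_sub_le (d : ℕ) (P Q : W.toAffine.Point) :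
    ptNorm d (P - Q) ≤ ptNorm d P + ptNorm d Q := by
  rw [sub_eq_add_neg, ← ptNorm_neg d Q]
  exact ptNorm_add_le d P (-Q)

lemma ptNorm_sum_le (d : ℕ) {ι : Type*} (s : Finset ι) (f : ι → W.toAffine.Point) :
    ptNorm d (∑ i ∈ s, f i) ≤ ∑ i ∈ s, ptNorm d (f i) :=
  Finset.le_sum_of_subadditive (ptNorm d) (ptNorm_zero d).le (ptNorm_add_le d) s f

/-- This is why it suffices, throughout, to know abelian subvarieties up to torsion. -/
lemma ptNorm_eq_zero_of_zsmul_eq_zero (d : ℕ) {n : ℤ} (hn : n ≠ 0) {P : W.toAffine.Point}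
    (h : n • P = 0) : ptNorm d P = 0 := by
  have := ptNorm_zsmul d n P
  rw [h, ptNorm_zero] at this
  have hn' : |(n : ℝ)| ≠ 0 := by simpa using hn
  exact (mul_eq_zero.mp this.symm).resolve_left hn'

end EllipticPower

/-! ### Positivity of the height on independent points -/

namespace EllipticPower

open WeierstrassCurve WeierstrassCurve.Affine Height NumberField

variable {W : WeierstrassCurve Qbar}

/-- Northcott's theorem for the x-coordinates in K, each of which is shared only by P and -P. -/
lemma finite_setOf_xHeight_le {K : IntermediateField ℚ Qbar} [FiniteDimensional ℚ K]
    (hW : CoeffsMem W K) (T : ℝ) :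
    {P : W.toAffine.Point | P ∈ rationalPoints hW ∧ xHeight P ≤ T}.Finite := by
  have : NumberField K := {}
  have hpos : (0 : ℝ) < Module.finrank ℚ K := by
    exact_mod_cast Module.finrank_pos (R := ℚ) (M := K)
  have hfin := finite_setOfPred_logHeight₁_le K (T * Module.finrank ℚ K)
  refine Set.Finite.of_finite_fibers Point.xRep ?_ ?_
  · refine ((hfin.image fun x : K => ![(x : Qbar), 1]).insert ![1, 0]).subset ?_
    rintro _ ⟨P, ⟨hP, hPT⟩, rfl⟩
    match P with
    | .zero => exact Or.inl rfl
    | .some x y h =>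
      refine Or.inr ⟨⟨x, hP 0⟩, ?_, rfl⟩
      rw [xHeight, absLogHeight₁_eq_logHeight₁_div K ⟨x, hP 0⟩, div_le_iff₀ hpos] at hPT
      exact hPT
  · rintro _ ⟨P, -, rfl⟩
    refine (Set.toFinite {P, -P}).subset ?_
    rintro Q ⟨-, hQ⟩
    exact Point.eq_or_eq_neg_of_xRep_eq_xRep hQ

variable [W.IsElliptic]

/-- All the combinations are defined over one number field, where the canonical height differs from
the naive one by a bounded amount; Northcott leaves finitely many points, and independence makes b
determined by its point. -/
lemma finite_setOf_ptNorm_sum_le {d : ℕ} (hd : 0 < d) {s : ℕ} {p : EPow W s}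
    (hp : LinearIndependent ℤ p) (T : ℝ) :
    {b : Fin s → ℤ | ptNorm d (∑ i, b i • p i) ≤ T}.Finite := by
  obtain ⟨K, hK, hW, hmem⟩ :=
    exists_field_forall_mem_rationalPoints (Set.range p) (Set.finite_range p)
  obtain ⟨C, hC⟩ := exists_tendsto_tateHeight hW
  have hfin := finite_setOf_xHeight_le hW (C + T ^ 2 * 2 / d)
  have hinj : Function.Injective fun b : Fin s → ℤ => ∑ i, b i • p i := by
    intro b b' h
    have h0 := Fintype.linearIndependent_iff.mp hp (fun i => b i - b' i) (by
      simp only [sub_smul, Finset.sum_sub_distrib]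
      exact sub_eq_zero.mpr h)
    funext i
    exact sub_eq_zero.mp (h0 i)
  refine (hfin.preimage hinj.injOn).subset ?_
  intro b hb
  have hbK : ∑ i, b i • p i ∈ rationalPoints hW :=
    sum_mem fun i _ => zsmul_mem (hmem _ ⟨i, rfl⟩) _
  refine ⟨hbK, ?_⟩
  have hd' : (0 : ℝ) < d := by exact_mod_cast hd
  have h1 : canonicalHeight d (∑ i, b i • p i) ≤ T ^ 2 :=
    Real.sqrt_le_iff.mp hb |>.2
  rw [canonicalHeight_eq] at h1
  have h2 : tateHeight (∑ i, b i • p i) ≤ T ^ 2 * 2 / d := by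
    rw [le_div_iff₀ hd']
    linarith
  have h3 := (abs_le.mp (hC _ hbK).2).2
  linarith

/-- The height is positive definite on the span of independent points. -/
lemma exists_pos_mul_abs_le_ptNorm_sum {d : ℕ} (hd : 0 < d) {s : ℕ} {p : EPow W s}
    (hp : LinearIndependent ℤ p) :
    ∃ c₀ : ℝ, 0 < c₀ ∧ ∀ (b : Fin s → ℤ) (i : Fin s),
      c₀ * |(b i : ℝ)| ≤ ptNorm d (∑ i, b i • p i) := by
  -- The 1 will bound a rescaled combination, the sum the remainders left by rounding its
  -- coefficients.
  set T : ℝ := 1 + ∑ i, ptNorm d (p i) with hT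
  have hfin := finite_setOf_ptNorm_sum_le hd hp T
  obtain ⟨M, hM⟩ : ∃ M : ℕ, ∀ b : Fin s → ℤ, ptNorm d (∑ i, b i • p i) ≤ T →
      ∀ i, (b i).natAbs ≤ M := by
    obtain ⟨M, hM⟩ := (hfin.image fun b : Fin s → ℤ => ∑ i, (b i).natAbs).bddAbove
    refine ⟨M, fun b hb i => le_trans ?_ (hM ⟨b, hb, rfl⟩)⟩
    exact Finset.single_le_sum (f := fun i => (b i).natAbs) (fun _ _ => Nat.zero_le _)
      (Finset.mem_univ i)
  have hm : (0 : ℝ) < (M : ℝ) + 1 := by positivity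
  refine ⟨1 / ((M : ℝ) + 1), by positivity, fun b i => ?_⟩
  by_contra! hlt
  obtain ⟨j, -, hj⟩ := Finset.exists_max_image Finset.univ (fun i => |b i|) ⟨i, Finset.mem_univ i⟩
  set β := |b j| with hβ
  have hbi : (|b i| : ℝ) ≤ β := by exact_mod_cast hj i (Finset.mem_univ i)
  have hNb : ptNorm d (∑ i, b i • p i) * ((M : ℝ) + 1) < β := by
    rw [one_div, inv_mul_eq_div, lt_div_iff₀ hm] at hlt
    linarith
  have hβ0 : 0 < β := by
    have : (0 : ℝ) < β := lt_of_le_of_lt (mul_nonneg (ptNorm_nonneg _ _) hm.le) hNb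
    exact_mod_cast this
  have hβ0' : (0 : ℝ) < β := by exact_mod_cast hβ0
  -- If ∑ b_i p_i were too short, scaling b so that its largest coefficient becomes ±(M + 1) and
  -- rounding the others would still give a point of norm at most T.
  set c : Fin s → ℤ := fun i => ((M + 1 : ℕ) : ℤ) * b i / β with hc
  have hcN : ptNorm d (∑ i, c i • p i) ≤ T := by
    have h1 : β • ∑ i, c i • p i = ((M + 1 : ℕ) : ℤ) • ∑ i, b i • p i -
        ∑ i, (((M + 1 : ℕ) : ℤ) * b i % β) • p i := by
      rw [Finset.smul_sum, Finset.smul_sum, ← Finset.sum_sub_distrib]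
      refine Finset.sum_congr rfl fun i _ => ?_
      rw [smul_smul, smul_smul, ← sub_smul]
      congr 1
      have := Int.mul_ediv_add_emod (((M + 1 : ℕ) : ℤ) * b i) β
      simp only [hc]
      linarith
    have h2 : ptNorm d (β • ∑ i, c i • p i) ≤ β * T := by
      rw [h1]
      refine (ptNorm_sub_le _ _ _).trans ?_
      have h3 : ptNorm d (((M + 1 : ℕ) : ℤ) • ∑ i, b i • p i) ≤ β := by
        rw [ptNorm_zsmul]
        push_cast
        rw [abs_of_pos hm]
        linarith
      have h4 : ptNorm d (∑ i, (((M + 1 : ℕ) : ℤ) * b i % β) • p i) ≤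
          ∑ i, β * ptNorm d (p i) := by
        refine (ptNorm_sum_le _ _ _).trans (Finset.sum_le_sum fun i _ => ?_)
        rw [ptNorm_zsmul]
        refine mul_le_mul_of_nonneg_right ?_ (ptNorm_nonneg _ _)
        have h5 := Int.emod_nonneg (((M + 1 : ℕ) : ℤ) * b i) hβ0.ne'
        have h6 := Int.emod_lt_of_pos (((M + 1 : ℕ) : ℤ) * b i) hβ0
        rw [abs_of_nonneg (by exact_mod_cast h5)]
        exact_mod_cast h6.le
      rw [← Finset.mul_sum] at h4
      rw [hT]
      linarith
    rw [ptNorm_zsmul, abs_of_pos hβ0'] at h2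
    exact le_of_mul_le_mul_left h2 hβ0'
  -- At the largest coefficient the division is exact, so the rounded vector violates the bound M on
  -- coefficients.
  have hcj : (c j).natAbs = M + 1 := by
    rcases abs_choice (b j) with h | h
    · have : c j = ((M + 1 : ℕ) : ℤ) := by
        simp only [hc]
        rw [← h]
        exact Int.mul_ediv_cancel _ hβ0.ne'
      rw [this]; rfl
    · have : c j = -((M + 1 : ℕ) : ℤ) := by
        simp only [hc]
        rw [show b j = -β by omega, mul_neg, ← neg_mul]
        exact Int.mul_ediv_cancel _ hβ0.ne'
      rw [this, Int.natAbs_neg]; rfl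
  have := hM c hcN j
  omega

lemma ptNorm_pos_of_linearIndependent {d : ℕ} (hd : 0 < d) {s : ℕ} {p : EPow W s}
    (hp : LinearIndependent ℤ p) (i : Fin s) : 0 < ptNorm d (p i) := by
  obtain ⟨c₀, hc₀, h⟩ := exists_pos_mul_abs_le_ptNorm_sum hd hp
  have := h (Pi.single i 1) i
  rw [Finset.sum_eq_single i (fun j _ hj => by simp [Pi.single_eq_of_ne hj]) (by simp)] at this
  simp only [Pi.single_eq_same, Int.cast_one, abs_one, mul_one, one_smul] at this
  linarith

/-- With β = max |b_i|, the unperturbed sum has norm at least c₀ β. The perturbation has s + 1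
terms, each of norm at most β ε since |b'| ≤ β, so ε = c₀/(2(s + 1)) consumes only half of this. -/
lemma exists_areConstants {d : ℕ} (hd : 0 < d) {s : ℕ} {p : EPow W s}
    (hp : LinearIndependent ℤ p) : ∃ c ε₀ : ℝ, AreConstants d p c ε₀ := by
  obtain ⟨c₀, hc₀, hlow⟩ := exists_pos_mul_abs_le_ptNorm_sum hd hp
  -- The summand 1 keeps D positive even for s = 0.
  set D : ℝ := 1 + ∑ i, ptNorm d (p i) ^ 2 with hD
  have hD0 : 0 < D := by positivity
  have hs : (0 : ℝ) < (s : ℝ) + 1 := by positivity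
  set ε := c₀ / (2 * ((s : ℝ) + 1)) with hε
  have hε0 : 0 < ε := by positivity
  refine ⟨(c₀ / 2) ^ 2 / D, ε, by positivity, hε0, ?_⟩
  rintro b b' ⟨i, hi⟩ ξ ζ hξ hζ
  obtain ⟨j, -, hj⟩ := Finset.exists_max_image Finset.univ (fun i => |b i|) ⟨i, Finset.mem_univ i⟩
  set β : ℝ := |(b j : ℝ)| with hβ
  have hβ0 : 0 ≤ β := abs_nonneg _
  have hbβ : ∀ i, |(b i : ℝ)| ≤ β := fun i => by
    rw [hβ]; exact_mod_cast hj i (Finset.mem_univ i)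
  have hb'β : |(b' : ℝ)| ≤ β := le_trans (by exact_mod_cast hi) (hbβ i)
  have h1 : ∑ i, b i • p i =
      (∑ i, b i • (p i - ξ i) - b' • ζ) + (∑ i, b i • ξ i + b' • ζ) := by
    simp only [zsmul_sub, Finset.sum_sub_distrib]
    abel
  have h2 : ptNorm d (∑ i, b i • ξ i + b' • ζ) ≤ (s + 1) * (β * ε) := by
    refine (ptNorm_add_le _ _ _).trans ?_
    have h3 : ptNorm d (∑ i, b i • ξ i) ≤ s * (β * ε) := by
      refine (ptNorm_sum_le _ _ _).trans ?_
      have : ∀ i ∈ Finset.univ, ptNorm d (b i • ξ i) ≤ β * ε := fun i _ => by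
        rw [ptNorm_zsmul]
        exact mul_le_mul (hbβ i) (hξ i) (ptNorm_nonneg _ _) hβ0
      simpa using Finset.sum_le_card_nsmul _ _ _ this
    have h4 : ptNorm d (b' • ζ) ≤ β * ε := by
      rw [ptNorm_zsmul]
      exact mul_le_mul hb'β hζ (ptNorm_nonneg _ _) hβ0
    linarith
  have h5 : (s + 1) * (β * ε) = c₀ / 2 * β := by
    rw [hε]; field_simp
  have h6 : c₀ / 2 * β ≤ ptNorm d (∑ i, b i • (p i - ξ i) - b' • ζ) := by
    have h7 := hlow b j
    have h8 := ptNorm_add_le d (∑ i, b i • (p i - ξ i) - b' • ζ) (∑ i, b i • ξ i + b' • ζ)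
    rw [← h1] at h8
    linarith
  have h9 : ∑ i, |(b i : ℝ)| ^ 2 * ptNorm d (p i) ^ 2 ≤ β ^ 2 * D := by
    rw [hD, mul_add, Finset.mul_sum]
    have : ∑ i, |(b i : ℝ)| ^ 2 * ptNorm d (p i) ^ 2 ≤ ∑ i, β ^ 2 * ptNorm d (p i) ^ 2 :=
      Finset.sum_le_sum fun i _ => mul_le_mul_of_nonneg_right
        (pow_le_pow_left₀ (abs_nonneg _) (hbβ i) 2) (sq_nonneg _)
    have := sq_nonneg β
    linarith
  have h10 : (c₀ / 2) ^ 2 / D * (β ^ 2 * D) = (c₀ / 2 * β) ^ 2 := by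
    rw [mul_comm (β ^ 2), ← mul_assoc, div_mul_cancel₀ _ hD0.ne', mul_pow]
  have h11 : (c₀ / 2 * β) ^ 2 ≤ ptNorm d (∑ i, b i • (p i - ξ i) - b' • ζ) ^ 2 :=
    pow_le_pow_left₀ (mul_nonneg (half_pos hc₀).le hβ0) h6 2
  exact (mul_le_mul_of_nonneg_left h9 (div_nonneg (sq_nonneg _) hD0.le)).trans (h10.trans_le h11)

end EllipticPower

/-! ### Multihomogeneous polynomials and the Zariski topology -/

namespace EllipticPower

open MvPolynomial

/-- Polynomials in `n` blocks of three variables. -/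
abbrev BlockPoly (n : ℕ) : Type := MvPolynomial (Fin n × Fin 3) Qbar

section Multihomogeneous

variable {n : ℕ}

theorem weight_block_apply (d : (Fin n × Fin 3) →₀ ℕ) (i : Fin n) :
    (Finsupp.weight (fun q : Fin n × Fin 3 => (Pi.single q.1 1 : Fin n → ℕ)) d) i =
      ∑ j, d (i, j) := by
  classical
  rw [Finsupp.weight_apply, Finsupp.sum_fintype _ _ (by simp), Finset.sum_apply,
    Fintype.sum_prod_type]
  rw [Finset.sum_eq_single i]
  · simp
  · intro b _ hb
    simp [Ne.symm hb]
  · simp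

theorem prod_block_pow (d : (Fin n × Fin 3) →₀ ℕ) (l : Fin n → Qbar) :
    ∏ q : Fin n × Fin 3, l q.1 ^ d q = ∏ i, l i ^ (∑ j, d (i, j)) := by
  rw [Fintype.prod_prod_type]
  refine Finset.prod_congr rfl fun i _ => ?_
  exact Finset.prod_pow_eq_pow_sum Finset.univ (fun j => d (i, j)) (l i)

theorem eval_monomial_block_smul (d : (Fin n × Fin 3) →₀ ℕ) (a : Qbar) (l : Fin n → Qbar)
    (v : Fin n × Fin 3 → Qbar) :
    eval (fun q => l q.1 * v q) (monomial d a) =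
      (∏ i, l i ^ (∑ j, d (i, j))) * eval v (monomial d a) := by
  rw [eval_monomial, eval_monomial, Finsupp.prod_fintype _ _ (by simp),
    Finsupp.prod_fintype _ _ (by simp), ← prod_block_pow]
  simp only [mul_pow, Finset.prod_mul_distrib]
  ring

/-- A polynomial is multihomogeneous of degree `m` if and only if it scales accordingly. -/
theorem isMultihomogeneous_iff_eval (F : BlockPoly n) (m : Fin n → ℕ) :
    IsMultihomogeneous F m ↔ ∀ (l : Fin n → Qbar) (v : Fin n × Fin 3 → Qbar),
      eval (fun q => l q.1 * v q) F = (∏ i, l i ^ m i) * eval v F := by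
  constructor
  · intro h l v
    conv_lhs => rw [F.as_sum]
    conv_rhs => rw [F.as_sum]
    rw [map_sum, map_sum, Finset.mul_sum]
    refine Finset.sum_congr rfl fun d hd => ?_
    rw [eval_monomial_block_smul]
    have := h (mem_support_iff.mp hd)
    congr 1
    refine Finset.prod_congr rfl fun i _ => ?_
    rw [← weight_block_apply, this]
  · intro h d hd
    funext i
    rw [weight_block_apply]
    -- Scaling only the block i by 2 isolates the degree in that block: comparing coefficients gives
    -- an equality of powers of 2.
    let l : Fin n → Qbar := fun k => if k = i then 2 else 1
    have key : bind₁ (fun q : Fin n × Fin 3 => C (l q.1) * X q) F = C (∏ i, l i ^ m i) * F := by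
      refine MvPolynomial.funext fun v => ?_
      rw [map_mul, eval_C, ← h l v]
      rw [← coe_aeval_eq_eval, AlgHom.coe_toRingHom, aeval_bind₁]
      rw [← coe_aeval_eq_eval, AlgHom.coe_toRingHom]
      congr 1
      congr 1
      funext q
      simp
    have hco : coeff d (bind₁ (fun q : Fin n × Fin 3 => C (l q.1) * X q) F) =
        (∏ i, l i ^ (∑ j, d (i, j))) * coeff d F := by
      conv_lhs => rw [F.as_sum]
      rw [map_sum, coeff_sum]
      rw [Finset.sum_eq_single d]
      · rw [bind₁_monomial, coeff_C_mul]
        simp only [mul_pow, Finset.prod_mul_distrib, ← map_pow, ← map_prod]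
        rw [coeff_C_mul]
        have : (∏ q ∈ d.support, (X q : BlockPoly n) ^ d q) = monomial d 1 := by
          rw [monomial_eq]; simp [Finsupp.prod]
        rw [this, coeff_monomial, if_pos rfl, mul_one, mul_comm, ← prod_block_pow]
        congr 1
        refine Finset.prod_subset (Finset.subset_univ _) fun q _ hq => ?_
        rw [Finsupp.notMem_support_iff.mp hq, pow_zero]
      · intro b _ hb
        rw [bind₁_monomial, coeff_C_mul]
        simp only [mul_pow, Finset.prod_mul_distrib, ← map_pow, ← map_prod]
        rw [coeff_C_mul]
        have : (∏ q ∈ b.support, (X q : BlockPoly n) ^ b q) = monomial b 1 := by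
          rw [monomial_eq]; simp [Finsupp.prod]
        rw [this, coeff_monomial, if_neg hb, mul_zero, mul_zero]
      · intro hd'
        exact absurd (mem_support_iff.mpr hd) hd'
    rw [key, coeff_C_mul] at hco
    have h2 := mul_right_cancel₀ hd hco
    have hl : ∀ e : Fin n → ℕ, ∏ k, l k ^ e k = (2 : Qbar) ^ e i := by
      intro e
      rw [Finset.prod_eq_single i]
      · simp [l]
      · intro b _ hb
        simp [l, hb]
      · simp
    rw [hl, hl] at h2
    have h3 : ((2 ^ m i : ℕ) : Qbar) = ((2 ^ (∑ j, d (i, j)) : ℕ) : Qbar) := by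
      push_cast; exact h2
    exact (Nat.pow_right_injective le_rfl (Nat.cast_injective h3)).symm

theorem eval_bind₁_block {n' : ℕ} (G : Fin n' × Fin 3 → BlockPoly n) (F : BlockPoly n')
    (v : Fin n × Fin 3 → Qbar) :
    eval v (bind₁ G F) = eval (fun q => eval v (G q)) F := by
  rw [← coe_aeval_eq_eval, AlgHom.coe_toRingHom, aeval_bind₁, ← coe_aeval_eq_eval,
    AlgHom.coe_toRingHom]

/-- By the scaling criterion, rescaling the inner variables rescales the outer block i by ∏ l_k ^
D_ik. -/
theorem IsMultihomogeneous.bind₁ {n' : ℕ} {F : BlockPoly n'} {m : Fin n' → ℕ}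
    (hF : IsMultihomogeneous F m) {G : Fin n' → Fin 3 → BlockPoly n} {D : Fin n' → Fin n → ℕ}
    (hG : ∀ i j, IsMultihomogeneous (G i j) (D i)) :
    IsMultihomogeneous (MvPolynomial.bind₁ (fun q => G q.1 q.2) F)
      (fun k => ∑ i, m i * D i k) := by
  rw [isMultihomogeneous_iff_eval] at hF ⊢
  intro l v
  rw [eval_bind₁_block, eval_bind₁_block]
  have : (fun q : Fin n' × Fin 3 => eval (fun q => l q.1 * v q) (G q.1 q.2)) =
      fun q => (∏ k, l k ^ D q.1 k) * eval v (G q.1 q.2) := by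
    funext q
    exact (isMultihomogeneous_iff_eval _ _).mp (hG q.1 q.2) l v
  rw [this, hF (fun i => ∏ k, l k ^ D i k)]
  congr 1
  simp only [← Finset.prod_pow, ← pow_mul]
  rw [Finset.prod_comm]
  refine Finset.prod_congr rfl fun k _ => ?_
  rw [Finset.prod_pow_eq_pow_sum]
  simp only [mul_comm]

theorem IsMultihomogeneous.mul {F G : BlockPoly n} {m m' : Fin n → ℕ}
    (hF : IsMultihomogeneous F m) (hG : IsMultihomogeneous G m') :
    IsMultihomogeneous (F * G) (m + m') :=
  MvPolynomial.IsWeightedHomogeneous.mul hF hG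

theorem isMultihomogeneous_X (q : Fin n × Fin 3) :
    IsMultihomogeneous (X q : BlockPoly n) (Pi.single q.1 1) :=
  MvPolynomial.isWeightedHomogeneous_X _ _ _

theorem isMultihomogeneous_one : IsMultihomogeneous (1 : BlockPoly n) 0 :=
  MvPolynomial.isWeightedHomogeneous_one _ _

end Multihomogeneous

section Topology

variable {W : WeierstrassCurve Qbar} {n : ℕ}

theorem evalAt_mul (F G : BlockPoly n) (x : EPow W n) :
    evalAt (F * G) x = evalAt F x * evalAt G x := map_mul _ _ _

theorem isOpen_evalAt_ne {F : BlockPoly n} {m : Fin n → ℕ} (hF : IsMultihomogeneous F m) :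
    IsOpen {x : EPow W n | evalAt F x ≠ 0} :=
  TopologicalSpace.isOpen_generateFrom_of_mem ⟨F, m, hF, rfl⟩

theorem isTopologicalBasis_evalAt_ne :
    TopologicalSpace.IsTopologicalBasis
      {U | ∃ (F : BlockPoly n) (m : Fin n → ℕ),
        IsMultihomogeneous F m ∧ U = {x : EPow W n | evalAt F x ≠ 0}} where
  exists_subset_inter := by
    rintro _ ⟨F, m, hF, rfl⟩ _ ⟨G, m', hG, rfl⟩ x ⟨h1, h2⟩
    refine ⟨_, ⟨F * G, m + m', hF.mul hG, rfl⟩, ?_, ?_⟩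
    · exact (evalAt_mul F G x).trans_ne (mul_ne_zero h1 h2)
    · intro y hy
      have hy' : evalAt F y * evalAt G y ≠ 0 := (evalAt_mul F G y).symm.trans_ne hy
      exact ⟨left_ne_zero_of_mul hy', right_ne_zero_of_mul hy'⟩
  sUnion_eq := by
    refine Set.eq_univ_of_forall fun x => ?_
    refine ⟨_, ⟨1, 0, isMultihomogeneous_one, rfl⟩, ?_⟩
    change evalAt 1 x ≠ 0
    simp [evalAt]
  eq_generateFrom := rfl

theorem exists_evalAt_ne_of_mem {U : Set (EPow W n)} (hU : IsOpen U) {x : EPow W n} (hx : x ∈ U) :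
    ∃ (F : BlockPoly n) (m : Fin n → ℕ), IsMultihomogeneous F m ∧ evalAt F x ≠ 0 ∧
      ∀ y, evalAt F y ≠ 0 → y ∈ U := by
  obtain ⟨_, ⟨F, m, hF, rfl⟩, h1, h2⟩ :=
    isTopologicalBasis_evalAt_ne.exists_subset_of_mem_open hx hU
  exact ⟨F, m, hF, h1, fun y hy => h2 hy⟩

theorem exists_evalAt_of_notMem {Z : Set (EPow W n)} (hZ : IsClosed Z) {x : EPow W n}
    (hx : x ∉ Z) :
    ∃ (F : BlockPoly n) (m : Fin n → ℕ), IsMultihomogeneous F m ∧ evalAt F x ≠ 0 ∧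
      ∀ y ∈ Z, evalAt F y = 0 := by
  obtain ⟨F, m, hF, h1, h2⟩ := exists_evalAt_ne_of_mem hZ.isOpen_compl hx
  exact ⟨F, m, hF, h1, fun y hy => by_contra fun h => h2 y h hy⟩

theorem isClosed_of_forall_exists {Z : Set (EPow W n)}
    (h : ∀ x ∉ Z, ∃ (F : BlockPoly n) (m : Fin n → ℕ), IsMultihomogeneous F m ∧ evalAt F x ≠ 0 ∧
      ∀ y ∈ Z, evalAt F y = 0) : IsClosed Z := by
  rw [← isOpen_compl_iff, isOpen_iff_forall_mem_open]
  intro x hx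
  obtain ⟨F, m, hF, h1, h2⟩ := h x hx
  exact ⟨_, fun y (hy : evalAt F y ≠ 0) hy' => hy (h2 y hy'), isOpen_evalAt_ne hF, h1⟩

/-- The polynomials vanishing at the chosen coordinates of the points of `Z`. -/
noncomputable def vanishing (Z : Set (EPow W n)) : Ideal (BlockPoly n) :=
  MvPolynomial.vanishingIdeal Qbar ((fun x (q : Fin n × Fin 3) => coords (x q.1) q.2) '' Z)

theorem mem_vanishing {Z : Set (EPow W n)} {F : BlockPoly n} :
    F ∈ vanishing Z ↔ ∀ x ∈ Z, evalAt F x = 0 := by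
  simp [vanishing, MvPolynomial.mem_vanishingIdeal_iff, evalAt, aeval_eq_eval]

/-- A closed set is determined by the polynomials vanishing on it, so a descending chain of closed
sets is an ascending chain of ideals, and Hilbert's basis theorem applies. -/
instance : TopologicalSpace.NoetherianSpace (EPow W n) := by
  refine ((TopologicalSpace.noetherianSpace_TFAE (EPow W n)).out 0 1 :).mpr ?_
  have hmono : StrictAnti (fun Z : TopologicalSpace.Closeds (EPow W n) =>
      vanishing (Z : Set (EPow W n))) := by
    intro Z Z' h
    have hle : vanishing (Z' : Set (EPow W n)) ≤ vanishing (Z : Set (EPow W n)) :=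
      fun F hF => mem_vanishing.mpr fun x hx => mem_vanishing.mp hF x (h.le hx)
    refine lt_of_le_not_ge hle fun hge => ?_
    obtain ⟨x, hx, hx'⟩ := Set.exists_of_ssubset (show (Z : Set (EPow W n)) ⊂ Z' from h)
    obtain ⟨F, m, -, h1, h2⟩ := exists_evalAt_of_notMem Z.isClosed hx'
    exact h1 (mem_vanishing.mp (hge (mem_vanishing.mpr h2)) x hx)
  exact hmono.wellFoundedLT

end Topology

end EllipticPower

/-! ### Regular maps -/

namespace EllipticPower

open MvPolynomial

variable {W : WeierstrassCurve Qbar} {n : ℕ}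

/-- Around `x`, the map `ψ : E^n → E` is given by multihomogeneous polynomials. -/
def HasLocalRep (ψ : EPow W n → W.toAffine.Point) (x : EPow W n) : Prop :=
  ∃ (F : Fin 3 → BlockPoly n) (m : Fin n → ℕ) (c : EPow W n → Qbar),
    (∀ j, IsMultihomogeneous (F j) m) ∧ c x ≠ 0 ∧ ∀ y j, evalAt (F j) y = c y * coords (ψ y) j

/-- `ψ : E^n → E^m` is a morphism of varieties. -/
def IsMorphism {m : ℕ} (ψ : EPow W n → EPow W m) : Prop :=
  ∀ x k, HasLocalRep (fun y => ψ y k) x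

theorem exists_coords_ne_zero (P : W.toAffine.Point) : ∃ j, coords P j ≠ 0 := by
  match P with
  | .zero => exact ⟨1, by simp [coords]⟩
  | .some _ _ _ => exact ⟨2, by simp [coords]⟩

theorem coords_some {x y : Qbar} (h : W.toAffine.Nonsingular x y) :
    coords (.some x y h : W.toAffine.Point) = ![x, y, 1] := rfl

/-- A multihomogeneous polynomial in the image of a map given by local formulas. -/
theorem exists_pullback {m : ℕ} {ψ : EPow W n → EPow W m} {x : EPow W n}
    (hψ : ∀ k, HasLocalRep (fun y => ψ y k) x) :
    ∃ (F : Fin m → Fin 3 → BlockPoly n) (D : Fin m → Fin n → ℕ) (c : Fin m → EPow W n → Qbar),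
      (∀ i j, IsMultihomogeneous (F i j) (D i)) ∧ (∀ k, c k x ≠ 0) ∧
      ∀ (G : BlockPoly m) (M : Fin m → ℕ), IsMultihomogeneous G M → ∀ y,
        evalAt (bind₁ (fun q => F q.1 q.2) G) y = (∏ k, c k y ^ M k) * evalAt G (ψ y) := by
  choose F D c h1 h2 h3 using hψ
  refine ⟨F, D, c, h1, h2, fun G M hG y => ?_⟩
  rw [evalAt, eval_bind₁_block, evalAt, ← (isMultihomogeneous_iff_eval G M).mp hG]
  congr 2
  funext q
  exact h3 q.1 y q.2

/-- The identity between polynomials and coordinates holds at every point, with a scale factor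
allowed to vanish away from x. Local formulas therefore compose without shrinking neighbourhoods,
and the scale factors multiply. -/
theorem HasLocalRep.comp {m : ℕ} {φ : EPow W m → W.toAffine.Point} {ψ : EPow W n → EPow W m}
    {x : EPow W n} (hφ : HasLocalRep φ (ψ x)) (hψ : ∀ k, HasLocalRep (fun y => ψ y k) x) :
    HasLocalRep (fun y => φ (ψ y)) x := by
  obtain ⟨F, D, c, h1, h2, h3⟩ := exists_pullback hψ
  obtain ⟨G, M, c', g1, g2, g3⟩ := hφ
  refine ⟨fun j => MvPolynomial.bind₁ (fun q => F q.1 q.2) (G j), _,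
    fun y => (∏ k, c k y ^ M k) * c' (ψ y), fun j => (g1 j).bind₁ h1, ?_, fun y j => ?_⟩
  · exact mul_ne_zero (Finset.prod_ne_zero_iff.mpr fun k _ => pow_ne_zero _ (h2 k)) g2
  · rw [h3 (G j) M (g1 j), g3]
    ring

/-- The pullback of G vanishes wherever G ∘ ψ does, and possibly where a scale factor does; so its
nonvanishing locus is a neighbourhood of x inside the preimage. -/
theorem IsMorphism.continuous {m : ℕ} {ψ : EPow W n → EPow W m} (hψ : IsMorphism ψ) :
    Continuous ψ := by
  refine continuous_generateFrom_iff.mpr ?_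
  rintro _ ⟨G, M, hG, rfl⟩
  rw [isOpen_iff_forall_mem_open]
  intro x hx
  obtain ⟨F, D, c, h1, h2, h3⟩ := exists_pullback (hψ x)
  refine ⟨_, fun y hy => ?_, isOpen_evalAt_ne (hG.bind₁ h1), ?_⟩
  · have : evalAt (MvPolynomial.bind₁ (fun q => F q.1 q.2) G) y ≠ 0 := hy
    rw [h3 G M hG] at this
    exact right_ne_zero_of_mul this
  · change evalAt _ x ≠ 0
    rw [h3 G M hG]
    exact mul_ne_zero (Finset.prod_ne_zero_iff.mpr fun k _ => pow_ne_zero _ (h2 k)) hx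

theorem hasLocalRep_apply (i : Fin n) (x : EPow W n) : HasLocalRep (fun y => y i) x :=
  ⟨fun j => X (i, j), Pi.single i 1, fun _ => 1, fun j => isMultihomogeneous_X (i, j),
    one_ne_zero, fun y j => by simp [evalAt]⟩

theorem hasLocalRep_const (P : W.toAffine.Point) (x : EPow W n) : HasLocalRep (fun _ => P) x :=
  ⟨fun j => C (coords P j), 0, fun _ => 1,
    fun j => MvPolynomial.isWeightedHomogeneous_C _ _, one_ne_zero,
    fun y j => by simp [evalAt]⟩

theorem isMorphism_precomp {m : ℕ} (e : Fin m → Fin n) :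
    IsMorphism (fun (z : EPow W n) => (z ∘ e : EPow W m)) :=
  fun x k => hasLocalRep_apply (e k) x

section Addition

theorem equation_coords (P : W.toAffine.Point) : W.toProjective.Equation (coords P) := by
  match P with
  | .zero =>
    rw [WeierstrassCurve.Projective.equation_iff]
    simp [coords]
  | .some x y h =>
    exact (WeierstrassCurve.Projective.equation_some x y).mpr h.1

/-- The addition formulas away from the diagonal. -/
theorem addXYZ_coords {P Q : W.toAffine.Point} (h : P ≠ Q) :
    ∃ c : Qbar, c ≠ 0 ∧ W.toProjective.addXYZ (coords P) (coords Q) = c • coords (P + Q) := by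
  match P, Q with
  | .zero, .zero => exact absurd rfl h
  | .zero, .some x y hQ =>
    refine ⟨1, one_ne_zero, ?_⟩
    rw [WeierstrassCurve.Projective.addXYZ_of_Z_eq_zero_left (equation_coords _) (by rfl)]
    congr 1
    simp [coords]
  | .some x y hP, .zero =>
    refine ⟨-1, by simp, ?_⟩
    rw [WeierstrassCurve.Projective.addXYZ_of_Z_eq_zero_right (equation_coords _) (by rfl)]
    congr 1
    simp [coords]
  | .some x y hP, .some x' y' hQ =>
    by_cases hx : x = x'
    · subst hx
      have hy : y ≠ y' := fun hy => h (by subst hy; rfl)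
      have hy' : y = W.toAffine.negY x y' :=
        WeierstrassCurve.Affine.Y_eq_of_X_eq hP.1 hQ.1 rfl |>.resolve_left hy
      refine ⟨WeierstrassCurve.Projective.addU (coords (.some x y hP)) (coords (.some x y' hQ)),
        ?_, ?_⟩
      swap
      · rw [WeierstrassCurve.Projective.addXYZ_of_X_eq (equation_coords _) (equation_coords _)
          (by simp [coords]) (by simp [coords]) (by simp [coords]),
          WeierstrassCurve.Affine.Point.add_of_Y_eq rfl hy']
        rfl
      · simp [WeierstrassCurve.Projective.addU, coords, sub_eq_zero, hy]
    · refine ⟨W.toProjective.addZ (coords (.some x y hP)) (coords (.some x' y' hQ)), ?_, ?_⟩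
      swap
      · rw [WeierstrassCurve.Projective.addXYZ_of_Z_ne_zero (equation_coords _) (equation_coords _)
          (by simp [coords]) (by simp [coords]) (by simpa [coords] using hx),
          WeierstrassCurve.Affine.Point.add_of_X_ne hx, coords_some, coords_some, coords_some]
        simp
      · exact (WeierstrassCurve.Projective.isUnit_addZ_of_X_ne (equation_coords _)
          (equation_coords _) (by simpa [coords] using hx)).ne_zero

/-- The polynomials of the addition formulas. -/
noncomputable def addPoly (W : WeierstrassCurve Qbar) (j : Fin 3) : BlockPoly 2 :=
  (W.map (C : Qbar →+* BlockPoly 2)).toProjective.addXYZ (fun i => X (0, i)) (fun i => X (1, i)) j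

theorem eval_addPoly (v : Fin 2 × Fin 3 → Qbar) (j : Fin 3) :
    eval v (addPoly W j) = W.toProjective.addXYZ (fun i => v (0, i)) (fun i => v (1, i)) j := by
  have h := WeierstrassCurve.Projective.map_addXYZ (W' := W.map (C : Qbar →+* BlockPoly 2))
    (eval v) (fun i => X (0, i)) (fun i => X (1, i))
  have hW : WeierstrassCurve.Projective.map (W.map (C : Qbar →+* BlockPoly 2)) (eval v) = W := by
    refine (WeierstrassCurve.map_map W C (eval v)).trans ?_
    have : (eval v).comp C = RingHom.id Qbar := RingHom.ext fun a => eval_C a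
    rw [this]
    exact W.map_id
  rw [hW] at h
  have h2 := congrFun h j
  simp only [Function.comp_def, eval_X] at h2
  exact h2.symm

theorem isMultihomogeneous_addPoly (j : Fin 3) :
    IsMultihomogeneous (addPoly W j) (fun _ => 2) := by
  rw [isMultihomogeneous_iff_eval]
  intro l v
  rw [eval_addPoly, eval_addPoly]
  have := congrFun (WeierstrassCurve.Projective.addXYZ_smul (W' := W) (fun i => v (0, i))
    (fun i => v (1, i)) (l 0) (l 1)) j
  rw [Fin.prod_univ_two, ← mul_pow]
  exact this

/-- The addition polynomials vanish identically on the diagonal, which is consistent with the scale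
factor 0 there. -/
theorem hasLocalRep_add_of_ne {z : EPow W 2} (hz : z 0 ≠ z 1) :
    HasLocalRep (fun z => z 0 + z 1) z := by
  classical
  refine ⟨addPoly W, fun _ => 2, fun z => if h : z 0 ≠ z 1 then (addXYZ_coords h).choose else 0,
    isMultihomogeneous_addPoly, ?_, fun y j => ?_⟩
  · dsimp only
    rw [dif_pos hz]
    exact (addXYZ_coords hz).choose_spec.1
  · rw [evalAt, eval_addPoly]
    dsimp only
    by_cases h : y 0 ≠ y 1
    · rw [dif_pos h]
      exact congrFun (addXYZ_coords h).choose_spec.2 j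
    · rw [dif_neg h, zero_mul]
      rw [not_not] at h
      rw [h]
      have := congrFun (WeierstrassCurve.Projective.addXYZ_self (W' := W) (coords (y 1))) j
      refine this.trans ?_
      fin_cases j <;> rfl

theorem HasLocalRep.add_of_ne {φ ψ : EPow W n → W.toAffine.Point} {x : EPow W n}
    (hφ : HasLocalRep φ x) (hψ : HasLocalRep ψ x) (h : φ x ≠ ψ x) :
    HasLocalRep (fun y => φ y + ψ y) x := by
  have := HasLocalRep.comp (φ := fun z : EPow W 2 => z 0 + z 1) (ψ := fun y => ![φ y, ψ y]) (x := x)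
    (hasLocalRep_add_of_ne h) (Fin.forall_fin_two.mpr ⟨hφ, hψ⟩)
  exact this

theorem hasLocalRep_neg (z : EPow W 1) : HasLocalRep (fun z => -z 0) z := by
  -- At the origin [0 : 1 : 0] these polynomials give [0 : -1 : 0], hence the scale factor -1.
  refine ⟨![X (0, 0), -X (0, 1) - C W.a₁ * X (0, 0) - C W.a₃ * X (0, 2), X (0, 2)], fun _ => 1,
    fun z => match z 0 with | .zero => -1 | .some _ _ _ => 1, ?_, ?_, fun y j => ?_⟩
  · intro j
    rw [isMultihomogeneous_iff_eval]
    intro l v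
    fin_cases j <;> simp
    ring
  · dsimp only
    split <;> simp
  · dsimp only
    split <;> rename_i h
    · rw [h]
      have : -(WeierstrassCurve.Affine.Point.zero : W.toAffine.Point) = .zero := rfl
      rw [this]
      fin_cases j <;> simp [evalAt, h, coords]
    · rw [h, WeierstrassCurve.Affine.Point.neg_some]
      fin_cases j <;> simp [evalAt, h, coords, WeierstrassCurve.Affine.negY]

theorem HasLocalRep.neg {ψ : EPow W n → W.toAffine.Point} {x : EPow W n} (hψ : HasLocalRep ψ x) :
    HasLocalRep (fun y => -ψ y) x :=
  HasLocalRep.comp (φ := fun z : EPow W 1 => -z 0) (ψ := fun y => ![ψ y]) (hasLocalRep_neg _)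
    (fun k => by fin_cases k; exact hψ)

end Addition

end EllipticPower

/-! ### The group law is a morphism -/

namespace EllipticPower

open MvPolynomial

variable {W : WeierstrassCurve Qbar} {n : ℕ}

theorem exists_equation (W : WeierstrassCurve Qbar) (x : Qbar) :
    ∃ y, W.toAffine.Equation x y := by
  obtain ⟨y, hy⟩ := IsAlgClosed.exists_eq_mul_self (k := Qbar)
    ((W.a₁ * x + W.a₃) ^ 2 + 4 * (x ^ 3 + W.a₂ * x ^ 2 + W.a₄ * x + W.a₆))
  refine ⟨(y - (W.a₁ * x + W.a₃)) / 2, ?_⟩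
  rw [WeierstrassCurve.Affine.equation_iff]
  linear_combination -(1 / 4) * hy

theorem exists_point [W.IsElliptic] (x : Qbar) :
    ∃ y h, (WeierstrassCurve.Affine.Point.some x y h : W.toAffine.Point) ≠ 0 := by
  obtain ⟨y, hy⟩ := exists_equation W x
  exact ⟨y, (W.toAffine.equation_iff_nonsingular).mp hy,
    WeierstrassCurve.Affine.Point.some_ne_zero _⟩

instance [W.IsElliptic] : Infinite W.toAffine.Point := by
  choose y h _ using fun x => exists_point (W := W) x
  exact Infinite.of_injective (fun x : Qbar => WeierstrassCurve.Affine.Point.some x (y x) (h x))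
    fun a b hab => by simpa using (WeierstrassCurve.Affine.Point.some.inj hab).1

theorem two_torsion_some_iff {x y : Qbar} (h : W.toAffine.Nonsingular x y) :
    (2 : ℕ) • (WeierstrassCurve.Affine.Point.some x y h : W.toAffine.Point) = 0 ↔
      2 * y + W.a₁ * x + W.a₃ = 0 := by
  rw [two_nsmul, add_eq_zero_iff_eq_neg, WeierstrassCurve.Affine.Point.neg_some,
    WeierstrassCurve.Affine.Point.some.injEq, WeierstrassCurve.Affine.negY]
  constructor
  · rintro ⟨-, h2⟩
    linear_combination h2
  · intro h2
    exact ⟨rfl, by linear_combination h2⟩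

/-- The x-coordinate is a root of a polynomial with leading coefficient 4, and 2y + a₁x + a₃ = 0
then determines y. -/
theorem finite_two_torsion : {P : W.toAffine.Point | (2 : ℕ) • P = 0}.Finite := by
  classical
  let p : Polynomial Qbar := W.twoTorsionPolynomial.toPoly
  have hp : p ≠ 0 := Cubic.ne_zero_of_a_ne_zero (by simp [WeierstrassCurve.twoTorsionPolynomial])
  let g : Qbar → W.toAffine.Point := fun x =>
    if h : W.toAffine.Nonsingular x (-(W.a₁ * x + W.a₃) / 2) then .some _ _ h else 0
  refine ((Finset.finite_toSet p.roots.toFinset).image g |>.insert 0).subset ?_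
  rintro P hP
  match P, hP with
  | .zero, _ => exact Set.mem_insert _ _
  | .some x y h, hP =>
    right
    have h2 := (two_torsion_some_iff h).mp hP
    have hy : y = -(W.a₁ * x + W.a₃) / 2 := by linear_combination (1 / 2) * h2
    refine ⟨x, ?_, ?_⟩
    · simp only [Finset.mem_coe, Multiset.mem_toFinset, Polynomial.mem_roots hp,
        Polynomial.IsRoot.def]
      have := (WeierstrassCurve.Affine.equation_iff _ _).mp h.1
      simp only [p, WeierstrassCurve.twoTorsionPolynomial, Cubic.toPoly, Polynomial.eval_add,
        Polynomial.eval_mul, Polynomial.eval_C, Polynomial.eval_pow, Polynomial.eval_X,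
        WeierstrassCurve.b₂, WeierstrassCurve.b₄, WeierstrassCurve.b₆]
      linear_combination (-4) * this + (2 * y + W.a₁ * x + W.a₃) * h2
    · subst hy
      exact dif_pos h

theorem finite_two_nsmul_eq (Q : W.toAffine.Point) :
    {P : W.toAffine.Point | (2 : ℕ) • P = Q}.Finite := by
  by_cases h : ∃ P₀, (2 : ℕ) • P₀ = Q
  · obtain ⟨P₀, h₀⟩ := h
    refine (finite_two_torsion.image (fun T => T + P₀)).subset fun P hP => ?_
    refine ⟨P - P₀, ?_, sub_add_cancel _ _⟩
    have hP' : (2 : ℕ) • P = Q := hP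
    change (2 : ℕ) • (P - P₀) = 0
    rw [nsmul_sub, hP', h₀, sub_self]
  · exact Set.Finite.subset Set.finite_empty fun P hP => h ⟨P, hP⟩

/-- On the diagonal write φ + ψ = ((φ + a) + ψ) - a. The three additions are off the diagonal at x
if a ≠ φ(x), a ≠ 0 and 2a ≠ -2φ(x), which excludes only finitely many a. -/
theorem HasLocalRep.add [W.IsElliptic] {φ ψ : EPow W n → W.toAffine.Point} {x : EPow W n}
    (hφ : HasLocalRep φ x) (hψ : HasLocalRep ψ x) : HasLocalRep (fun y => φ y + ψ y) x := by
  by_cases h : φ x = ψ x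
  · have hfin : ({φ x, 0} ∪ {a | (2 : ℕ) • a = -((2 : ℕ) • φ x)} : Set W.toAffine.Point).Finite :=
      (Set.toFinite _).union (finite_two_nsmul_eq _)
    obtain ⟨a, ha⟩ := hfin.infinite_compl.nonempty
    simp only [Set.mem_compl_iff, Set.mem_union, Set.mem_insert_iff, Set.mem_singleton_iff,
      Set.mem_ofPred_eq, not_or] at ha
    obtain ⟨⟨h1, h2⟩, h3⟩ := ha
    have e1 := hφ.add_of_ne (hasLocalRep_const a x) (Ne.symm h1)
    have e2 := e1.add_of_ne hψ (by
      rw [← h]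
      intro h'
      exact h2 (by simpa using h'))
    have e3 := e2.add_of_ne (hasLocalRep_const (-a) x) (by
      rw [← h]
      intro h'
      apply h3
      have : φ x + a + φ x + a = 0 := by rw [h']; exact neg_add_cancel a
      rw [two_nsmul, two_nsmul, eq_neg_iff_add_eq_zero.mpr (by
        rw [← this]; abel : a + a + (φ x + φ x) = 0)] )
    have hfun : (fun y => φ y + ψ y) = fun y => φ y + a + ψ y + -a := by
      funext y; abel
    rw [hfun]
    exact e3
  · exact hφ.add_of_ne hψ h

theorem HasLocalRep.nsmul [W.IsElliptic] {φ : EPow W n → W.toAffine.Point} {x : EPow W n}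
    (hφ : HasLocalRep φ x) (k : ℕ) : HasLocalRep (fun y => k • φ y) x := by
  induction k with
  | zero => simpa using hasLocalRep_const 0 x
  | succ k ih => simpa only [succ_nsmul] using ih.add hφ

theorem HasLocalRep.zsmul [W.IsElliptic] {φ : EPow W n → W.toAffine.Point} {x : EPow W n}
    (hφ : HasLocalRep φ x) (k : ℤ) : HasLocalRep (fun y => k • φ y) x := by
  obtain ⟨k, rfl | rfl⟩ := k.eq_nat_or_neg
  · simpa only [natCast_zsmul] using hφ.nsmul k
  · simpa only [neg_zsmul, natCast_zsmul] using (hφ.nsmul k).neg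

theorem HasLocalRep.sum [W.IsElliptic] {ι : Type*} (s : Finset ι)
    {φ : ι → EPow W n → W.toAffine.Point} {x : EPow W n} (hφ : ∀ i, HasLocalRep (φ i) x) :
    HasLocalRep (fun y => ∑ i ∈ s, φ i y) x := by
  classical
  induction s using Finset.induction_on with
  | empty => simpa using hasLocalRep_const 0 x
  | insert a s ha ih => simpa only [Finset.sum_insert ha] using (hφ a).add ih

/-- Integral linear maps between powers of `E` are morphisms. -/
theorem isMorphism_linear [W.IsElliptic] {m : ℕ} (c : Fin m → Fin n → ℤ) :
    IsMorphism (fun (z : EPow W n) (j : Fin m) => ∑ i, c j i • z i) :=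
  fun x j => HasLocalRep.sum (φ := fun i (z : EPow W n) => c j i • z i) Finset.univ
    fun i => (hasLocalRep_apply i x).zsmul (c j i)

theorem isMorphism_add_const [W.IsElliptic] (a : EPow W n) :
    IsMorphism (fun z : EPow W n => z + a) :=
  fun x k => (hasLocalRep_apply k x).add (hasLocalRep_const (a k) x)

theorem isMorphism_neg [W.IsElliptic] : IsMorphism (fun z : EPow W n => -z) :=
  fun x k => (hasLocalRep_apply k x).neg

/-- Translation by `a`. -/
noncomputable def translate [W.IsElliptic] (a : EPow W n) : EPow W n ≃ₜ EPow W n where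
  toEquiv := Equiv.addRight a
  continuous_toFun := (isMorphism_add_const a).continuous
  continuous_invFun := (isMorphism_add_const (-a)).continuous

theorem translate_apply [W.IsElliptic] (a z : EPow W n) : translate a z = z + a := rfl

theorem coords_injective_of_smul {P Q : W.toAffine.Point}
    (h : ∀ i j, coords P i * coords Q j = coords P j * coords Q i) : P = Q := by
  match P, Q with
  | .zero, .zero => rfl
  | .zero, .some x y hQ => have := h 1 2; simp [coords] at this
  | .some x y hP, .zero => have := h 1 2; simp [coords] at this
  | .some x y hP, .some x' y' hQ =>
    have h0 := h 0 2
    have h1 := h 1 2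
    simp only [coords, Matrix.cons_val] at h0 h1
    rw [WeierstrassCurve.Affine.Point.some.injEq]
    exact ⟨by simpa using h0, by simpa using h1⟩

theorem isClosed_apply_eq (i : Fin n) (P : W.toAffine.Point) :
    IsClosed {z : EPow W n | z i = P} := by
  refine isClosed_of_forall_exists fun x hx => ?_
  have : ∃ a b, coords (x i) a * coords P b ≠ coords (x i) b * coords P a := by
    by_contra! h
    exact hx (coords_injective_of_smul h)
  obtain ⟨a, b, hab⟩ := this
  refine ⟨C (coords P b) * X (i, a) - C (coords P a) * X (i, b), Pi.single i 1, ?_, ?_, ?_⟩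
  · exact Submodule.sub_mem (MvPolynomial.weightedHomogeneousSubmodule Qbar _ _)
      ((isMultihomogeneous_X (i, a)).C_mul _) ((isMultihomogeneous_X (i, b)).C_mul _)
  · simp only [evalAt, map_sub, map_mul, eval_C, eval_X]
    intro h
    exact hab (by linear_combination h)
  · rintro y rfl
    simp only [evalAt, map_sub, map_mul, eval_C, eval_X]
    ring

theorem isClosed_apply_eq_apply (i j : Fin n) : IsClosed {z : EPow W n | z i = z j} := by
  refine isClosed_of_forall_exists fun x hx => ?_
  have : ∃ a b, coords (x i) a * coords (x j) b ≠ coords (x i) b * coords (x j) a := by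
    by_contra! h
    exact hx (coords_injective_of_smul h)
  obtain ⟨a, b, hab⟩ := this
  refine ⟨X (i, a) * X (j, b) - X (i, b) * X (j, a), Pi.single i 1 + Pi.single j 1, ?_, ?_, ?_⟩
  · exact Submodule.sub_mem (MvPolynomial.weightedHomogeneousSubmodule Qbar _ _)
      ((isMultihomogeneous_X (i, a)).mul (isMultihomogeneous_X (j, b)))
      ((isMultihomogeneous_X (i, b)).mul (isMultihomogeneous_X (j, a)))
  · simp only [evalAt, map_sub, map_mul, eval_X]
    intro h
    exact hab (by linear_combination h)
  · intro y hy
    have hy : y i = y j := hy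
    simp only [evalAt, map_sub, map_mul, eval_X, hy]
    ring

instance : T1Space (EPow W n) where
  t1 x := by
    have : ({x} : Set (EPow W n)) = ⋂ i, {z | z i = x i} := by
      ext z
      simp [funext_iff]
    rw [this]
    exact isClosed_iInter fun i => isClosed_apply_eq i (x i)

end EllipticPower

/-! ### Specialization of generic points -/

namespace EllipticPower

open MvPolynomial

/-- Nullstellensatz: a prime ideal is the vanishing ideal of its zero locus, so some zero of I is
not a zero of h. -/
theorem exists_specialization {k σ : Type*} [Field k] [IsAlgClosed k] [Finite σ]
    {I : Ideal (MvPolynomial σ k)} (hI : I.IsPrime) {h : MvPolynomial σ k} (hh : h ∉ I) :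
    ∃ c : σ → k, (∀ f ∈ I, eval c f = 0) ∧ eval c h ≠ 0 := by
  have h1 := MvPolynomial.vanishingIdeal_zeroLocus_eq_radical (K := k) I
  rw [hI.radical] at h1
  rw [← h1, mem_vanishingIdeal_iff] at hh
  push Not at hh
  obtain ⟨c, hc, hc'⟩ := hh
  rw [aeval_eq_eval] at hc'
  refine ⟨c, fun f hf => ?_, hc'⟩
  have := hc f hf
  rwa [aeval_eq_eval] at this

/-- Specializations of part of the coordinates extend, away from a hypersurface. -/
theorem exists_extend_specialization {k σ τ : Type*} [Field k] [IsAlgClosed k] [Finite σ]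
    [Finite τ] {I : Ideal (MvPolynomial σ k)} (hI : I.IsPrime) (ρ : τ → σ)
    {h : MvPolynomial σ k} (hh : h ∉ I) :
    ∃ u : MvPolynomial τ k, rename ρ u ∉ I ∧ ∀ c : τ → k,
      (∀ f, rename ρ f ∈ I → eval c f = 0) → eval c u ≠ 0 →
      ∃ c' : σ → k, (∀ f ∈ I, eval c' f = 0) ∧ eval c' h ≠ 0 ∧ c' ∘ ρ = c := by
  let φ : MvPolynomial τ k →+* MvPolynomial σ k ⧸ I :=
    (Ideal.Quotient.mk I).comp (rename ρ : MvPolynomial τ k →ₐ[k] MvPolynomial σ k).toRingHom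
  have hφ : φ.FinitePresentation := by
    rw [← RingHom.FinitePresentation.of_finiteType]
    have h2 : (φ.comp (C : k →+* MvPolynomial τ k)).FiniteType := by
      have : φ.comp (C : k →+* MvPolynomial τ k) = algebraMap k (MvPolynomial σ k ⧸ I) := by
        ext a
        simp [φ]
        rfl
      rw [this]
      exact RingHom.finiteType_algebraMap.mpr inferInstance
    exact RingHom.FiniteType.of_comp_finiteType h2
  -- Chevalley: the projection of the locus h ≠ 0 is constructible. It contains the image of the
  -- generic point, hence so does one of its locally closed pieces.
  obtain ⟨S, hS⟩ := PrimeSpectrum.exists_constructibleSetData_iff.mpr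
    (PrimeSpectrum.isConstructible_comap_image hφ
      (PrimeSpectrum.isConstructible_basicOpen (f := Ideal.Quotient.mk I h)))
  have hgen : PrimeSpectrum.comap φ ⊥ ∈ S.toSet := by
    rw [hS]
    refine ⟨⊥, ?_, rfl⟩
    change Ideal.Quotient.mk I h ∉ (⊥ : Ideal _)
    rwa [Ideal.mem_bot, Ideal.Quotient.eq_zero_iff_mem]
  have hmem : ∀ f, f ∈ (PrimeSpectrum.comap φ ⊥).asIdeal ↔ rename ρ f ∈ I := by
    intro f
    rw [PrimeSpectrum.comap_asIdeal, Ideal.mem_comap]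
    change φ f ∈ (⊥ : Ideal _) ↔ _
    rw [Ideal.mem_bot]
    exact Ideal.Quotient.eq_zero_iff_mem
  rw [PrimeSpectrum.ConstructibleSetData.toSet] at hgen
  simp only [Set.mem_iUnion] at hgen
  obtain ⟨D, hD, hgen⟩ := hgen
  obtain ⟨hg1, hg2⟩ := hgen
  -- The equations of that piece are satisfied by every specialization, as they vanish at the
  -- generic point; only the inequation `D.f` remains as a condition.
  refine ⟨D.f, ?_, fun c hc hu => ?_⟩
  · rw [← hmem]
    intro hmem'
    exact hg2 (by simpa [PrimeSpectrum.mem_zeroLocus] using hmem')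
  · let pc : PrimeSpectrum (MvPolynomial τ k) := ⟨RingHom.ker (eval c), RingHom.ker_isPrime _⟩
    have hpc : pc ∈ S.toSet := by
      rw [PrimeSpectrum.ConstructibleSetData.toSet]
      simp only [Set.mem_iUnion]
      refine ⟨D, hD, ?_, ?_⟩
      · rintro _ ⟨i, rfl⟩
        change eval c (D.g i) = 0
        exact hc _ ((hmem _).mp (hg1 ⟨i, rfl⟩))
      · intro h'
        exact hu (h' (Set.mem_singleton _))
    rw [hS] at hpc
    obtain ⟨q, hq, hqc⟩ := hpc
    have hQ : (q.asIdeal.comap (Ideal.Quotient.mk I)).IsPrime := Ideal.comap_isPrime _ _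
    obtain ⟨c', h1, h2⟩ := exists_specialization hQ (h := h) hq
    refine ⟨c', fun f hf => h1 f ?_, h2, funext fun t => ?_⟩
    · rw [Ideal.mem_comap, Ideal.Quotient.eq_zero_iff_mem.mpr hf]
      exact zero_mem _
    · have : (X t - C (c t) : MvPolynomial τ k) ∈ (PrimeSpectrum.comap φ q).asIdeal := by
        rw [hqc]
        change eval c (X t - C (c t)) = 0
        simp
      have h3 := h1 (rename ρ (X t - C (c t))) this
      simpa [sub_eq_zero] using h3

end EllipticPower

/-! ### Closed subsets of `E`, and irreducibility of `E^n` -/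

namespace EllipticPower

open MvPolynomial

variable {W : WeierstrassCurve Qbar} {n : ℕ}

/-- Evaluation of regular functions at an affine point. -/
noncomputable def evalPoint {x y : Qbar} (h : W.toAffine.Equation x y) :
    W.toAffine.CoordinateRing →+* Qbar :=
  AdjoinRoot.lift (Polynomial.evalRingHom x) y (by
    rw [Polynomial.eval₂_evalRingHom]; exact h)

theorem evalPoint_mk {x y : Qbar} (h : W.toAffine.Equation x y)
    (f : Polynomial (Polynomial Qbar)) :
    evalPoint h (WeierstrassCurve.Affine.CoordinateRing.mk W f) = f.evalEval x y := by
  rw [evalPoint]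
  refine (AdjoinRoot.lift_mk _ f).trans ?_
  rw [Polynomial.eval₂_evalRingHom]

theorem evalPoint_algebraMap {x y : Qbar} (h : W.toAffine.Equation x y) (p : Polynomial Qbar) :
    evalPoint h (algebraMap (Polynomial Qbar) W.toAffine.CoordinateRing p) = p.eval x := by
  have : algebraMap (Polynomial Qbar) W.toAffine.CoordinateRing p =
    WeierstrassCurve.Affine.CoordinateRing.mk W (Polynomial.C p) := rfl
  rw [this, evalPoint_mk, Polynomial.evalEval_C]

/-- The norm of f to the polynomial ring in x is a nonzero polynomial vanishing at the x-coordinate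
of each zero of f, and each x carries at most two points. -/
theorem finite_evalPoint_eq_zero {f : W.toAffine.CoordinateRing} (hf : f ≠ 0) :
    {P : W.toAffine.Point | ∃ x y h, P = .some x y h ∧ evalPoint h.1 f = 0}.Finite := by
  classical
  obtain ⟨p, q, rfl⟩ := WeierstrassCurve.Affine.CoordinateRing.exists_smul_basis_eq f
  let N := Algebra.norm (Polynomial Qbar)
    (p • (1 : W.toAffine.CoordinateRing) + q • WeierstrassCurve.Affine.CoordinateRing.mk W .X)
  have hN : N ≠ 0 := Algebra.norm_ne_zero_iff_of_basis
    (WeierstrassCurve.Affine.CoordinateRing.basis W) |>.mpr hf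
  have hroot : ∀ x y (h : W.toAffine.Equation x y), evalPoint h (p • 1 +
      q • WeierstrassCurve.Affine.CoordinateRing.mk W .X) = 0 → N.eval x = 0 := by
    intro x y h h0
    rw [← evalPoint_algebraMap h]
    have h1 := WeierstrassCurve.Affine.CoordinateRing.coe_norm_smul_basis (W' := W) p q
    change algebraMap _ _ N = _ at h1
    rw [h1, evalPoint_mk, Polynomial.evalEval_mul]
    convert zero_mul _
    rw [← h0, Algebra.smul_def, Algebra.smul_def, mul_one, map_add, map_mul,
      evalPoint_algebraMap, evalPoint_algebraMap, evalPoint_mk]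
    simp [Polynomial.evalEval]
  have hfib : ∀ x : Qbar, {P : W.toAffine.Point | ∃ y h, P = .some x y h}.Finite := by
    intro x
    by_cases hx : ∃ y₀, W.toAffine.Nonsingular x y₀
    · obtain ⟨y₀, h₀⟩ := hx
      refine (Set.toFinite {.some x y₀ h₀, -.some x y₀ h₀}).subset ?_
      rintro _ ⟨y, h, rfl⟩
      rcases WeierstrassCurve.Affine.Y_eq_of_X_eq h.1 h₀.1 rfl with h' | h'
      · left
        subst h'
        rfl
      · right
        rw [Set.mem_singleton_iff, WeierstrassCurve.Affine.Point.neg_some]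
        subst h'
        rfl
    · refine Set.Finite.subset Set.finite_empty ?_
      rintro _ ⟨y, h, rfl⟩
      exact hx ⟨y, h⟩
  refine (Set.Finite.biUnion (Finset.finite_toSet N.roots.toFinset) fun x _ => hfib x).subset ?_
  rintro _ ⟨x, y, h, rfl, h0⟩
  simp only [Finset.mem_coe, Multiset.mem_toFinset, Set.mem_iUnion]
  exact ⟨x, (Polynomial.mem_roots hN).mpr (hroot x y h.1 h0), y, h, rfl⟩

/-- A polynomial as a regular function on the affine part of `E`. -/
noncomputable def toCoordinateRing (W : WeierstrassCurve Qbar) :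
    BlockPoly 1 →ₐ[Qbar] W.toAffine.CoordinateRing :=
  aeval (fun q => (![WeierstrassCurve.Affine.CoordinateRing.mk W (Polynomial.C .X),
    WeierstrassCurve.Affine.CoordinateRing.mk W .X, 1] : Fin 3 → W.toAffine.CoordinateRing) q.2)

theorem evalPoint_toCoordinateRing (F : BlockPoly 1) {x y : Qbar} (h : W.toAffine.Nonsingular x y) :
    evalPoint h.1 (toCoordinateRing W F) = evalAt F (fun _ => .some x y h) := by
  have : (evalPoint h.1).comp (toCoordinateRing W).toRingHom =
      eval (fun q : Fin 1 × Fin 3 => coords (W := W) (.some x y h) q.2) := by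
    refine MvPolynomial.ringHom_ext (fun a => ?_) (fun q => ?_)
    · simp
      have : algebraMap Qbar W.toAffine.CoordinateRing a =
        WeierstrassCurve.Affine.CoordinateRing.mk W (Polynomial.C (Polynomial.C a)) := rfl
      rw [this, evalPoint_mk]
      simp
    · obtain ⟨q, j⟩ := q
      fin_cases j <;> simp [toCoordinateRing, coords]
      · exact (evalPoint_mk h.1 (Polynomial.C .X)).trans (by simp [Polynomial.evalEval])
      · exact (evalPoint_mk h.1 .X).trans (by simp [Polynomial.evalEval])
  exact congrArg (fun g => g F) this

/-- E has dimension one: a polynomial vanishing on Z but not at some affine point is a nonzero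
regular function on the affine curve, so it has finitely many zeros. -/
theorem finite_of_isClosed_ne_univ [W.IsElliptic] {Z : Set (EPow W 1)} (hZ : IsClosed Z)
    (h : Z ≠ Set.univ) : Z.Finite := by
  have key : ∀ {Z : Set (EPow W 1)}, IsClosed Z → (∃ P : EPow W 1, P 0 ≠ 0 ∧ P ∉ Z) →
      Z.Finite := by
    rintro Z hZ ⟨P, hP0, hPZ⟩
    obtain ⟨F, m, -, h1, h2⟩ := exists_evalAt_of_notMem hZ hPZ
    have hF : toCoordinateRing W F ≠ 0 := by
      intro h0
      match hP : P 0, hP0 with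
      | .some x y hxy, _ =>
        have := evalPoint_toCoordinateRing F hxy
        rw [h0, map_zero] at this
        apply h1
        rw [this]
        congr 1
        funext i
        fin_cases i
        exact hP
    refine (((finite_evalPoint_eq_zero hF).image (fun P _ => P)).insert (fun _ => 0)).subset ?_
    intro z hz
    have hz' : z = fun _ => z 0 := by
      funext i; fin_cases i; rfl
    match hP : z 0 with
    | .zero =>
      left
      rw [hz', hP]
      rfl
    | .some x y h =>
      right
      refine ⟨.some x y h, ⟨x, y, h, rfl, ?_⟩, ?_⟩
      · rw [evalPoint_toCoordinateRing F h, ← hP, ← hz']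
        exact h2 z hz
      · rw [← hP]
        exact hz'.symm
  by_cases h' : ∃ P : EPow W 1, P 0 ≠ 0 ∧ P ∉ Z
  · exact key hZ h'
  -- Here Z misses only the origin; a translation makes the missed point affine.
  · push Not at h'
    obtain ⟨P, hP⟩ := (Set.ne_univ_iff_exists_notMem Z).mp h
    obtain ⟨a, ha⟩ := Set.Infinite.nonempty (Set.finite_singleton (0 : W.toAffine.Point)).infinite_compl
    have hP0 : P 0 = 0 := by
      by_contra h0
      exact hP (h' P h0)
    let T := translate (n := 1) (fun _ => a)
    have hfin : (T '' Z).Finite := by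
      refine key (T.isClosedMap _ hZ) ⟨fun _ => a, ha, ?_⟩
      rintro ⟨z, hz, hza⟩
      have : z = P := by
        funext i
        fin_cases i
        have := congrFun hza 0
        simp only [T, translate_apply, Pi.add_apply] at this
        exact (by simpa using this : z 0 = 0).trans hP0.symm
      exact hP (this ▸ hz)
    exact hfin.of_finite_image T.injective.injOn

theorem isMorphism_snoc {m : ℕ} {ψ : EPow W n → EPow W m} {φ : EPow W n → W.toAffine.Point}
    (hψ : IsMorphism ψ) (hφ : ∀ x, HasLocalRep φ x) :
    IsMorphism (fun y => (Fin.snoc (ψ y) (φ y) : EPow W (m + 1))) := by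
  intro x k
  refine Fin.lastCases ?_ (fun k => ?_) k
  · simpa using hφ x
  · simpa using hψ x k

theorem isMorphism_id : IsMorphism (fun y : EPow W n => y) := fun x k => hasLocalRep_apply k x

theorem isMorphism_const {m : ℕ} (a : EPow W m) : IsMorphism (fun _ : EPow W n => a) :=
  fun x k => hasLocalRep_const (a k) x

theorem continuous_snoc_const (t : W.toAffine.Point) :
    Continuous (fun x : EPow W n => (Fin.snoc x t : EPow W (n + 1))) :=
  (isMorphism_snoc isMorphism_id fun x => hasLocalRep_const t x).continuous

theorem continuous_const_snoc (x : EPow W n) :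
    Continuous (fun t : EPow W 1 => (Fin.snoc x (t 0) : EPow W (n + 1))) :=
  (isMorphism_snoc (isMorphism_const x) fun t => hasLocalRep_apply 0 t).continuous

instance [W.IsElliptic] : Infinite (EPow W 1) :=
  Infinite.of_injective (fun P : W.toAffine.Point => fun _ => P) fun _ _ h => congrFun h 0

/-- A proper closed subset of E is finite and E is infinite, which settles n = 1. In general the
last coordinates t over which the slice of Z, or of Z', is full form closed subsets of E. By
induction they cover E, so one of them is E. -/
theorem isClosed_union_eq_univ [W.IsElliptic] :
    ∀ {n : ℕ} {Z Z' : Set (EPow W n)}, IsClosed Z → IsClosed Z' → Z ∪ Z' = Set.univ →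
      Z = Set.univ ∨ Z' = Set.univ := by
  have h1 : ∀ {Z Z' : Set (EPow W 1)}, IsClosed Z → IsClosed Z' → Z ∪ Z' = Set.univ →
      Z = Set.univ ∨ Z' = Set.univ := by
    intro Z Z' hZ hZ' h
    by_contra! hne
    have := (finite_of_isClosed_ne_univ hZ hne.1).union (finite_of_isClosed_ne_univ hZ' hne.2)
    rw [h] at this
    exact Set.infinite_univ this
  intro n
  induction n with
  | zero =>
    intro Z Z' _ _ h
    have : ∀ Y : Set (EPow W 0), default ∈ Y → Y = Set.univ := fun Y hY =>
      Set.eq_univ_of_forall fun x => Subsingleton.elim default x ▸ hY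
    rcases (h ▸ Set.mem_univ default : (default : EPow W 0) ∈ Z ∪ Z') with h' | h'
    · exact Or.inl (this _ h')
    · exact Or.inr (this _ h')
  | succ n ih =>
    intro Z Z' hZ hZ' h
    have hT : ∀ {Y : Set (EPow W (n + 1))}, IsClosed Y →
        IsClosed {t : EPow W 1 | ∀ x : EPow W n, (Fin.snoc x (t 0) : EPow W (n + 1)) ∈ Y} := by
      intro Y hY
      rw [Set.ofPred_forall]
      exact isClosed_iInter fun x => hY.preimage (continuous_const_snoc x)
    have hY : ∀ {Y : Set (EPow W (n + 1))},
        {t : EPow W 1 | ∀ x : EPow W n, (Fin.snoc x (t 0) : EPow W (n + 1)) ∈ Y} = Set.univ →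
        Y = Set.univ := by
      intro Y hY
      refine Set.eq_univ_of_forall fun z => ?_
      have : (fun _ => z (Fin.last n)) ∈
          {t : EPow W 1 | ∀ x : EPow W n, (Fin.snoc x (t 0) : EPow W (n + 1)) ∈ Y} := by
        rw [hY]; trivial
      have := this (Fin.init z)
      simpa using this
    refine (h1 (hT hZ) (hT hZ') ?_).imp hY hY
    refine Set.eq_univ_of_forall fun t => ?_
    have := ih (hZ.preimage (continuous_snoc_const (t 0)))
      (hZ'.preimage (continuous_snoc_const (t 0))) (by
        rw [← Set.preimage_union, h, Set.preimage_univ])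
    refine this.imp (fun h' x => ?_) (fun h' x => ?_)
    · exact (h' ▸ Set.mem_univ x : x ∈ (fun x => (Fin.snoc x (t 0) : EPow W (n + 1))) ⁻¹' Z)
    · exact (h' ▸ Set.mem_univ x : x ∈ (fun x => (Fin.snoc x (t 0) : EPow W (n + 1))) ⁻¹' Z')

instance [W.IsElliptic] : IrreducibleSpace (EPow W n) := by
  have : PreirreducibleSpace (EPow W n) := by
    refine ⟨?_⟩
    rw [isPreirreducible_iff_isClosed_union_isClosed]
    intro Z Z' hZ hZ' h
    rw [Set.univ_subset_iff] at h
    simpa [Set.univ_subset_iff] using isClosed_union_eq_univ hZ hZ' h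
  exact { toPreirreducibleSpace := this, toNonempty := inferInstance }

end EllipticPower

/-! ### Affine parts and projections of closed sets -/

namespace EllipticPower

open MvPolynomial

variable {W : WeierstrassCurve Qbar} {n : ℕ}

/-- The points of `E^n` all of whose coordinates are affine. -/
def affinePart (W : WeierstrassCurve Qbar) (n : ℕ) : Set (EPow W n) := {x | ∀ i, x i ≠ 0}

theorem coords_two_of_ne {P : W.toAffine.Point} (h : P ≠ 0) : coords P 2 = 1 := by
  match P, h with
  | .zero, h => exact absurd rfl h
  | .some _ _ _, _ => rfl

/-- Multihomogenization, vanishing at infinity. -/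
theorem exists_homogenization (f : BlockPoly n) {M : ℕ} (hM : f.totalDegree < M) :
    ∃ F : BlockPoly n, IsMultihomogeneous F (fun _ => M) ∧
      (∀ x ∈ affinePart W n, evalAt F x = evalAt f x) ∧
      ∀ x ∉ affinePart W n, evalAt F x = 0 := by
  classical
  -- Pads each monomial with powers of Z_i up to degree M in block i. As M exceeds the total degree,
  -- every Z_i occurs, so the result vanishes when some coordinate is at infinity.
  let pad : ((Fin n × Fin 3) →₀ ℕ) → ((Fin n × Fin 3) →₀ ℕ) := fun d =>
    Finsupp.equivFunOnFinite.symm fun q => if q.2 = 2 then M - ∑ j, d (q.1, j) else 0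
  have hdeg : ∀ d ∈ f.support, ∀ i, ∑ j, d (i, j) < M := by
    intro d hd i
    refine lt_of_le_of_lt ?_ hM
    refine le_trans ?_ (le_totalDegree hd)
    rw [Finsupp.sum_fintype _ _ (by simp), Fintype.sum_prod_type]
    exact Finset.single_le_sum (f := fun i => ∑ j, d (i, j)) (fun _ _ => Nat.zero_le _)
      (Finset.mem_univ i)
  refine ⟨∑ d ∈ f.support, monomial (d + pad d) (coeff d f), ?_, fun x hx => ?_, fun x hx => ?_⟩
  · refine MvPolynomial.IsWeightedHomogeneous.sum _ _ _ fun d hd => ?_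
    refine MvPolynomial.isWeightedHomogeneous_monomial _ _ _ ?_
    funext i
    rw [weight_block_apply]
    have := hdeg d hd i
    simp only [Finsupp.add_apply, Finset.sum_add_distrib]
    have h2 : ∑ j, pad d (i, j) = M - ∑ j, d (i, j) := by simp [pad]
    omega
  · rw [evalAt, evalAt, map_sum]
    conv_rhs => rw [f.as_sum, map_sum]
    refine Finset.sum_congr rfl fun d _ => ?_
    rw [eval_monomial, eval_monomial, Finsupp.prod_fintype _ _ (by simp),
      Finsupp.prod_fintype _ _ (by simp)]
    congr 1
    refine Finset.prod_congr rfl fun q _ => ?_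
    rw [Finsupp.add_apply, pow_add]
    by_cases hq : q.2 = 2
    · rw [hq, coords_two_of_ne (hx q.1), one_pow, one_pow, one_mul]
    · have : pad d q = 0 := by simp [pad, hq]
      rw [this, pow_zero, mul_one]
  · have : ∃ i, x i = 0 := by
      by_contra! h
      exact hx h
    obtain ⟨i, hi⟩ := this
    rw [evalAt, map_sum]
    refine Finset.sum_eq_zero fun d hd => ?_
    rw [eval_monomial, Finsupp.prod_fintype _ _ (by simp)]
    refine mul_eq_zero_of_right _ (Finset.prod_eq_zero (Finset.mem_univ (i, 2)) ?_)
    have h1 : coords (x (i, (2 : Fin 3)).1) (i, (2 : Fin 3)).2 = 0 := by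
      simp only [hi]
      rfl
    rw [h1]
    refine zero_pow ?_
    have := hdeg d hd i
    simp only [Finsupp.add_apply, pad, Finsupp.equivFunOnFinite_symm_apply_apply, if_true]
    omega

/-- On the affine part arbitrary polynomials may be used in place of multihomogeneous ones. -/
theorem isOpen_affinePart_inter (f : BlockPoly n) :
    IsOpen {x : EPow W n | x ∈ affinePart W n ∧ evalAt f x ≠ 0} := by
  obtain ⟨F, hF, h1, h2⟩ := exists_homogenization (W := W) f (Nat.lt_succ_self _)
  convert isOpen_evalAt_ne (W := W) hF using 1
  ext x
  by_cases hx : x ∈ affinePart W n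
  · simp [hx, h1 x hx]
  · simp [hx, h2 x hx]

theorem isOpen_affinePart : IsOpen (affinePart W n) := by
  convert isOpen_affinePart_inter (W := W) (1 : BlockPoly n) using 1
  ext x
  simp [evalAt]

theorem isPrime_vanishing {Z : Set (EPow W n)} (hirr : IsIrreducible Z)
    (hU : (Z ∩ affinePart W n).Nonempty) : (vanishing (Z ∩ affinePart W n)).IsPrime := by
  refine ⟨fun htop => ?_, fun {f g} hfg => ?_⟩
  · obtain ⟨x, hx⟩ := hU
    have : (1 : BlockPoly n) ∈ vanishing (Z ∩ affinePart W n) := htop ▸ Submodule.mem_top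
    have := mem_vanishing.mp this x hx
    simp [evalAt] at this
  · by_contra! h
    rw [mem_vanishing, mem_vanishing] at h
    push Not at h
    obtain ⟨⟨x, hx, hfx⟩, ⟨y, hy, hgy⟩⟩ := h
    obtain ⟨z, hz, ⟨hz1, hz2⟩, -, hz3⟩ := hirr.isPreirreducible _ _ (isOpen_affinePart_inter f)
      (isOpen_affinePart_inter g) ⟨x, hx.1, hx.2, hfx⟩ ⟨y, hy.1, hy.2, hgy⟩
    have := mem_vanishing.mp hfg z ⟨hz, hz1⟩
    rw [evalAt_mul] at this
    exact mul_ne_zero hz2 hz3 this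

theorem X_sub_one_mem_vanishing (Z : Set (EPow W n)) (i : Fin n) :
    (X (i, 2) - 1 : BlockPoly n) ∈ vanishing (Z ∩ affinePart W n) := by
  rw [mem_vanishing]
  intro x hx
  simp only [evalAt, map_sub, eval_X, map_one]
  rw [coords_two_of_ne (hx.2 i), sub_self]

theorem weierstrass_mem_vanishing (Z : Set (EPow W n)) (i : Fin n) :
    (X (i, 1) ^ 2 + C W.a₁ * X (i, 0) * X (i, 1) + C W.a₃ * X (i, 1) -
      (X (i, 0) ^ 3 + C W.a₂ * X (i, 0) ^ 2 + C W.a₄ * X (i, 0) + C W.a₆) : BlockPoly n) ∈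
      vanishing (Z ∩ affinePart W n) := by
  rw [mem_vanishing]
  intro x hx
  simp only [evalAt, map_sub, map_add, map_mul, map_pow, eval_X, eval_C]
  match h : x i, hx.2 i with
  | .zero, h0 => exact absurd rfl h0
  | .some a b hab, _ =>
    have := (WeierstrassCurve.Affine.equation_iff _ _).mp hab.1
    simp only [coords, Matrix.cons_val]
    linear_combination this

/-- A specialization of the generic point of `Z` is a point of `Z`. -/
theorem exists_point_of_forall_vanishing [W.IsElliptic] {Z : Set (EPow W n)} (hZ : IsClosed Z)
    {c : Fin n × Fin 3 → Qbar} (hc : ∀ f ∈ vanishing (Z ∩ affinePart W n), eval c f = 0) :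
    ∃ z ∈ Z, z ∈ affinePart W n ∧ ∀ q, coords (z q.1) q.2 = c q := by
  have heq : ∀ i, W.toAffine.Equation (c (i, 0)) (c (i, 1)) := by
    intro i
    have := hc _ (weierstrass_mem_vanishing Z i)
    simp only [map_sub, map_add, map_mul, map_pow, eval_X, eval_C] at this
    rw [WeierstrassCurve.Affine.equation_iff]
    linear_combination this
  have hone : ∀ i, c (i, 2) = 1 := by
    intro i
    have := hc _ (X_sub_one_mem_vanishing Z i)
    simp only [map_sub, eval_X, map_one] at this
    linear_combination this
  let z : EPow W n := fun i => .some _ _ ((W.toAffine.equation_iff_nonsingular).mp (heq i))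
  have hz : ∀ q, coords (z q.1) q.2 = c q := by
    rintro ⟨i, j⟩
    fin_cases j
    · rfl
    · rfl
    · exact (hone i).symm
  refine ⟨z, ?_, fun i => WeierstrassCurve.Affine.Point.some_ne_zero _, hz⟩
  by_contra hzZ
  obtain ⟨F, m, -, h1, h2⟩ := exists_evalAt_of_notMem hZ hzZ
  apply h1
  rw [evalAt, funext hz]
  exact hc F (mem_vanishing.mpr fun x hx => h2 x hx.1)

theorem evalAt_rename {m : ℕ} (e : Fin m → Fin n) (f : BlockPoly m) (z : EPow W n) :
    evalAt (rename (Prod.map e id) f) z = evalAt f (z ∘ e) := by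
  rw [evalAt, eval_rename]
  rfl

theorem coords_injective : Function.Injective (coords (W := W)) := fun P Q h =>
  coords_injective_of_smul fun i j => by rw [h]; ring

theorem eq_of_coords_eq {x y : EPow W n} (h : ∀ q : Fin n × Fin 3,
    coords (x q.1) q.2 = coords (y q.1) q.2) : x = y :=
  funext fun i => coords_injective (funext fun j => h (i, j))

/-- The projection of an irreducible closed set contains a nonempty open part of its closure. -/
theorem exists_isOpen_inter_closure_subset [W.IsElliptic] {m : ℕ} (e : Fin m → Fin n)
    {Z : Set (EPow W n)} (hZ : IsClosed Z) (hirr : IsIrreducible Z) :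
    ∃ V : Set (EPow W m), IsOpen V ∧ (V ∩ (· ∘ e) '' Z).Nonempty ∧
      V ∩ closure ((· ∘ e) '' Z) ⊆ (· ∘ e) '' Z := by
  have key : ∀ {Z : Set (EPow W n)}, IsClosed Z → IsIrreducible Z →
      (Z ∩ affinePart W n).Nonempty →
      ∃ V : Set (EPow W m), IsOpen V ∧ (V ∩ (· ∘ e) '' Z).Nonempty ∧
        V ∩ closure ((· ∘ e) '' Z) ⊆ (· ∘ e) '' Z := by
    intro Z hZ hirr hU
    have hI := isPrime_vanishing hirr hU
    obtain ⟨u, hu, hext⟩ := exists_extend_specialization hI (Prod.map e id : Fin m × Fin 3 → _)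
      (h := 1) (fun h => hI.ne_top ((Ideal.eq_top_iff_one _).mpr h))
    refine ⟨_, isOpen_affinePart_inter u, ?_, ?_⟩
    · rw [mem_vanishing] at hu
      push Not at hu
      obtain ⟨z, hz, hz'⟩ := hu
      rw [evalAt_rename] at hz'
      exact ⟨z ∘ e, ⟨fun i => hz.2 (e i), hz'⟩, z, hz.1, rfl⟩
    · rintro y ⟨⟨hy1, hy2⟩, hy3⟩
      -- A relation valid on the projection of the affine part of Z is valid on the closure of the
      -- projection of Z, because the affine part is dense in the irreducible set Z.
      have hspec : ∀ f : BlockPoly m, rename (Prod.map e id) f ∈ vanishing (Z ∩ affinePart W n) →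
          eval (fun q => coords (y q.1) q.2) f = 0 := by
        intro f hf
        by_contra hne
        have hne' : y ∈ {x : EPow W m | x ∈ affinePart W m ∧ evalAt f x ≠ 0} := ⟨hy1, hne⟩
        obtain ⟨_, ⟨hv1, hv2⟩, z, hz, rfl⟩ :=
          mem_closure_iff.mp hy3 _ (isOpen_affinePart_inter f) hne'
        obtain ⟨z', hz', hz1, hz2⟩ := hirr.isPreirreducible (affinePart W n)
          ((· ∘ e) ⁻¹' {x : EPow W m | x ∈ affinePart W m ∧ evalAt f x ≠ 0}) isOpen_affinePart
          ((isOpen_affinePart_inter f).preimage (isMorphism_precomp e).continuous)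
          (by obtain ⟨x, hx⟩ := hU; exact ⟨x, hx⟩) ⟨z, hz, hv1, hv2⟩
        apply hz2.2
        rw [← evalAt_rename]
        exact mem_vanishing.mp hf z' ⟨hz', hz1⟩
      obtain ⟨c', h1, -, h3⟩ := hext _ hspec hy2
      obtain ⟨z, hz, hzU, hzc⟩ := exists_point_of_forall_vanishing hZ h1
      refine ⟨z, hz, eq_of_coords_eq fun q => ?_⟩
      exact (hzc (e q.1, q.2)).trans (congrFun h3 q)
  obtain ⟨z₀, hz₀⟩ := hirr.nonempty
  obtain ⟨a₀, ha₀⟩ := (Set.finite_singleton (0 : W.toAffine.Point)).infinite_compl.nonempty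
  -- This translation takes z₀ to (a₀, …, a₀), so that the translate of Z meets the affine part.
  let a : EPow W n := fun i => a₀ - z₀ i
  let T := translate a
  let T' := translate (a ∘ e)
  have hcomm : (· ∘ e) '' (T '' Z) = T' '' ((· ∘ e) '' Z) := by
    rw [Set.image_image, Set.image_image]
    rfl
  obtain ⟨V, hV, hne, hsub⟩ := key (Z := T '' Z) (T.isClosedMap _ hZ)
    (hirr.image T T.continuous.continuousOn) ⟨T z₀, ⟨z₀, hz₀, rfl⟩, fun i => by
      simp only [T, translate_apply, a, Pi.add_apply]
      simpa using ha₀⟩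
  rw [hcomm] at hne hsub
  refine ⟨T' ⁻¹' V, hV.preimage T'.continuous, ?_, ?_⟩
  · obtain ⟨_, hv, y, hy, rfl⟩ := hne
    exact ⟨y, hv, hy⟩
  · rintro y ⟨hy1, hy2⟩
    have : T' y ∈ T' '' ((· ∘ e) '' Z) := hsub ⟨hy1, by
      rw [← T'.image_closure]
      exact ⟨y, hy2, rfl⟩⟩
    obtain ⟨y', hy', h⟩ := this
    rwa [← T'.injective h]

/-- The closure of a subgroup of `E^n` is a subgroup. -/
noncomputable def closureSubgroup [W.IsElliptic] (B : AddSubgroup (EPow W n)) :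
    AddSubgroup (EPow W n) where
  carrier := closure (B : Set (EPow W n))
  zero_mem' := subset_closure B.zero_mem
  add_mem' := by
    intro a b ha hb
    have h1 : ∀ b ∈ B, ∀ a ∈ closure (B : Set (EPow W n)), a + b ∈ closure (B : Set (EPow W n)) :=
      fun b hb a ha => map_mem_closure (f := translate b) (translate b).continuous ha
        fun x hx => B.add_mem hx hb
    have := map_mem_closure (translate a).continuous hb (t := closure (B : Set (EPow W n)))
      fun x hx => by
        rw [translate_apply, add_comm]
        exact h1 x hx a ha
    rw [closure_closure, translate_apply, add_comm] at this
    exact this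
  neg_mem' := by
    intro a ha
    exact map_mem_closure isMorphism_neg.continuous ha fun x hx => B.neg_mem hx

/-- The projection of a subgroup of `E^n`. -/
noncomputable def projSubgroup {m : ℕ} (e : Fin m → Fin n) (B : AddSubgroup (EPow W n)) :
    AddSubgroup (EPow W m) :=
  B.map (⟨⟨(· ∘ e), rfl⟩, fun _ _ => rfl⟩ : EPow W n →+ EPow W m)

theorem coe_projSubgroup {m : ℕ} (e : Fin m → Fin n) (B : AddSubgroup (EPow W n)) :
    (projSubgroup e B : Set (EPow W m)) = (· ∘ e) '' (B : Set (EPow W n)) := rfl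

/-- The projection of an irreducible closed subgroup is closed. -/
theorem isClosed_projSubgroup [W.IsElliptic] {m : ℕ} (e : Fin m → Fin n)
    {B : AddSubgroup (EPow W n)} (hB : IsAbelianSubvariety B) :
    IsClosed (projSubgroup e B : Set (EPow W m)) := by
  obtain ⟨V, hV, ⟨v, hv, hvB⟩, hsub⟩ := exists_isOpen_inter_closure_subset e hB.1 hB.2
  rw [← coe_projSubgroup] at hvB hsub
  have hirr : IsIrreducible (closure (projSubgroup e B : Set (EPow W m))) := by
    rw [coe_projSubgroup]
    exact (hB.2.image _ (isMorphism_precomp e).continuous.continuousOn).closure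
  refine isClosed_of_closure_subset fun x hx => ?_
  let D := closureSubgroup (projSubgroup e B)
  have hvD : v ∈ D := subset_closure hvB
  have hc : Continuous (fun y : EPow W m => x - y) := by
    have := (isMorphism_add_const x).continuous.comp (isMorphism_neg (W := W) (n := m)).continuous
    convert this using 1
    funext y
    simp [sub_eq_neg_add]
  -- V and x - V both meet the irreducible closure, hence meet inside it; then x = (x - y) + y is a
  -- sum of two elements of the projection.
  obtain ⟨y, hy, hy1, hy2⟩ := hirr.isPreirreducible V ((fun y => x - y) ⁻¹' V) hV
    (hV.preimage hc) ⟨v, hvD, hv⟩ ⟨x - v, D.sub_mem hx hvD, by simpa using hv⟩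
  have h1 : y ∈ projSubgroup e B := hsub ⟨hy1, hy⟩
  have h2 : x - y ∈ projSubgroup e B := hsub ⟨hy2, D.sub_mem hx hy⟩
  have := (projSubgroup e B).add_mem h2 h1
  simpa using this

end EllipticPower

/-! ### Lower bounds for dimensions -/

-- Every chain of irreducible closed subsets of Z' can be extended by Z itself.
open Topology TopologicalSpace in
theorem topologicalKrullDim_add_one_le {X : Type*} [TopologicalSpace X] {Z' Z : Set X}
    (hZ' : IsClosed Z') (hirr' : Z'.Nonempty) (hirr : IsIrreducible Z) (h : Z' ⊂ Z) :
    topologicalKrullDim Z' + 1 ≤ topologicalKrullDim Z := by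
  obtain ⟨z', hz'⟩ := hirr'
  -- Without it the dimension of Z' would be the bottom element, and adjoining a top would not add
  -- one.
  have : Nonempty (IrreducibleCloseds Z') :=
    ⟨⟨closure {⟨z', hz'⟩}, isIrreducible_singleton.closure, isClosed_closure⟩⟩
  have : IrreducibleSpace Z := Subtype.irreducibleSpace hirr
  have hι : IsInducing (Set.inclusion h.subset) := (IsEmbedding.inclusion h.subset).isInducing
  let top : IrreducibleCloseds Z := ⟨Set.univ, IrreducibleSpace.isIrreducible_univ Z, isClosed_univ⟩
  let φ : WithTop (IrreducibleCloseds Z') → IrreducibleCloseds Z := fun T =>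
    T.recTopCoe top (IrreducibleCloseds.map _ hι.continuous)
  have hφ : StrictMono φ := by
    intro a b hab
    induction a using WithTop.recTopCoe with
    | top => exact absurd hab not_top_lt
    | coe a =>
      induction b using WithTop.recTopCoe with
      | coe b =>
        exact IrreducibleCloseds.map_strictMono_of_isInducing hι (WithTop.coe_lt_coe.mp hab)
      | top =>
        refine lt_of_le_of_ne (fun x _ => Set.mem_univ x) fun heq => ?_
        obtain ⟨x, hx, hx'⟩ := Set.exists_of_ssubset h
        have h1 : (⟨x, hx⟩ : Z) ∈ φ (a : WithTop (IrreducibleCloseds Z')) := by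
          rw [heq]; exact Set.mem_univ _
        have h2 : closure (Set.inclusion h.subset '' (a : Set Z')) ⊆ Subtype.val ⁻¹' Z' := by
          refine closure_minimal ?_ (hZ'.preimage continuous_subtype_val)
          rintro _ ⟨y, -, rfl⟩
          exact y.2
        exact hx' (h2 h1)
  rw [topologicalKrullDim, topologicalKrullDim, ← Order.krullDim_WithTop]
  exact Order.krullDim_le_of_strictMono φ hφ

namespace EllipticPower

variable {W : WeierstrassCurve Qbar} {n : ℕ}

/-- Z has finitely many components; the closures of their projections cover the irreducible space
E^m, so one of them is everything. -/
theorem exists_irreducible_subset_dense [W.IsElliptic] {m : ℕ} (e : Fin m → Fin n)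
    {Z : Set (EPow W n)} (hZ : IsClosed Z) (hd : Dense ((· ∘ e) '' Z : Set (EPow W m))) :
    ∃ Z' ⊆ Z, IsClosed Z' ∧ IsIrreducible Z' ∧ Dense ((· ∘ e) '' Z' : Set (EPow W m)) := by
  classical
  obtain ⟨S, hS, hc, hi, rfl⟩ :=
    TopologicalSpace.NoetherianSpace.exists_finite_set_isClosed_irreducible hZ
  have huniv := IrreducibleSpace.isIrreducible_univ (EPow W m)
  rw [isIrreducible_iff_sUnion_isClosed] at huniv
  obtain ⟨_, ht, hsub⟩ := huniv (hS.toFinset.image fun Y => closure ((· ∘ e) '' Y)) (by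
      intro _ hz
      obtain ⟨Y, -, rfl⟩ := Finset.mem_image.mp hz
      exact isClosed_closure) (by
    rw [← hd.closure_eq]
    refine closure_minimal ?_ ?_
    · rintro _ ⟨z, ⟨Y, hY, hzY⟩, rfl⟩
      refine ⟨closure ((· ∘ e) '' Y), ?_, subset_closure ⟨z, hzY, rfl⟩⟩
      exact Finset.mem_coe.mpr (Finset.mem_image.mpr ⟨Y, hS.mem_toFinset.mpr hY, rfl⟩)
    · rw [Set.sUnion_eq_biUnion]
      refine Set.Finite.isClosed_biUnion (Finset.finite_toSet _) ?_
      intro _ hz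
      obtain ⟨Y, -, rfl⟩ := Finset.mem_image.mp hz
      exact isClosed_closure)
  obtain ⟨Y, hY, rfl⟩ := Finset.mem_image.mp ht
  rw [hS.mem_toFinset] at hY
  exact ⟨Y, Set.subset_sUnion_of_mem hY, hc Y hY, hi Y hY,
    dense_iff_closure_eq.mpr (Set.univ_subset_iff.mp hsub)⟩

theorem exists_isOpen_subset_image [W.IsElliptic] {m : ℕ} (e : Fin m → Fin n)
    {Z : Set (EPow W n)} (hZ : IsClosed Z) (hirr : IsIrreducible Z)
    (hd : Dense ((· ∘ e) '' Z : Set (EPow W m))) :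
    ∃ V : Set (EPow W m), IsOpen V ∧ V.Nonempty ∧ V ⊆ (· ∘ e) '' Z := by
  obtain ⟨V, hV, hne, hsub⟩ := exists_isOpen_inter_closure_subset e hZ hirr
  rw [hd.closure_eq, Set.inter_univ] at hsub
  exact ⟨V, hV, hne.mono Set.inter_subset_left, hsub⟩

/-- A closed set dominating `E^m` has dimension at least `m`. -/
theorem le_topologicalKrullDim_of_dense [W.IsElliptic] {m : ℕ} (e : Fin m → Fin n)
    {Z : Set (EPow W n)} (hZ : IsClosed Z) (hirr : IsIrreducible Z)
    (hd : Dense ((· ∘ e) '' Z : Set (EPow W m))) :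
    (m : WithBot ℕ∞) ≤ topologicalKrullDim Z := by
  induction m generalizing Z with
  | zero =>
    obtain ⟨z, hz⟩ := hirr.nonempty
    have : Nonempty (TopologicalSpace.IrreducibleCloseds Z) :=
      ⟨⟨closure {⟨z, hz⟩}, isIrreducible_singleton.closure, isClosed_closure⟩⟩
    exact Order.krullDim_nonneg
  | succ m ih =>
    obtain ⟨V, hV, ⟨y, hy⟩, hsub⟩ := exists_isOpen_subset_image e hZ hirr hd
    have hyt : y = Fin.snoc (Fin.init y) (y (Fin.last m)) := (Fin.snoc_init_self y).symm
    -- Fixing one coordinate at the value of a point y of V, the slice of Z still dominates E^m,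
    -- since its projection contains the corresponding slice of V.
    have hdense : Dense ((· ∘ (e ∘ Fin.castSucc)) ''
        (Z ∩ {z | z (e (Fin.last m)) = y (Fin.last m)}) : Set (EPow W m)) := by
      refine Dense.mono ?_ ((hV.preimage (continuous_snoc_const (y (Fin.last m)))).dense
        ⟨Fin.init y, by rw [Set.mem_preimage, ← hyt]; exact hy⟩)
      intro x hx
      obtain ⟨z, hz, hzx⟩ := hsub hx
      refine ⟨z, ⟨hz, ?_⟩, ?_⟩
      · have := congrFun hzx (Fin.last m)
        simpa using this
      · funext i
        have := congrFun hzx i.castSucc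
        simpa using this
    obtain ⟨Z', hsub', hc', hi', hd'⟩ := exists_irreducible_subset_dense (e ∘ Fin.castSucc)
      (hZ.inter (isClosed_apply_eq _ _)) hdense
    have h1 := ih (e ∘ Fin.castSucc) hc' hi' hd'
    -- The slice is proper: V contains points that differ from y only in the last coordinate.
    have hss : Z' ⊂ Z := by
      refine ⟨fun z hz => (hsub' hz).1, fun hle => ?_⟩
      have hopen := hV.preimage (continuous_const_snoc (Fin.init y))
      have hne : ((fun t : EPow W 1 => (Fin.snoc (Fin.init y) (t 0) : EPow W (m + 1))) ⁻¹' V)ᶜ ≠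
          Set.univ := by
        intro h
        have : (fun _ => y (Fin.last m) : EPow W 1) ∈
          ((fun t : EPow W 1 => (Fin.snoc (Fin.init y) (t 0) : EPow W (m + 1))) ⁻¹' V)ᶜ := by
            rw [h]; trivial
        exact this (by rw [Set.mem_preimage, ← hyt]; exact hy)
      have hfin := finite_of_isClosed_ne_univ hopen.isClosed_compl hne
      obtain ⟨t, ht⟩ := (hfin.insert (fun _ => y (Fin.last m))).infinite_compl.nonempty
      simp only [Set.mem_compl_iff, Set.mem_insert_iff, not_or, not_not] at ht
      obtain ⟨z, hz, hzt⟩ := hsub ht.2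
      apply ht.1
      have h2 := (hsub' (hle hz)).2
      have h3 := congrFun hzt (Fin.last m)
      have h4 : z (e (Fin.last m)) = t 0 := by simpa using h3
      funext i
      fin_cases i
      exact h4.symm.trans h2
    refine le_trans ?_ (topologicalKrullDim_add_one_le hc' hi'.nonempty hirr hss)
    push_cast
    exact add_le_add_left h1 1

/-! ### Torsion and divisibility -/

theorem isClosed_eq_of_hasLocalRep {φ ψ : EPow W n → W.toAffine.Point}
    (hφ : ∀ x, HasLocalRep φ x) (hψ : ∀ x, HasLocalRep ψ x) :
    IsClosed {z : EPow W n | φ z = ψ z} := by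
  have : IsMorphism (fun z : EPow W n => (![φ z, ψ z] : EPow W 2)) := fun x =>
    Fin.forall_fin_two.mpr ⟨hφ x, hψ x⟩
  exact (isClosed_apply_eq_apply (W := W) (0 : Fin 2) 1).preimage this.continuous

theorem finite_or_eq_univ_of_isClosed [W.IsElliptic] {A : Set W.toAffine.Point}
    (h : IsClosed ((fun z : EPow W 1 => z 0) ⁻¹' A)) : A.Finite ∨ A = Set.univ := by
  by_cases hA : ((fun z : EPow W 1 => z 0) ⁻¹' A) = Set.univ
  · right
    refine Set.eq_univ_of_forall fun P => ?_
    have : (fun _ => P : EPow W 1) ∈ ((fun z : EPow W 1 => z 0) ⁻¹' A) := hA ▸ Set.mem_univ _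
    exact this
  · left
    refine ((finite_of_isClosed_ne_univ h hA).image (fun z => z 0)).subset fun P hP => ?_
    exact ⟨fun _ => P, hP, rfl⟩

theorem isClosed_zsmul_eq [W.IsElliptic] (a : ℤ) (i j : Fin n) :
    IsClosed {z : EPow W n | a • z i = z j} :=
  isClosed_eq_of_hasLocalRep (fun x => (hasLocalRep_apply i x).zsmul a) (hasLocalRep_apply j)

/-- The graph of multiplication by `a`. -/
noncomputable def zsmulGraph (W : WeierstrassCurve Qbar) (a : ℤ) : AddSubgroup (EPow W 2) where
  carrier := {z | a • z 0 = z 1}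
  zero_mem' := zsmul_zero a
  add_mem' := by
    intro x y hx hy
    have hx : a • x 0 = x 1 := hx
    have hy : a • y 0 = y 1 := hy
    change a • (x 0 + y 0) = x 1 + y 1
    rw [zsmul_add, hx, hy]
  neg_mem' := by
    intro x hx
    have hx : a • x 0 = x 1 := hx
    change a • (-x 0) = -x 1
    rw [zsmul_neg, hx]

theorem isAbelianSubvariety_zsmulGraph [W.IsElliptic] (a : ℤ) :
    IsAbelianSubvariety (zsmulGraph W a) := by
  refine ⟨isClosed_zsmul_eq a 0 1, ?_⟩
  have hmor : IsMorphism (fun t : EPow W 1 => (![t 0, a • t 0] : EPow W 2)) := fun x =>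
    Fin.forall_fin_two.mpr ⟨hasLocalRep_apply 0 x, (hasLocalRep_apply 0 x).zsmul a⟩
  have := (IrreducibleSpace.isIrreducible_univ (EPow W 1)).image _ hmor.continuous.continuousOn
  convert this using 1
  ext z
  constructor
  · intro hz
    have hz : a • z 0 = z 1 := hz
    refine ⟨fun _ => z 0, trivial, funext fun i => ?_⟩
    fin_cases i
    · rfl
    · exact hz
  · rintro ⟨t, -, rfl⟩
    exact rfl

/-- Kernel and image are closed in E, the image as a projection of the graph, so each is finite or
everything. Both cannot be finite, as E is infinite. -/
theorem finite_torsion_and_surjective_or [W.IsElliptic] (a : ℤ) :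
    ({P : W.toAffine.Point | a • P = 0}.Finite ∧ ∀ Q : W.toAffine.Point, ∃ P, a • P = Q) ∨
      ∀ P : W.toAffine.Point, a • P = 0 := by
  have h1 : {P : W.toAffine.Point | a • P = 0}.Finite ∨ {P : W.toAffine.Point | a • P = 0} =
      Set.univ := finite_or_eq_univ_of_isClosed
    (isClosed_eq_of_hasLocalRep (n := 1) (fun x => (hasLocalRep_apply 0 x).zsmul a)
      (hasLocalRep_const 0))
  have h2 : {Q : W.toAffine.Point | ∃ P, a • P = Q}.Finite ∨
      {Q : W.toAffine.Point | ∃ P, a • P = Q} = Set.univ := by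
    apply finite_or_eq_univ_of_isClosed
    convert isClosed_projSubgroup (fun _ : Fin 1 => (1 : Fin 2))
      (isAbelianSubvariety_zsmulGraph (W := W) a) using 1
    ext z
    constructor
    · rintro ⟨P, hP⟩
      refine ⟨![P, z 0], hP, funext fun i => ?_⟩
      fin_cases i
      rfl
    · rintro ⟨y, hy, rfl⟩
      exact ⟨y 0, hy⟩
  rcases h1 with h1 | h1
  · left
    refine ⟨h1, ?_⟩
    rcases h2 with h2 | h2
    · exfalso
      have : (Set.univ : Set W.toAffine.Point).Finite := by
        refine Set.Finite.of_finite_fibers (fun P => a • P) (h2.subset ?_) ?_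
        · rintro _ ⟨P, -, rfl⟩
          exact ⟨P, rfl⟩
        · rintro _ ⟨P₀, -, rfl⟩
          refine (h1.image (fun T => T + P₀)).subset ?_
          rintro P ⟨-, hP⟩
          have hP : a • P = a • P₀ := hP
          refine ⟨P - P₀, ?_, sub_add_cancel _ _⟩
          change a • (P - P₀) = 0
          rw [zsmul_sub, hP, sub_self]
      exact Set.infinite_univ this
    · intro Q
      exact (h2 ▸ Set.mem_univ Q : Q ∈ {Q : W.toAffine.Point | ∃ P, a • P = Q})
  · right
    intro P
    exact (h1 ▸ Set.mem_univ P : P ∈ {P : W.toAffine.Point | a • P = 0})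

theorem exists_two_torsion_ne_zero (W : WeierstrassCurve Qbar) [W.IsElliptic] :
    ∃ T : W.toAffine.Point, T ≠ 0 ∧ (2 : ℕ) • T = 0 := by
  have hdeg : W.twoTorsionPolynomial.toPoly.degree ≠ 0 := by
    rw [Cubic.degree_of_a_ne_zero (by simp [WeierstrassCurve.twoTorsionPolynomial])]
    decide
  obtain ⟨x, hx⟩ := IsAlgClosed.exists_root _ hdeg
  have heq : W.toAffine.Equation x (-(W.a₁ * x + W.a₃) / 2) := by
    rw [WeierstrassCurve.Affine.equation_iff]
    simp only [WeierstrassCurve.twoTorsionPolynomial, Cubic.toPoly, Polynomial.IsRoot.def,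
      Polynomial.eval_add, Polynomial.eval_mul, Polynomial.eval_C, Polynomial.eval_pow,
      Polynomial.eval_X, WeierstrassCurve.b₂, WeierstrassCurve.b₄, WeierstrassCurve.b₆] at hx
    linear_combination -(1 / 4) * hx
  refine ⟨.some _ _ ((W.toAffine.equation_iff_nonsingular).mp heq),
    WeierstrassCurve.Affine.Point.some_ne_zero _, ?_⟩
  rw [two_torsion_some_iff]
  ring

/-- Write a = 2^k b with b odd and let T have order 2. Doubling has finite kernel, so it is
surjective and 2^k P = T for some P; then aP = bT = T. -/
theorem exists_zsmul_ne_zero (W : WeierstrassCurve Qbar) [W.IsElliptic] {a : ℤ} (ha : a ≠ 0) :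
    ∃ P : W.toAffine.Point, a • P ≠ 0 := by
  obtain ⟨T, hT, hT2⟩ := exists_two_torsion_ne_zero W
  have hdiv : ∀ Q : W.toAffine.Point, ∃ P, (2 : ℤ) • P = Q := by
    rcases finite_torsion_and_surjective_or (W := W) 2 with h | h
    · exact h.2
    · exfalso
      have hfin := finite_two_torsion (W := W)
      refine Set.infinite_univ (hfin.subset fun P _ => ?_)
      have := h P
      change (2 : ℕ) • P = 0
      exact_mod_cast this
  have hpow : ∀ k : ℕ, ∃ P : W.toAffine.Point, (2 ^ k : ℤ) • P = T := by
    intro k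
    induction k with
    | zero => exact ⟨T, by simp⟩
    | succ k ih =>
      obtain ⟨P, hP⟩ := ih
      obtain ⟨P', hP'⟩ := hdiv P
      exact ⟨P', by rw [pow_succ, mul_zsmul, hP', hP]⟩
  obtain ⟨k, b, hb, hab⟩ : ∃ (k : ℕ) (b : ℤ), Odd b ∧ a = 2 ^ k * b := by
    obtain ⟨k, m, hm, h⟩ := Nat.exists_eq_two_pow_mul_odd (Int.natAbs_ne_zero.mpr ha)
    have hm' : Odd (m : ℤ) := by exact_mod_cast hm
    rcases Int.natAbs_eq a with h' | h'
    · exact ⟨k, m, hm', by rw [h', h]; push_cast; ring⟩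
    · exact ⟨k, -m, hm'.neg, by rw [h', h]; push_cast; ring⟩
  obtain ⟨P, hP⟩ := hpow k
  refine ⟨P, ?_⟩
  obtain ⟨l, rfl⟩ := hb
  have hT2' : (2 : ℤ) • T = 0 := by exact_mod_cast hT2
  rw [hab, mul_comm, mul_zsmul, hP, add_zsmul, one_zsmul, mul_comm, mul_zsmul, hT2', zsmul_zero,
    zero_add]
  exact hT

theorem finite_torsion [W.IsElliptic] {a : ℤ} (ha : a ≠ 0) :
    {P : W.toAffine.Point | a • P = 0}.Finite := by
  rcases finite_torsion_and_surjective_or (W := W) a with h | h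
  · exact h.1
  · obtain ⟨P, hP⟩ := exists_zsmul_ne_zero W ha
    exact absurd (h P) hP

theorem exists_zsmul_eq [W.IsElliptic] {a : ℤ} (ha : a ≠ 0) (Q : W.toAffine.Point) :
    ∃ P, a • P = Q := by
  rcases finite_torsion_and_surjective_or (W := W) a with h | h
  · exact h.2 Q
  · obtain ⟨P, hP⟩ := exists_zsmul_ne_zero W ha
    exact absurd (h P) hP

end EllipticPower

/-! ### Algebraic relations between generic coordinates -/

namespace EllipticPower

open MvPolynomial

section Algebra

variable {k σ τ : Type*} [Field k]

theorem aeval_elim_eq_eval₂ {R : Type*} [CommRing R] [Algebra k R] (ξ : τ → R) (t : R)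
    (f : MvPolynomial (Option τ) k) :
    aeval (fun o : Option τ => o.elim t ξ) f =
      (optionEquivLeft k τ f).eval₂ (aeval ξ : MvPolynomial τ k →ₐ[k] R).toRingHom t := by
  induction f using MvPolynomial.induction_on with
  | C a => simp
  | add p q hp hq => rw [map_add, map_add, Polynomial.eval₂_add, hp, hq]
  | mul_X p o hp =>
    rw [map_mul, map_mul, Polynomial.eval₂_mul, hp]
    congr 1
    cases o <;> simp

/-- If a coordinate of the generic point is transcendental over some other coordinates, it takes
infinitely many values on a fibre. -/
theorem infinite_specialization_of_transcendental [IsAlgClosed k] [Finite σ] [Finite τ]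
    {R : Type*} [CommRing R] [IsDomain R] [Algebra k R]
    {I : Ideal (MvPolynomial σ k)} (hI : I.IsPrime) {θ : σ → R}
    (hθ : ∀ f : MvPolynomial σ k, aeval θ f = 0 ↔ f ∈ I) (ρ : τ → σ) (s : σ)
    (hs : Transcendental (Algebra.adjoin k (Set.range (θ ∘ ρ))) (θ s)) :
    ∃ c : τ → k, {t : k | ∃ c' : σ → k, (∀ f ∈ I, eval c' f = 0) ∧ c' ∘ ρ = c ∧
      c' s = t}.Infinite := by
  let ρ' : Option τ → σ := fun o => o.elim s ρ
  have hρ' : θ ∘ ρ' = fun o => o.elim (θ s) (θ ∘ ρ) := by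
    funext o
    cases o <;> rfl
  -- Transcendence of θ_s: a polynomial relation involving it holds only if each coefficient, a
  -- polynomial in the other coordinates, is itself a relation.
  have hmem : ∀ f : MvPolynomial (Option τ) k, rename ρ' f ∈ I ↔
      ∀ i, rename ρ ((optionEquivLeft k τ f).coeff i) ∈ I := by
    intro f
    rw [← hθ, aeval_rename, hρ', aeval_elim_eq_eval₂]
    let φ : MvPolynomial τ k →ₐ[k] Algebra.adjoin k (Set.range (θ ∘ ρ)) :=
      aeval fun t => ⟨θ (ρ t), Algebra.subset_adjoin ⟨t, rfl⟩⟩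
    have hφ : ∀ g, ((φ g : Algebra.adjoin k (Set.range (θ ∘ ρ))) : R) = aeval (θ ∘ ρ) g := by
      intro g
      have : (Algebra.adjoin k (Set.range (θ ∘ ρ))).val.comp φ = aeval (θ ∘ ρ) := by
        ext t
        simp [φ]
      exact congrArg (fun h => h g) this
    have h1 : (optionEquivLeft k τ f).eval₂ (aeval (θ ∘ ρ) : MvPolynomial τ k →ₐ[k] R).toRingHom
        (θ s) = Polynomial.aeval (θ s) ((optionEquivLeft k τ f).map φ.toRingHom) := by
      rw [Polynomial.aeval_def, Polynomial.eval₂_map]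
      congr 1
      ext g
      · simp
      · simp [φ]
    rw [h1]
    constructor
    · intro h0 i
      have h2 := congrArg (fun p => (p.coeff i : R)) (transcendental_iff.mp hs _ h0)
      simp only [Polynomial.coeff_map, Polynomial.coeff_zero] at h2
      rw [← hθ, aeval_rename, ← hφ]
      exact h2
    · intro h0
      have h2 : (optionEquivLeft k τ f).map φ.toRingHom = 0 := by
        ext i
        rw [Polynomial.coeff_map, Polynomial.coeff_zero]
        refine (hφ _).trans ?_
        rw [← aeval_rename]
        exact (hθ _).mpr (h0 i)
      rw [h2, map_zero]
  obtain ⟨u, hu, hext⟩ := exists_extend_specialization hI ρ' (h := 1)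
    (fun h => hI.ne_top ((Ideal.eq_top_iff_one _).mpr h))
  rw [hmem] at hu
  push Not at hu
  obtain ⟨i, hi⟩ := hu
  obtain ⟨c₀, h1, h2⟩ := exists_specialization hI hi
  refine ⟨c₀ ∘ ρ, ?_⟩
  have heval : ∀ g : MvPolynomial τ k, eval c₀ (rename ρ g) = eval (c₀ ∘ ρ) g := fun g =>
    eval_rename _ _ _
  -- The obstruction u at fixed values of the other coordinates is a nonzero polynomial in t, so all
  -- but finitely many t extend.
  let v := (optionEquivLeft k τ u).map (eval (c₀ ∘ ρ))
  have hv : v ≠ 0 := by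
    intro h0
    have := congrArg (fun p => p.coeff i) h0
    simp only [v, Polynomial.coeff_map, Polynomial.coeff_zero] at this
    exact h2 ((heval _).trans this)
  refine ((Polynomial.finite_setOfPred_isRoot hv).infinite_compl).mono fun t ht => ?_
  obtain ⟨c', h3, -, h4⟩ := hext (fun o => o.elim t (c₀ ∘ ρ)) (by
      intro f hf
      rw [optionEquivLeft_elim_eval]
      convert Polynomial.eval_zero
      ext j
      rw [Polynomial.coeff_map, Polynomial.coeff_zero, ← heval]
      exact h1 _ ((hmem f).mp hf j)) (by
    rw [optionEquivLeft_elim_eval]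
    exact ht)
  exact ⟨c', h3, funext fun a => congrFun h4 (some a), congrFun h4 none⟩

theorem isIntegral_of_sq_add {R A : Type*} [CommRing R] [Nontrivial R] [CommRing A] [Algebra R A]
    (b c : R) {y : A} (h : y ^ 2 + algebraMap R A b * y = algebraMap R A c) : IsIntegral R y := by
  refine ⟨.X ^ 2 + (.C b * .X - .C c), ?_, ?_⟩
  · refine (Polynomial.monic_X_pow 2).add_of_left ?_
    rw [Polynomial.degree_X_pow]
    refine lt_of_le_of_lt (Polynomial.degree_sub_le _ _) (max_lt ?_ ?_)
    · exact lt_of_le_of_lt (Polynomial.degree_C_mul_X_le _) (by decide)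
    · exact lt_of_le_of_lt Polynomial.degree_C_le (by decide)
  · simp only [Polynomial.eval₂_sub, Polynomial.eval₂_add, Polynomial.eval₂_mul,
      Polynomial.eval₂_pow, Polynomial.eval₂_X, Polynomial.eval₂_C]
    linear_combination h

/-- Noether normalization: R is integral over a polynomial ring in s ≤ m variables, and in an
integral extension strict inclusions of primes remain strict after contraction. -/
theorem ringKrullDim_le_of_trdeg_le {R : Type*} [CommRing R] [IsDomain R] [Algebra k R]
    [Algebra.FiniteType k R] {m : ℕ} (h : Algebra.trdeg k R ≤ m) : ringKrullDim R ≤ m := by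
  obtain ⟨s, g, hinj, h_int⟩ := exists_integral_inj_algHom_of_fg k R
  have hs : s ≤ m := by
    have hind : AlgebraicIndependent k (fun i => g (X i)) := by
      rw [AlgebraicIndependent]
      convert hinj
      ext i
      simp
    have := hind.lift_cardinalMk_le_trdeg.trans (Cardinal.lift_le.mpr h)
    simpa using this
  let _ : Algebra (MvPolynomial (Fin s) k) R := g.toRingHom.toAlgebra
  have : Algebra.IsIntegral (MvPolynomial (Fin s) k) R := ⟨h_int⟩
  have hle : ringKrullDim R ≤ ringKrullDim (MvPolynomial (Fin s) k) := by
    refine Order.krullDim_le_of_strictMono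
      (PrimeSpectrum.comap (algebraMap (MvPolynomial (Fin s) k) R)) fun p q hpq => ?_
    exact Ideal.IsIntegral.comap_lt_comap (I := p.asIdeal) (J := q.asIdeal) hpq
  refine hle.trans ?_
  rw [MvPolynomial.ringKrullDim_of_isNoetherianRing, ringKrullDim_eq_zero_of_field, zero_add,
    Nat.card_fin]
  exact_mod_cast hs

end Algebra

/-! ### Finite fibres bound the dimension from above -/

variable {W : WeierstrassCurve Qbar} {n : ℕ}

/-- The generic point of the affine part of `Z`. -/
noncomputable def genericPoint (Z : Set (EPow W n)) :
    Fin n × Fin 3 → BlockPoly n ⧸ vanishing (Z ∩ affinePart W n) :=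
  fun q => Ideal.Quotient.mk _ (X q)

theorem aeval_genericPoint (Z : Set (EPow W n)) (f : BlockPoly n) :
    aeval (genericPoint Z) f = Ideal.Quotient.mk (vanishing (Z ∩ affinePart W n)) f := by
  have : aeval (genericPoint Z) = Ideal.Quotient.mkₐ Qbar (vanishing (Z ∩ affinePart W n)) := by
    ext q
    simp [genericPoint]
  rw [this]
  rfl

theorem aeval_genericPoint_eq_zero (Z : Set (EPow W n)) (f : BlockPoly n) :
    aeval (genericPoint Z) f = 0 ↔ f ∈ vanishing (Z ∩ affinePart W n) := by
  rw [aeval_genericPoint, Ideal.Quotient.eq_zero_iff_mem]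

/-- A coordinate transcendental over those of the base would take infinitely many values on some
fibre. -/
theorem isAlgebraic_genericPoint_of_finite [W.IsElliptic] {m : ℕ} (e : Fin m → Fin n)
    {Z : Set (EPow W n)} (hZ : IsClosed Z)
    (hI : (vanishing (Z ∩ affinePart W n)).IsPrime)
    (hfin : ∀ y : EPow W m, {z ∈ Z | z ∘ e = y}.Finite) (q : Fin n × Fin 3) :
    IsAlgebraic (Algebra.adjoin Qbar (Set.range (genericPoint Z ∘ Prod.map e id)))
      (genericPoint Z q) := by
  by_contra hq
  have : IsDomain (BlockPoly n ⧸ vanishing (Z ∩ affinePart W n)) :=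
    (Ideal.Quotient.isDomain_iff_prime _).mpr hI
  obtain ⟨c, hc⟩ := infinite_specialization_of_transcendental hI (aeval_genericPoint_eq_zero Z)
    (Prod.map e id) q hq
  obtain ⟨t₀, c₀, h₀, hc₀, -⟩ := hc.nonempty
  obtain ⟨z₀, hz₀, -, hzc₀⟩ := exists_point_of_forall_vanishing hZ h₀
  refine hc (((hfin (z₀ ∘ e)).image fun z => coords (z q.1) q.2).subset ?_)
  rintro t ⟨c', h1, h2, rfl⟩
  obtain ⟨z, hz, -, hzc⟩ := exists_point_of_forall_vanishing hZ h1
  refine ⟨z, ⟨hz, eq_of_coords_eq fun p => ?_⟩, hzc q⟩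
  refine (hzc (Prod.map e id p)).trans ((congrFun (h2.trans hc₀.symm) p).trans ?_)
  exact (hzc₀ (Prod.map e id p)).symm

/-- The m coordinates X of the base suffice: there Y is integral over X by the Weierstrass equation
and Z = 1, and finiteness of the fibres makes all remaining coordinates algebraic. -/
theorem trdeg_le_of_finite [W.IsElliptic] {m : ℕ} (e : Fin m → Fin n)
    {Z : Set (EPow W n)} (hZ : IsClosed Z)
    (hI : (vanishing (Z ∩ affinePart W n)).IsPrime)
    (hfin : ∀ y : EPow W m, {z ∈ Z | z ∘ e = y}.Finite) :
    Algebra.trdeg Qbar (BlockPoly n ⧸ vanishing (Z ∩ affinePart W n)) ≤ m := by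
  have : IsDomain (BlockPoly n ⧸ vanishing (Z ∩ affinePart W n)) :=
    (Ideal.Quotient.isDomain_iff_prime _).mpr hI
  let S : Set (BlockPoly n ⧸ vanishing (Z ∩ affinePart W n)) :=
    Set.range fun i : Fin m => genericPoint Z (e i, 0)
  have h1 : ∀ x ∈ Set.range (genericPoint Z ∘ Prod.map e (id : Fin 3 → Fin 3)),
      IsAlgebraic (Algebra.adjoin Qbar S) x := by
    rintro _ ⟨⟨i, j⟩, rfl⟩
    have hX : genericPoint Z (e i, 0) ∈ Algebra.adjoin Qbar S :=
      Algebra.subset_adjoin ⟨i, rfl⟩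
    fin_cases j
    · exact isAlgebraic_algebraMap (⟨_, hX⟩ : Algebra.adjoin Qbar S)
    · let ξ : Algebra.adjoin Qbar S := ⟨_, hX⟩
      let α : Qbar → Algebra.adjoin Qbar S := algebraMap _ _
      refine (isIntegral_of_sq_add (α W.a₁ * ξ + α W.a₃)
        (ξ ^ 3 + α W.a₂ * ξ ^ 2 + α W.a₄ * ξ + α W.a₆) ?_).isAlgebraic
      have := (aeval_genericPoint_eq_zero Z _).mpr (weierstrass_mem_vanishing Z (e i))
      simp only [map_sub, map_add, map_mul, map_pow, aeval_X, ← algebraMap_eq,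
        AlgHom.commutes] at this
      change genericPoint Z (e i, 1) ^ 2 + (algebraMap _ _ W.a₁ * genericPoint Z (e i, 0) +
        algebraMap _ _ W.a₃) * genericPoint Z (e i, 1) = (genericPoint Z (e i, 0) ^ 3 +
        algebraMap _ _ W.a₂ * genericPoint Z (e i, 0) ^ 2 +
        algebraMap _ _ W.a₄ * genericPoint Z (e i, 0) + algebraMap _ _ W.a₆)
      linear_combination this
    · have := (aeval_genericPoint_eq_zero Z _).mpr (X_sub_one_mem_vanishing Z (e i))
      rw [map_sub, aeval_X, map_one, sub_eq_zero] at this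
      change IsAlgebraic _ (genericPoint Z (e i, 2))
      rw [this]
      exact isAlgebraic_one
  have h2 : ∀ x : BlockPoly n ⧸ vanishing (Z ∩ affinePart W n),
      IsAlgebraic (Algebra.adjoin Qbar (Set.range (genericPoint Z))) x := by
    intro x
    obtain ⟨f, rfl⟩ := Ideal.Quotient.mk_surjective x
    rw [← aeval_genericPoint]
    have : aeval (genericPoint Z) f ∈ Algebra.adjoin Qbar (Set.range (genericPoint Z)) := by
      rw [Algebra.adjoin_range_eq_range_aeval]
      exact ⟨f, rfl⟩
    exact isAlgebraic_algebraMap (⟨_, this⟩ : Algebra.adjoin Qbar (Set.range (genericPoint Z)))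
  have : Algebra.IsAlgebraic (Algebra.adjoin Qbar S)
      (BlockPoly n ⧸ vanishing (Z ∩ affinePart W n)) := by
    refine ⟨fun x => ?_⟩
    refine IsAlgebraic.adjoin_of_forall_isAlgebraic (fun y hy => h1 y hy.1) ?_
    refine IsAlgebraic.adjoin_of_forall_isAlgebraic (fun y hy => ?_) (h2 x)
    obtain ⟨q, rfl⟩ := hy.1
    exact isAlgebraic_genericPoint_of_finite e hZ hI hfin q
  refine (Algebra.IsAlgebraic.trdeg_le_cardinalMk Qbar S).trans ?_
  refine Cardinal.mk_range_le.trans ?_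
  simp

theorem vanishing_lt_of_ssubset [W.IsElliptic] {Z Z' : Set (EPow W n)} (hZ : IsClosed Z)
    (hirr : IsIrreducible Z') (hU : (Z ∩ affinePart W n).Nonempty) (h : Z ⊂ Z') :
    vanishing (Z' ∩ affinePart W n) < vanishing (Z ∩ affinePart W n) := by
  refine lt_of_le_not_ge (fun f hf => mem_vanishing.mpr fun x hx =>
    mem_vanishing.mp hf x ⟨h.subset hx.1, hx.2⟩) fun hge => ?_
  have h1 : Z' ∩ affinePart W n ⊆ Z := by
    intro x hx
    obtain ⟨z, hz, -, hzc⟩ := exists_point_of_forall_vanishing hZ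
      (c := fun q => coords (x q.1) q.2) fun f hf => mem_vanishing.mp (hge hf) x hx
    rwa [← eq_of_coords_eq hzc]
  refine h.not_subset fun x hx => ?_
  by_contra hxZ
  obtain ⟨z, hz, hz1, hz2⟩ := hirr.isPreirreducible _ _ isOpen_affinePart hZ.isOpen_compl
    (by obtain ⟨z, hz⟩ := hU; exact ⟨z, h.subset hz.1, hz.2⟩) ⟨x, hx, hxZ⟩
  exact hz2 (h1 ⟨hz, hz1⟩)

/-- A closed irreducible set with finite fibres over `E^m` has dimension at most `m`. -/
theorem topologicalKrullDim_le_of_finite [W.IsElliptic] {m : ℕ} (e : Fin m → Fin n)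
    {Z : Set (EPow W n)} (hZ : IsClosed Z) (hirr : IsIrreducible Z)
    (hfin : ∀ y : EPow W m, {z ∈ Z | z ∘ e = y}.Finite) :
    topologicalKrullDim Z ≤ m := by
  refine iSup_le fun p => ?_
  -- A point of the smallest member lies on the whole chain; translating it into the affine part
  -- makes every member meet that part.
  obtain ⟨⟨z₀, hz₀Z⟩, hz₀⟩ := p.head.isIrreducible.nonempty
  obtain ⟨a₀, ha₀⟩ := (Set.finite_singleton (0 : W.toAffine.Point)).infinite_compl.nonempty
  let a : EPow W n := fun i => a₀ - z₀ i
  let T := translate a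
  have hTz₀ : T z₀ ∈ affinePart W n := fun i => by
    simp only [T, translate_apply, a, Pi.add_apply]
    simpa using ha₀
  have hI : (vanishing (T '' Z ∩ affinePart W n)).IsPrime :=
    isPrime_vanishing (hirr.image T T.continuous.continuousOn) ⟨T z₀, ⟨z₀, hz₀Z, rfl⟩, hTz₀⟩
  have hTZ : IsClosed (T '' Z) := T.isClosedMap _ hZ
  have hfinT : ∀ y : EPow W m, {z ∈ T '' Z | z ∘ e = y}.Finite := by
    intro y
    refine ((hfin (y - a ∘ e)).image T).subset ?_
    rintro _ ⟨⟨z, hz, rfl⟩, rfl⟩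
    refine ⟨z, ⟨hz, ?_⟩, rfl⟩
    funext i
    simp [T, translate_apply]
  have : IsDomain (BlockPoly n ⧸ vanishing (T '' Z ∩ affinePart W n)) :=
    (Ideal.Quotient.isDomain_iff_prime _).mpr hI
  have hdim := ringKrullDim_le_of_trdeg_le (trdeg_le_of_finite e hTZ hI hfinT)
  rw [ringKrullDim_quotient] at hdim
  let Y : Fin (p.length + 1) → Set (EPow W n) := fun i => T '' (Subtype.val '' (p i : Set Z))
  have hYc : ∀ i, IsClosed (Y i) := fun i =>
    T.isClosedMap _ (hZ.isClosedEmbedding_subtypeVal.isClosedMap _ (p i).isClosed)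
  have hYi : ∀ i, IsIrreducible (Y i) := fun i =>
    ((p i).isIrreducible.image _ continuous_subtype_val.continuousOn).image T
      T.continuous.continuousOn
  have hYU : ∀ i, (Y i ∩ affinePart W n).Nonempty := fun i =>
    ⟨T z₀, ⟨z₀, ⟨⟨z₀, hz₀Z⟩, p.head_le i hz₀, rfl⟩, rfl⟩, hTz₀⟩
  have hYlt : ∀ {i j}, i < j → Y i ⊂ Y j := fun {i j} hij =>
    T.injective.image_strictMono (Subtype.val_injective.image_strictMono
      (p.strictMono hij))
  have hYle : ∀ i, vanishing (T '' Z ∩ affinePart W n) ≤ vanishing (Y i ∩ affinePart W n) := by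
    intro i f hf
    refine mem_vanishing.mpr fun x hx => mem_vanishing.mp hf x ⟨?_, hx.2⟩
    exact Set.image_mono (by rintro _ ⟨z, -, rfl⟩; exact z.2) hx.1
  -- Vanishing ideals reverse inclusions, hence the reversed index.
  let φ : Fin (p.length + 1) → PrimeSpectrum.zeroLocus
      (vanishing (T '' Z ∩ affinePart W n) : Set (BlockPoly n)) := fun i =>
    ⟨⟨vanishing (Y i.rev ∩ affinePart W n), isPrime_vanishing (hYi _) (hYU _)⟩, hYle _⟩
  have hφ : StrictMono φ := fun i j hij =>
    vanishing_lt_of_ssubset (hYc _) (hYi _) (hYU _) (hYlt (Fin.rev_lt_rev.mpr hij))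
  refine le_trans ?_ hdim
  exact Order.LTSeries.length_le_krullDim (LTSeries.mk p.length φ hφ)

end EllipticPower

/-! ### Homomorphisms with closed graph are regular -/

namespace EllipticPower

open MvPolynomial

/-- In characteristic zero the minimal polynomial of x is separable of degree at least 2, so x has
another conjugate. -/
theorem exists_algHom_apply_ne {K L : Type*} [Field K] [Field L] [CharZero K] [Algebra K L]
    [Algebra.IsAlgebraic K L] {x : L} (hx : x ∉ Set.range (algebraMap K L)) :
    ∃ φ : L →ₐ[K] AlgebraicClosure L, φ x ≠ algebraMap L (AlgebraicClosure L) x := by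
  classical
  have h_int : IsIntegral K x := Algebra.IsIntegral.isIntegral x
  have hdeg : 1 < (minpoly K x).natDegree := by
    have h1 := minpoly.natDegree_pos h_int
    by_contra h2
    have h3 : (minpoly K x).natDegree = 1 := by omega
    obtain ⟨y, hy⟩ := minpoly.natDegree_eq_one_iff.mp h3
    exact hx ⟨y, hy⟩
  have hcard := Polynomial.card_rootSet_eq_natDegree (K := AlgebraicClosure L)
    (minpoly.irreducible h_int).separable (IsAlgClosed.splits _)
  rw [← hcard] at hdeg
  obtain ⟨⟨y, hy⟩, hne⟩ := Fintype.exists_ne_of_one_lt_card hdeg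
    ⟨algebraMap L (AlgebraicClosure L) x, by
      rw [Polynomial.mem_rootSet]
      refine ⟨minpoly.ne_zero h_int, ?_⟩
      rw [Polynomial.aeval_algebraMap_apply, minpoly.aeval, map_zero]⟩
  obtain ⟨φ, hφ⟩ := IntermediateField.exists_algHom_of_splits_of_aeval (F := K) (E := L)
    (K := AlgebraicClosure L) (x := x) (y := y)
    (fun s => ⟨Algebra.IsIntegral.isIntegral s, IsAlgClosed.splits _⟩)
    (Polynomial.mem_rootSet.mp hy).2
  exact ⟨φ, fun h => hne (Subtype.ext (hφ.symm.trans h))⟩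

/-- A generic coordinate determined by other ones is a rational function of them. -/
theorem mem_adjoin_of_unique_specialization {k σ τ L : Type*} [Field k] [IsAlgClosed k]
    [CharZero k] [Finite σ] [Field L] [Algebra k L] {I : Ideal (MvPolynomial σ k)} {θ : σ → L}
    (hθ : ∀ f : MvPolynomial σ k, aeval θ f = 0 ↔ f ∈ I) (ρ : τ → σ)
    (halg : Algebra.IsAlgebraic (IntermediateField.adjoin k (Set.range (θ ∘ ρ))) L) (s : σ)
    (huniq : ∀ c c' : σ → k, (∀ f ∈ I, eval c f = 0) → (∀ f ∈ I, eval c' f = 0) →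
      c ∘ ρ = c' ∘ ρ → c s = c' s) :
    θ s ∈ IntermediateField.adjoin k (Set.range (θ ∘ ρ)) := by
  by_contra hs
  have : CharZero (IntermediateField.adjoin k (Set.range (θ ∘ ρ))) :=
    charZero_of_injective_algebraMap
      (algebraMap k (IntermediateField.adjoin k (Set.range (θ ∘ ρ)))).injective
  obtain ⟨φ, hφ⟩ := exists_algHom_apply_ne
    (K := IntermediateField.adjoin k (Set.range (θ ∘ ρ))) (x := θ s) (by
      rintro ⟨y, hy⟩
      exact hs (hy ▸ y.2))
  -- A conjugate of the generic point agrees with it on the given coordinates but not at s.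
  -- Specializing the pair, with the difference at s kept nonzero, contradicts uniqueness.
  let ψ : L →ₐ[k] AlgebraicClosure L := φ.restrictScalars k
  let ι : L →ₐ[k] AlgebraicClosure L := IsScalarTower.toAlgHom k L (AlgebraicClosure L)
  let Φ : MvPolynomial (σ ⊕ σ) k →ₐ[k] AlgebraicClosure L :=
    aeval (Sum.elim (ι ∘ θ) (ψ ∘ θ))
  have hprime : (RingHom.ker Φ).IsPrime := RingHom.ker_isPrime Φ
  have hh : (X (Sum.inr s) - X (Sum.inl s) : MvPolynomial (σ ⊕ σ) k) ∉ RingHom.ker Φ := by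
    rw [RingHom.mem_ker, map_sub, sub_eq_zero]
    simp only [Φ, aeval_X, Sum.elim_inl, Sum.elim_inr, Function.comp_apply]
    exact hφ
  obtain ⟨c, h1, h2⟩ := exists_specialization hprime hh
  have hl : ∀ f ∈ I, eval (c ∘ Sum.inl) f = 0 := by
    intro f hf
    rw [← eval_rename]
    apply h1
    rw [RingHom.mem_ker]
    change aeval _ (rename _ f) = 0
    rw [aeval_rename, Sum.elim_comp_inl]
    have := (hθ f).mpr hf
    have h3 : aeval (ι ∘ θ) f = ι (aeval θ f) := by
      rw [← AlgHom.comp_apply, comp_aeval]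
      rfl
    rw [h3, this, map_zero]
  have hr : ∀ f ∈ I, eval (c ∘ Sum.inr) f = 0 := by
    intro f hf
    rw [← eval_rename]
    apply h1
    rw [RingHom.mem_ker]
    change aeval _ (rename _ f) = 0
    rw [aeval_rename, Sum.elim_comp_inr]
    have := (hθ f).mpr hf
    have h3 : aeval (ψ ∘ θ) f = ψ (aeval θ f) := by
      rw [← AlgHom.comp_apply, comp_aeval]
      rfl
    rw [h3, this, map_zero]
  have hρ : (c ∘ Sum.inl) ∘ ρ = (c ∘ Sum.inr) ∘ ρ := by
    funext t
    have h3 : (X (Sum.inr (ρ t)) - X (Sum.inl (ρ t)) : MvPolynomial (σ ⊕ σ) k) ∈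
        RingHom.ker Φ := by
      rw [RingHom.mem_ker, map_sub, sub_eq_zero]
      have hmem : θ (ρ t) ∈ IntermediateField.adjoin k (Set.range (θ ∘ ρ)) :=
        IntermediateField.subset_adjoin _ _ ⟨t, rfl⟩
      have := φ.commutes ⟨θ (ρ t), hmem⟩
      simp only [Φ, aeval_X, Sum.elim_inl, Sum.elim_inr, Function.comp_apply]
      exact this
    have := h1 _ h3
    rw [map_sub, eval_X, eval_X, sub_eq_zero] at this
    exact this.symm
  apply h2
  rw [map_sub, eval_X, eval_X, sub_eq_zero]
  exact (huniq _ _ hl hr hρ).symm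

variable {W : WeierstrassCurve Qbar}

theorem isAlgebraic_fractionRing_of_forall {k R : Type*} [Field k] [CommRing R] [IsDomain R]
    [Algebra k R] (S : Set R)
    (h : ∀ x : R, IsAlgebraic (Algebra.adjoin k S) x) :
    Algebra.IsAlgebraic (IntermediateField.adjoin k (algebraMap R (FractionRing R) '' S))
      (FractionRing R) := by
  let K := IntermediateField.adjoin k (algebraMap R (FractionRing R) '' S)
  have hR : ∀ x : R, IsAlgebraic K (algebraMap R (FractionRing R) x) := by
    intro x
    have hle : ∀ y ∈ Algebra.adjoin k S, algebraMap R (FractionRing R) y ∈ K := by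
      intro y hy
      induction hy using Algebra.adjoin_induction with
      | mem y hy => exact IntermediateField.subset_adjoin _ _ ⟨y, hy, rfl⟩
      | algebraMap r =>
        rw [← IsScalarTower.algebraMap_apply]
        exact K.algebraMap_mem r
      | add a b _ _ ha hb => rw [map_add]; exact K.add_mem ha hb
      | mul a b _ _ ha hb => rw [map_mul]; exact K.mul_mem ha hb
    let g : Algebra.adjoin k S →+* K :=
      ((algebraMap R (FractionRing R)).comp (Algebra.adjoin k S).val.toRingHom).codRestrict
        K.toSubalgebra.toSubring fun y => hle y y.2
    obtain ⟨p, hp, hpx⟩ := h x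
    have hg : Function.Injective g := by
      intro a b hab
      have := congrArg Subtype.val hab
      exact Subtype.ext (IsFractionRing.injective R (FractionRing R) this)
    refine ⟨p.map g, (Polynomial.map_ne_zero_iff hg).mpr hp, ?_⟩
    rw [Polynomial.aeval_def, Polynomial.eval₂_map]
    have : (algebraMap K (FractionRing R)).comp g =
        (algebraMap R (FractionRing R)).comp (algebraMap (Algebra.adjoin k S) R) := rfl
    rw [this, ← Polynomial.hom_eval₂]
    rw [Polynomial.aeval_def] at hpx
    rw [hpx, map_zero]
  refine ⟨fun x => ?_⟩
  obtain ⟨a, b, -, rfl⟩ := IsFractionRing.div_surjective (A := R) x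
  rw [div_eq_mul_inv]
  exact (hR a).mul (hR b).inv

end EllipticPower

/-! ### From a closed graph to local formulas -/

namespace EllipticPower

open MvPolynomial

variable {W : WeierstrassCurve Qbar}

theorem IsMultihomogeneous.isHomogeneous {F : BlockPoly 1} {m : Fin 1 → ℕ}
    (hF : IsMultihomogeneous F m) : F.IsHomogeneous (m 0) := by
  intro d hd
  have h := congrFun (hF hd) 0
  rw [weight_block_apply] at h
  rw [← h, Finsupp.weight_apply, Finsupp.sum_fintype _ _ (by simp), Fintype.sum_prod_type]
  simp

theorem isRegularMap_of_hasLocalRep {f : W.toAffine.Point → W.toAffine.Point}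
    (h : ∀ x : EPow W 1, HasLocalRep (fun y => f (y 0)) x) : IsRegularMap f := by
  intro P
  obtain ⟨F, m, c, h1, h2, h3⟩ := h fun _ => P
  have heval : ∀ (Q : W.toAffine.Point) i,
      eval (coords Q) (rename Prod.snd (F i)) = c (fun _ => Q) * coords (f Q) i := by
    intro Q i
    rw [eval_rename]
    exact h3 (fun _ => Q) i
  refine ⟨fun i => rename Prod.snd (F i), m 0, fun i => (h1 i).isHomogeneous.rename_isHomogeneous,
    ?_, fun Q hQ => ⟨c fun _ => Q, ?_, heval Q⟩⟩
  · obtain ⟨i, hi⟩ := exists_coords_ne_zero (f P)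
    exact ⟨i, by rw [heval]; exact mul_ne_zero h2 hi⟩
  · obtain ⟨i, hi⟩ := hQ
    rw [heval] at hi
    exact left_ne_zero_of_mul hi

/-- Additivity transports a formula by translation: f(y) = f(y + (x₀ - x)) - f(x₀ - x). -/
theorem hasLocalRep_of_exists [W.IsElliptic] (f : W.toAffine.Point →+ W.toAffine.Point)
    {x₀ : EPow W 1} (h : HasLocalRep (fun y => f (y 0)) x₀) (x : EPow W 1) :
    HasLocalRep (fun y => f (y 0)) x := by
  have h1 : HasLocalRep (fun y : EPow W 1 => f ((y + (x₀ - x)) 0)) x := by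
    refine HasLocalRep.comp (φ := fun y => f (y 0)) (ψ := fun y : EPow W 1 => y + (x₀ - x)) ?_
      (fun k => isMorphism_add_const (x₀ - x) x k)
    rwa [add_sub_cancel]
  have h2 := h1.add (hasLocalRep_const (-f ((x₀ - x) 0)) x)
  convert h2 using 2
  rw [Pi.add_apply, map_add, add_neg_cancel_right]

/-- The graph of `f`. -/
def graph (f : W.toAffine.Point →+ W.toAffine.Point) : Set (EPow W 2) := {z | z 1 = f (z 0)}

theorem finite_kernel_of_isClosed_graph [W.IsElliptic] {f : W.toAffine.Point →+ W.toAffine.Point}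
    (hf : IsClosed (graph f)) (h0 : f ≠ 0) : {P | f P = 0}.Finite := by
  have hmor : IsMorphism (fun t : EPow W 1 => (![t 0, 0] : EPow W 2)) := fun x =>
    Fin.forall_fin_two.mpr ⟨hasLocalRep_apply 0 x, hasLocalRep_const 0 x⟩
  have hc := hf.preimage hmor.continuous
  rcases finite_or_eq_univ_of_isClosed (A := {P | f P = 0}) (by
    convert hc using 1
    ext t
    simp [graph, eq_comm]) with h | h
  · exact h
  · refine absurd (AddMonoidHom.ext fun P => ?_) h0
    exact (h ▸ Set.mem_univ P : P ∈ {P | f P = 0})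

/-- An irreducible component of the graph dominating `E`: it contains almost all points. -/
theorem exists_component_graph [W.IsElliptic] {f : W.toAffine.Point →+ W.toAffine.Point}
    (hf : IsClosed (graph f)) (h0 : f ≠ 0) :
    ∃ Z ⊆ graph f, IsClosed Z ∧ IsIrreducible Z ∧
      {t : EPow W 1 | (![t 0, f (t 0)] : EPow W 2) ∉ Z ∩ affinePart W 2}.Finite := by
  let e : Fin 1 → Fin 2 := fun _ => 0
  have hdense : Dense ((· ∘ e) '' graph f : Set (EPow W 1)) := by
    have : ((· ∘ e) '' graph f : Set (EPow W 1)) = Set.univ := by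
      refine Set.eq_univ_of_forall fun t => ⟨![t 0, f (t 0)], rfl, ?_⟩
      funext i
      fin_cases i
      rfl
    rw [this]
    exact dense_univ
  obtain ⟨Z, hsub, hZ, hirr, hd⟩ := exists_irreducible_subset_dense e hf hdense
  refine ⟨Z, hsub, hZ, hirr, ?_⟩
  obtain ⟨V, hV, hne, hVsub⟩ := exists_isOpen_subset_image e hZ hirr hd
  have hfin : Vᶜ.Finite := finite_of_isClosed_ne_univ hV.isClosed_compl fun h => by
    obtain ⟨v, hv⟩ := hne
    exact (h ▸ Set.mem_univ v : v ∈ Vᶜ) hv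
  refine ((hfin.union (((Set.finite_singleton 0).union
    (finite_kernel_of_isClosed_graph hf h0)).image fun P _ => P))).subset fun t ht => ?_
  by_contra hcon
  simp only [Set.mem_union, Set.mem_compl_iff, not_or, not_not] at hcon
  obtain ⟨ht1, ht2⟩ := hcon
  have ht' : t = fun _ => t 0 := by
    funext i; fin_cases i; rfl
  apply ht
  obtain ⟨z, hz, hzt⟩ := hVsub ht1
  have hz0 : z 0 = t 0 := congrFun hzt 0
  have hz1 : z 1 = f (z 0) := hsub hz
  have hzz : z = ![t 0, f (t 0)] := by
    funext i
    fin_cases i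
    · exact hz0
    · exact hz1.trans (by rw [hz0]; rfl)
  refine ⟨hzz ▸ hz, Fin.forall_fin_two.mpr ⟨fun h => ht2 ?_, fun h => ht2 ?_⟩⟩
  · exact ⟨t 0, Or.inl h, ht'.symm⟩
  · exact ⟨t 0, Or.inr h, ht'.symm⟩

/-- The coordinates of `f` are rational functions. -/
theorem exists_rational_formula [W.IsElliptic] {f : W.toAffine.Point →+ W.toAffine.Point}
    {Z : Set (EPow W 2)} (hsub : Z ⊆ graph f) (hZ : IsClosed Z) (hirr : IsIrreducible Z)
    (hU : (Z ∩ affinePart W 2).Nonempty) (j : Fin 3) :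
    ∃ a b : BlockPoly 1, (∃ z ∈ Z ∩ affinePart W 2, evalAt b (fun _ => z 0) ≠ 0) ∧
      ∀ z ∈ Z ∩ affinePart W 2,
        evalAt b (fun _ => z 0) * coords (f (z 0)) j = evalAt a (fun _ => z 0) := by
  let e : Fin 1 → Fin 2 := fun _ => 0
  have hI := isPrime_vanishing hirr hU
  have hdom : IsDomain (BlockPoly 2 ⧸ vanishing (Z ∩ affinePart W 2)) :=
    (Ideal.Quotient.isDomain_iff_prime _).mpr hI
  have hpt : ∀ z ∈ Z, ∀ z' ∈ Z, z 0 = z' 0 → z = z' := by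
    intro z hz z' hz' h
    have h1 : z 1 = f (z 0) := hsub hz
    have h2 : z' 1 = f (z' 0) := hsub hz'
    funext i
    fin_cases i
    · exact h
    · exact h1.trans ((congrArg f h).trans h2.symm)
  have hfin : ∀ y : EPow W 1, {z ∈ Z | z ∘ e = y}.Finite := by
    intro y
    refine Set.Subsingleton.finite ?_
    rintro z ⟨hz, hzy⟩ z' ⟨hz', hzy'⟩
    exact hpt z hz z' hz' (congrFun (hzy.trans hzy'.symm) 0)
  let R := BlockPoly 2 ⧸ vanishing (Z ∩ affinePart W 2)
  let L := FractionRing R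
  let θ : Fin 2 × Fin 3 → L := fun q => algebraMap R L (genericPoint Z q)
  have hev : ∀ g : BlockPoly 2, aeval θ g = algebraMap R L (aeval (genericPoint Z) g) := by
    intro g
    have : aeval θ = (IsScalarTower.toAlgHom Qbar R L).comp (aeval (genericPoint Z)) := by
      ext q
      simp [θ]
    rw [this]
    rfl
  have hθ : ∀ g : BlockPoly 2, aeval θ g = 0 ↔ g ∈ vanishing (Z ∩ affinePart W 2) := by
    intro g
    rw [hev, ← aeval_genericPoint_eq_zero]
    exact map_eq_zero_iff _ (IsFractionRing.injective R L)
  have halg : Algebra.IsAlgebraic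
      (IntermediateField.adjoin Qbar (Set.range (θ ∘ Prod.map e (id : Fin 3 → Fin 3)))) L := by
    have h1 : Set.range (θ ∘ Prod.map e (id : Fin 3 → Fin 3)) =
        algebraMap R L '' Set.range (genericPoint Z ∘ Prod.map e (id : Fin 3 → Fin 3)) := by
      rw [← Set.range_comp]
      rfl
    rw [h1]
    refine isAlgebraic_fractionRing_of_forall _ fun x => ?_
    refine IsAlgebraic.adjoin_of_forall_isAlgebraic (s := Set.range (genericPoint Z))
      (fun y hy => ?_) ?_
    · obtain ⟨q, rfl⟩ := hy.1
      exact isAlgebraic_genericPoint_of_finite e hZ hI hfin q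
    · obtain ⟨g, rfl⟩ := Ideal.Quotient.mk_surjective x
      rw [← aeval_genericPoint]
      have : aeval (genericPoint Z) g ∈ Algebra.adjoin Qbar (Set.range (genericPoint Z)) := by
        rw [Algebra.adjoin_range_eq_range_aeval]
        exact ⟨g, rfl⟩
      exact isAlgebraic_algebraMap (⟨_, this⟩ : Algebra.adjoin Qbar (Set.range (genericPoint Z)))
  have hmem := mem_adjoin_of_unique_specialization hθ (Prod.map e id) halg (1, j) (by
    intro c c' hc hc' hcc
    obtain ⟨z, hz, -, hzc⟩ := exists_point_of_forall_vanishing hZ hc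
    obtain ⟨z', hz', -, hzc'⟩ := exists_point_of_forall_vanishing hZ hc'
    have h0 : z 0 = z' 0 := coords_injective (funext fun i => by
      have := congrFun hcc (0, i)
      exact (hzc (0, i)).trans (this.trans (hzc' (0, i)).symm))
    rw [← hzc, ← hzc', hpt z hz z' hz' h0])
  rw [IntermediateField.mem_adjoin_range_iff] at hmem
  obtain ⟨a, b, hab⟩ := hmem
  have hren : ∀ (g : BlockPoly 1) (z : EPow W 2),
      evalAt (rename (Prod.map e id) g) z = evalAt g (fun _ => z 0) := fun g z =>
    evalAt_rename e g z
  -- If the denominator vanishes, the quotient is 0 by convention, so the generic coordinate itself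
  -- is 0 and 0/1 represents it.
  by_cases hb : aeval (θ ∘ Prod.map e id) b = 0
  · rw [hb, div_zero] at hab
    refine ⟨0, 1, ?_, fun z hz => ?_⟩
    · obtain ⟨z, hz⟩ := hU
      exact ⟨z, hz, by simp [evalAt]⟩
    · have h1 : (X (1, j) : BlockPoly 2) ∈ vanishing (Z ∩ affinePart W 2) := by
        rw [← hθ, aeval_X, hab]
      have h2 := mem_vanishing.mp h1 z hz
      have h3 : z 1 = f (z 0) := hsub hz.1
      simp only [evalAt, eval_X, h3] at h2
      simp [evalAt, h2]
  · refine ⟨a, b, ?_, fun z hz => ?_⟩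
    · rw [← aeval_rename, hθ, mem_vanishing] at hb
      push Not at hb
      obtain ⟨z, hz, hbz⟩ := hb
      exact ⟨z, hz, by rwa [hren] at hbz⟩
    · have h1 : (rename (Prod.map e id) b * X (1, j) - rename (Prod.map e id) a : BlockPoly 2) ∈
          vanishing (Z ∩ affinePart W 2) := by
        rw [← hθ, map_sub, map_mul, aeval_X, aeval_rename, aeval_rename, hab,
          mul_div_cancel₀ _ hb, sub_self]
      have h2 := mem_vanishing.mp h1 z hz
      have h3 : z 1 = f (z 0) := hsub hz.1
      have h4 : evalAt (rename (Prod.map e id) b * X (1, j) - rename (Prod.map e id) a) z =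
          evalAt (rename (Prod.map e id) b) z * coords (z 1) j -
            evalAt (rename (Prod.map e id) a) z := by
        simp [evalAt]
      rw [h4, hren, hren, h3, sub_eq_zero] at h2
      exact h2

/-- On a component of the graph dominating E the coordinates of f are rational functions of the
first point, since they are determined by it. This gives a local formula at one point, and
translations give it everywhere. -/
theorem isRegularMap_of_isClosed_graph [W.IsElliptic] {f : W.toAffine.Point →+ W.toAffine.Point}
    (hf : IsClosed (graph f)) : IsRegularMap f := by
  by_cases h0 : f = 0
  · subst h0
    exact isRegularMap_of_hasLocalRep fun x => hasLocalRep_const 0 x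
  obtain ⟨Z, hsub, hZ, hirr, hfin⟩ := exists_component_graph hf h0
  let D : Set (EPow W 1) := {t | (![t 0, f (t 0)] : EPow W 2) ∉ Z ∩ affinePart W 2}
  have hD : IsClosed D := hfin.isClosed
  have hU : (Z ∩ affinePart W 2).Nonempty := by
    obtain ⟨t, ht⟩ := hfin.infinite_compl.nonempty
    exact ⟨_, not_not.mp ht⟩
  choose a b hb hab using exists_rational_formula hsub hZ hirr hU
  -- A common denominator of the three coordinates, with numerators A_j.
  let B : BlockPoly 1 := ∏ j, b j
  let A : Fin 3 → BlockPoly 1 := fun j => a j * ∏ i ∈ Finset.univ.erase j, b i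
  have hev : ∀ z ∈ Z ∩ affinePart W 2, ∀ j,
      evalAt B (fun _ => z 0) * coords (f (z 0)) j = evalAt (A j) (fun _ => z 0) := by
    intro z hz j
    have h1 : B = b j * ∏ i ∈ Finset.univ.erase j, b i :=
      (Finset.mul_prod_erase _ _ (Finset.mem_univ j)).symm
    rw [h1, evalAt_mul, evalAt_mul, ← hab j z hz]
    ring
  have hB : ∃ z ∈ Z ∩ affinePart W 2, evalAt B (fun _ => z 0) ≠ 0 := by
    have hI := isPrime_vanishing hirr hU
    let e : Fin 1 → Fin 2 := fun _ => 0
    have h1 : rename (Prod.map e id) B ∉ vanishing (Z ∩ affinePart W 2) := by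
      rw [map_prod]
      intro h
      obtain ⟨j, -, hj⟩ := (Ideal.IsPrime.prod_mem_iff).mp h
      obtain ⟨z, hz, hbz⟩ := hb j
      have := mem_vanishing.mp hj z hz
      rw [evalAt_rename] at this
      exact hbz this
    rw [mem_vanishing] at h1
    push Not at h1
    obtain ⟨z, hz, hBz⟩ := h1
    rw [evalAt_rename] at hBz
    exact ⟨z, hz, hBz⟩
  obtain ⟨z₀, hz₀, hBz₀⟩ := hB
  have hgraph : ∀ z ∈ Z, z = ![z 0, f (z 0)] := by
    intro z hz
    funext i
    fin_cases i
    · rfl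
    · exact hsub hz
  have ht₀ : (fun _ => z₀ 0 : EPow W 1) ∉ D := by
    intro h
    apply h
    change (![z₀ 0, f (z₀ 0)] : EPow W 2) ∈ _
    rw [← hgraph z₀ hz₀.1]
    exact hz₀
  -- The rational formulas may fail on the finite set D. Multiplying by G, which vanishes on D but
  -- not at the base point, makes the identity hold at every point.
  obtain ⟨G, m, hG, hG0, hGD⟩ := exists_evalAt_of_notMem hD ht₀
  let M := (Finset.univ.sup fun j => (A j).totalDegree) + 1
  have hM : ∀ j, (A j).totalDegree < M := fun j =>
    Nat.lt_succ_of_le (Finset.le_sup (f := fun j => (A j).totalDegree) (Finset.mem_univ j))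
  choose F hF1 hF2 hF3 using fun j => exists_homogenization (W := W) (A j) (hM j)
  refine isRegularMap_of_hasLocalRep (hasLocalRep_of_exists f (x₀ := fun _ => z₀ 0) ?_)
  refine ⟨fun j => F j * G, _, fun y => evalAt B y * evalAt G y, fun j => (hF1 j).mul hG,
    mul_ne_zero hBz₀ hG0, fun y j => ?_⟩
  rw [evalAt_mul]
  by_cases hy : y ∈ D
  · simp only [hGD y hy, mul_zero, zero_mul]
  · have hy' : (![y 0, f (y 0)] : EPow W 2) ∈ Z ∩ affinePart W 2 := not_not.mp hy
    have hyy : y = fun _ => y 0 := by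
      funext i; fin_cases i; rfl
    have h1 := hev _ hy' j
    simp only [Matrix.cons_val_zero] at h1
    rw [← hyy] at h1
    rw [hF2 j y (fun i => ?_), ← h1]
    · ring
    · fin_cases i
      exact hy'.2 0

end EllipticPower

/-! ### Abelian subvarieties and integral relations -/

namespace EllipticPower

variable {W : WeierstrassCurve Qbar} {n : ℕ}

theorem finite_zsmul_eq [W.IsElliptic] {a : ℤ} (ha : a ≠ 0) (Q : W.toAffine.Point) :
    {P : W.toAffine.Point | a • P = Q}.Finite := by
  obtain ⟨P₀, h₀⟩ := exists_zsmul_eq ha Q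
  refine ((finite_torsion ha).image (fun T => T + P₀)).subset fun P hP => ?_
  refine ⟨P - P₀, ?_, sub_add_cancel _ _⟩
  have hP' : a • P = Q := hP
  change a • (P - P₀) = 0
  rw [zsmul_sub, hP', h₀, sub_self]

/-- The linear map `E^m → E^n` of an integral matrix. -/
noncomputable def linearMap {m : ℕ} (c : Fin n → Fin m → ℤ) : EPow W m →+ EPow W n where
  toFun t j := ∑ i, c j i • t i
  map_zero' := by
    funext j
    exact Finset.sum_eq_zero fun i _ => zsmul_zero _
  map_add' x y := by
    funext j
    simp only [Pi.add_apply, zsmul_add, Finset.sum_add_distrib]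

theorem linearMap_apply {m : ℕ} (c : Fin n → Fin m → ℤ) (t : EPow W m) (j : Fin n) :
    linearMap c t j = ∑ i, c j i • t i := rfl

/-- Integral relations of rank `n - m` define an abelian subvariety of dimension at most `m`, up to
torsion. -/
theorem exists_abelianSubvariety_of_relations [W.IsElliptic] {m : ℕ} (e : Fin m → Fin n)
    (c : Fin n → Fin m → ℤ) {a : ℤ} (ha : a ≠ 0) (hc : ∀ i, c (e i) = Pi.single i a) :
    ∃ B : AddSubgroup (EPow W n), IsAbelianSubvariety B ∧
      topologicalKrullDim (B : Set (EPow W n)) ≤ m ∧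
      ∀ z : EPow W n, (∀ j, a • z j = ∑ i, c j i • z (e i)) →
        ∃ β ∈ B, ∀ j, a • (z j - β j) = 0 := by
  let ψ : EPow W m →+ EPow W n := linearMap c
  have hψe : ∀ t i, ψ t (e i) = a • t i := by
    intro t i
    simp only [ψ, linearMap_apply, hc]
    rw [Finset.sum_eq_single i]
    · rw [Pi.single_eq_same]
    · intro k _ hk
      rw [Pi.single_eq_of_ne hk, zero_zsmul]
    · simp
  have hψ : ∀ t j, a • ψ t j = ∑ i, c j i • ψ t (e i) := by
    intro t j
    simp only [hψe]
    simp only [ψ, linearMap_apply, Finset.smul_sum]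
    exact Finset.sum_congr rfl fun i _ => smul_comm _ _ _
  -- The closure of the image of E^m. The relations are closed conditions, so they hold on B; they
  -- determine a z_j from the coordinates in e, whence finite fibres and dimension at most m.
  let B := closureSubgroup ψ.range
  have hBc : IsClosed (B : Set (EPow W n)) := isClosed_closure
  have hBi : IsIrreducible (B : Set (EPow W n)) := by
    have h1 := (IrreducibleSpace.isIrreducible_univ (EPow W m)).image ψ
      (isMorphism_linear c).continuous.continuousOn
    rw [Set.image_univ] at h1
    exact h1.closure
  have hBrel : ∀ z ∈ B, ∀ j, a • z j = ∑ i, c j i • z (e i) := by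
    intro z hz j
    have hcl : IsClosed {z : EPow W n | a • z j = ∑ i, c j i • z (e i)} :=
      isClosed_eq_of_hasLocalRep (fun x => (hasLocalRep_apply j x).zsmul a) fun x =>
        HasLocalRep.sum (φ := fun i (z : EPow W n) => c j i • z (e i)) Finset.univ
          fun i => (hasLocalRep_apply (e i) x).zsmul (c j i)
    refine closure_minimal ?_ hcl hz
    rintro _ ⟨t, rfl⟩
    exact hψ t j
  refine ⟨B, ⟨hBc, hBi⟩, topologicalKrullDim_le_of_finite e hBc hBi fun y => ?_, fun z hz => ?_⟩
  · refine (Set.Finite.pi' fun j => finite_zsmul_eq ha (∑ i, c j i • y i)).subset ?_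
    rintro z ⟨hz, rfl⟩ j
    exact hBrel z hz j
  -- Dividing the e-coordinates of z by a gives t whose image agrees with z on e; both satisfy the
  -- relations, so all coordinates agree after multiplication by a.
  · choose t ht using fun i => exists_zsmul_eq ha (z (e i))
    refine ⟨ψ t, subset_closure ⟨t, rfl⟩, fun j => ?_⟩
    rw [zsmul_sub, hψ, hz, sub_eq_zero]
    exact Finset.sum_congr rfl fun i _ => by rw [hψe, ht]

theorem injective_of_projSubgroup_eq_top [W.IsElliptic] {B : AddSubgroup (EPow W n)} {m : ℕ}
    {e : Fin m → Fin n} (h : projSubgroup e B = ⊤) : Function.Injective e := by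
  intro i i' hii
  by_contra hne
  obtain ⟨t, ht⟩ := (Set.finite_singleton (0 : W.toAffine.Point)).infinite_compl.nonempty
  have hmem : (Pi.single i t : EPow W m) ∈ projSubgroup e B := h ▸ AddSubgroup.mem_top _
  obtain ⟨b, -, hb⟩ := hmem
  have h1 : b (e i) = t := (congrFun hb i).trans
    (Pi.single_eq_same (M := fun _ : Fin m => W.toAffine.Point) i t)
  have h2 : b (e i') = 0 := (congrFun hb i').trans
    (Pi.single_eq_of_ne (M := fun _ : Fin m => W.toAffine.Point) (Ne.symm hne) t)
  exact ht (by rw [← h1, hii, h2]; rfl)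

theorem projSubgroup_snoc_eq_top {B : AddSubgroup (EPow W n)} {m : ℕ} {e : Fin m → Fin n}
    (htop : projSubgroup e B = ⊤) {j : Fin n}
    (h : ∀ t : W.toAffine.Point, (Fin.snoc 0 t : EPow W (m + 1)) ∈
      projSubgroup (Fin.snoc e j : Fin (m + 1) → Fin n) B) :
    projSubgroup (Fin.snoc e j : Fin (m + 1) → Fin n) B = ⊤ := by
  rw [eq_top_iff]
  intro w _
  have hmem : (Fin.init w : EPow W m) ∈ projSubgroup e B := htop ▸ AddSubgroup.mem_top _
  obtain ⟨b, hb, hbe⟩ := hmem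
  have h1 := h (w (Fin.last m) - b j)
  have h2 : (b ∘ (Fin.snoc e j : Fin (m + 1) → Fin n) : EPow W (m + 1)) ∈
      projSubgroup (Fin.snoc e j : Fin (m + 1) → Fin n) B := ⟨b, hb, rfl⟩
  have h3 := AddSubgroup.add_mem _ h2 h1
  convert h3 using 1
  funext i
  refine Fin.lastCases ?_ (fun i => ?_) i
  · simp
  · have := congrFun hbe i
    simp only [Pi.add_apply, Function.comp_apply, Fin.snoc_castSucc, Pi.zero_apply, add_zero]
    exact this.symm

/-- The graph of `b ↦ N b_j` over a subgroup. -/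
noncomputable def graphSubgroup (B : AddSubgroup (EPow W n)) (N : ℤ) (j : Fin n) :
    AddSubgroup (EPow W (n + 1)) :=
  B.map (⟨⟨fun b => Fin.snoc b (N • b j), by
    funext i
    refine Fin.lastCases ?_ (fun i => ?_) i <;> simp [zsmul_zero]⟩, fun x y => by
    funext i
    refine Fin.lastCases ?_ (fun i => ?_) i
    · simp [zsmul_add]
    · simp⟩ : EPow W n →+ EPow W (n + 1))

theorem isAbelianSubvariety_graphSubgroup [W.IsElliptic] {B : AddSubgroup (EPow W n)}
    (hB : IsAbelianSubvariety B) (N : ℤ) (j : Fin n) :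
    IsAbelianSubvariety (graphSubgroup B N j) := by
  constructor
  · have h1 : IsClosed ((fun w : EPow W (n + 1) => (w ∘ Fin.castSucc : EPow W n)) ⁻¹' B) :=
      hB.1.preimage (isMorphism_precomp Fin.castSucc).continuous
    have h2 := h1.inter (isClosed_zsmul_eq (W := W) N j.castSucc (Fin.last n))
    change IsClosed (graphSubgroup B N j : Set (EPow W (n + 1)))
    convert h2 using 1
    ext w
    constructor
    · rintro ⟨b, hb, rfl⟩
      refine ⟨?_, ?_⟩
      · change ((Fin.snoc b (N • b j) : EPow W (n + 1)) ∘ Fin.castSucc) ∈ B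
        have : ((Fin.snoc b (N • b j) : EPow W (n + 1)) ∘ Fin.castSucc : EPow W n) = b := by
          funext i
          simp
        rw [this]
        exact hb
      · change N • (Fin.snoc b (N • b j) : EPow W (n + 1)) j.castSucc =
          (Fin.snoc b (N • b j) : EPow W (n + 1)) (Fin.last n)
        simp
    · rintro ⟨h, h'⟩
      refine ⟨w ∘ Fin.castSucc, h, ?_⟩
      funext i
      refine Fin.lastCases ?_ (fun i => ?_) i
      · change (Fin.snoc (w ∘ Fin.castSucc) (N • w j.castSucc) : EPow W (n + 1)) (Fin.last n) = _
        rw [Fin.snoc_last]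
        exact h'
      · change (Fin.snoc (w ∘ Fin.castSucc) (N • w j.castSucc) : EPow W (n + 1)) i.castSucc = _
        simp
  · exact hB.2.image _ (isMorphism_snoc isMorphism_id fun x =>
      (hasLocalRep_apply j x).zsmul N).continuous.continuousOn

/-- The homomorphism `y ↦ N b_j`, for `b ∈ B` above `y`. -/
theorem exists_hom_of_projSubgroup [W.IsElliptic] {B : AddSubgroup (EPow W n)} {m : ℕ}
    {e : Fin m → Fin n} (htop : projSubgroup e B = ⊤) {j : Fin n} {N : ℤ}
    (hN : ∀ b ∈ B, b ∘ e = 0 → N • b j = 0) :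
    ∃ φ : EPow W m →+ W.toAffine.Point, ∀ b ∈ B, φ (b ∘ e) = N • b j := by
  have hsurj : ∀ y : EPow W m, ∃ b ∈ B, b ∘ e = y := fun y =>
    (htop ▸ AddSubgroup.mem_top y : y ∈ projSubgroup e B)
  choose s hs hse using hsurj
  have hwell : ∀ b ∈ B, ∀ b' ∈ B, b ∘ e = b' ∘ e → N • b j = N • b' j := by
    intro b hb b' hb' h
    have := hN (b - b') (B.sub_mem hb hb') (by
      funext i
      have := congrFun h i
      simpa [sub_eq_zero] using this)
    rw [Pi.sub_apply, zsmul_sub, sub_eq_zero] at this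
    exact this
  refine ⟨AddMonoidHom.mk' (fun y => N • s y j) fun y y' => ?_, fun b hb => ?_⟩
  · rw [← zsmul_add]
    refine hwell _ (hs _) (s y + s y') (B.add_mem (hs y) (hs y')) ?_
    rw [hse]
    funext i
    simp only [Function.comp_apply, Pi.add_apply]
    rw [← congrFun (hse y) i, ← congrFun (hse y') i]
    rfl
  · exact hwell _ (hs _) b hb (hse _)

/-- The graph of φ is a projection of the abelian subvariety {(b, N b_j)}, hence closed. Its
restrictions to the coordinate axes are homomorphisms E → E with closed graph, hence regular, hence
integers since End(E) = ℤ. -/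
theorem exists_relation_of_hom [W.IsElliptic] (hCM : NoCM W) {B : AddSubgroup (EPow W n)}
    (hB : IsAbelianSubvariety B) {m : ℕ}
    {e : Fin m → Fin n} (htop : projSubgroup e B = ⊤) {j : Fin n} {N : ℤ}
    {φ : EPow W m →+ W.toAffine.Point} (hφ : ∀ b ∈ B, φ (b ∘ e) = N • b j) :
    ∃ c : Fin m → ℤ, ∀ y, φ y = ∑ i, c i • y i := by
  have hclosed : IsClosed {w : EPow W (m + 1) | w (Fin.last m) = φ (Fin.init w)} := by
    have h1 := isClosed_projSubgroup (Fin.snoc (Fin.castSucc ∘ e) (Fin.last n) : Fin (m + 1) → _)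
      (isAbelianSubvariety_graphSubgroup hB N j)
    convert h1 using 1
    ext w
    constructor
    · intro hw
      have hw : w (Fin.last m) = φ (Fin.init w) := hw
      obtain ⟨b, hb, hbe⟩ : ∃ b ∈ B, b ∘ e = Fin.init w :=
        (htop ▸ AddSubgroup.mem_top _ : (Fin.init w : EPow W m) ∈ projSubgroup e B)
      refine ⟨_, ⟨b, hb, rfl⟩, ?_⟩
      funext i
      refine Fin.lastCases ?_ (fun i => ?_) i
      · rw [hw, ← hbe, hφ b hb]
        change (Fin.snoc b (N • b j) : EPow W (n + 1))
          ((Fin.snoc (Fin.castSucc ∘ e) (Fin.last n) : Fin (m + 1) → _) (Fin.last m)) = _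
        simp
      · change (Fin.snoc b (N • b j) : EPow W (n + 1))
          ((Fin.snoc (Fin.castSucc ∘ e) (Fin.last n) : Fin (m + 1) → _) i.castSucc) = _
        simp only [Fin.snoc_castSucc, Function.comp_apply]
        exact congrFun hbe i
    · rintro ⟨_, ⟨b, hb, rfl⟩, rfl⟩
      change (Fin.snoc b (N • b j) : EPow W (n + 1))
          ((Fin.snoc (Fin.castSucc ∘ e) (Fin.last n) : Fin (m + 1) → _) (Fin.last m)) =
        φ fun i => (Fin.snoc b (N • b j) : EPow W (n + 1))
          ((Fin.snoc (Fin.castSucc ∘ e) (Fin.last n) : Fin (m + 1) → _) i.castSucc)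
      simp only [Fin.snoc_castSucc, Function.comp_apply, Fin.snoc_last]
      exact (hφ b hb).symm
  have hc : ∀ i : Fin m, ∃ c : ℤ, ∀ P, φ (Pi.single i P) = c • P := by
    intro i
    let f : W.toAffine.Point →+ W.toAffine.Point :=
      φ.comp (AddMonoidHom.single (fun _ : Fin m => W.toAffine.Point) i)
    refine hCM f (isRegularMap_of_isClosed_graph ?_)
    have hmor : IsMorphism (fun z : EPow W 2 =>
        (Fin.snoc (Pi.single i (z 0) : EPow W m) (z 1) : EPow W (m + 1))) := by
      refine isMorphism_snoc (fun x k => ?_) (hasLocalRep_apply 1)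
      by_cases hk : k = i
      · subst hk
        simpa using hasLocalRep_apply 0 x
      · simpa [Pi.single_eq_of_ne hk] using hasLocalRep_const 0 x
    convert hclosed.preimage hmor.continuous using 1
    ext z
    simp [graph, f]
  choose c hc using hc
  refine ⟨c, fun y => ?_⟩
  conv_lhs => rw [← Finset.univ_sum_single y]
  rw [map_sum]
  exact Finset.sum_congr rfl fun i _ => hc i (y i)

/-- The values of the coordinate j on the part of B with zero e-coordinates form a closed subgroup
of E. It is proper, since otherwise j would be a further free coordinate, so it is finite; its order
N makes N b_j a function of the e-coordinates. -/
theorem exists_relation [W.IsElliptic] (hCM : NoCM W) {B : AddSubgroup (EPow W n)}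
    (hB : IsAbelianSubvariety B) {m : ℕ}
    {e : Fin m → Fin n} (htop : projSubgroup e B = ⊤) (j : Fin n)
    (hj : projSubgroup (Fin.snoc e j : Fin (m + 1) → Fin n) B ≠ ⊤) :
    ∃ (N : ℤ) (c : Fin m → ℤ), N ≠ 0 ∧ ∀ b ∈ B, N • b j = ∑ i, c i • b (e i) := by
  let D := projSubgroup (Fin.snoc e j : Fin (m + 1) → Fin n) B
  let ι : W.toAffine.Point →+ EPow W (m + 1) :=
    ⟨⟨fun t => Fin.snoc 0 t, by
      funext i
      refine Fin.lastCases ?_ (fun i => ?_) i <;> simp⟩, fun x y => by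
      funext i
      refine Fin.lastCases ?_ (fun i => ?_) i <;> simp⟩
  let F : AddSubgroup W.toAffine.Point := D.comap ι
  have hfin : (F : Set W.toAffine.Point).Finite := by
    rcases finite_or_eq_univ_of_isClosed (A := (F : Set W.toAffine.Point))
      ((isClosed_projSubgroup _ hB).preimage (continuous_const_snoc 0)) with h | h
    · exact h
    · refine absurd (projSubgroup_snoc_eq_top htop fun t => ?_) hj
      exact (h ▸ Set.mem_univ t : t ∈ (F : Set W.toAffine.Point))
  have : Finite F := hfin
  have hN : ∀ b ∈ B, b ∘ e = 0 → ((Nat.card F : ℕ) : ℤ) • b j = 0 := by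
    intro b hb hbe
    have hmem : b j ∈ F := by
      change (Fin.snoc 0 (b j) : EPow W (m + 1)) ∈ D
      refine ⟨b, hb, ?_⟩
      funext i
      refine Fin.lastCases ?_ (fun i => ?_) i
      · change b ((Fin.snoc e j : Fin (m + 1) → Fin n) (Fin.last m)) = _
        simp
      · change b ((Fin.snoc e j : Fin (m + 1) → Fin n) i.castSucc) = _
        simp only [Fin.snoc_castSucc]
        exact congrFun hbe i
    have := card_nsmul_eq_zero' (x := (⟨b j, hmem⟩ : F))
    rw [natCast_zsmul]
    exact congrArg Subtype.val this
  obtain ⟨φ, hφ⟩ := exists_hom_of_projSubgroup htop hN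
  obtain ⟨c, hc⟩ := exists_relation_of_hom hCM hB htop hφ
  refine ⟨(Nat.card F : ℕ), c, ?_, fun b hb => ?_⟩
  · exact_mod_cast Nat.card_pos.ne'
  · rw [← hφ b hb, hc]
    rfl

/-- An abelian subvariety of codimension at least `r` satisfies `r` independent integral
relations. -/
theorem exists_relations [W.IsElliptic] (hCM : NoCM W) {B : AddSubgroup (EPow W n)}
    (hB : IsAbelianSubvariety B) {r : ℕ} (hr : CodimGE (B : Set (EPow W n)) r) :
    ∃ (m : ℕ) (e : Fin m → Fin n) (N : ℤ) (c : Fin n → Fin m → ℤ), Function.Injective e ∧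
      m + r ≤ n ∧ N ≠ 0 ∧ (∀ i, c (e i) = Pi.single i N) ∧
      ∀ b ∈ B, ∀ j, N • b j = ∑ i, c j i • b (e i) := by
  classical
  -- A maximal set of free coordinates of B: repeated coordinates cannot be free, so the process
  -- stops by n.
  have hmax : ∃ m, (∃ e : Fin m → Fin n, projSubgroup e B = ⊤) ∧
      ¬ ∃ e : Fin (m + 1) → Fin n, projSubgroup e B = ⊤ := by
    by_contra! h
    have hall : ∀ m, ∃ e : Fin m → Fin n, projSubgroup e B = ⊤ := by
      intro m
      induction m with
      | zero =>
        refine ⟨Fin.elim0, eq_top_iff.mpr fun y _ => ⟨0, B.zero_mem, Subsingleton.elim _ _⟩⟩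
      | succ m ih => exact h m ih
    obtain ⟨e, he⟩ := hall (n + 1)
    have := Fintype.card_le_of_injective e (injective_of_projSubgroup_eq_top he)
    simp at this
  obtain ⟨m, ⟨e, htop⟩, hnot⟩ := hmax
  have hinj := injective_of_projSubgroup_eq_top htop
  have hdim : (m : WithBot ℕ∞) ≤ topologicalKrullDim (B : Set (EPow W n)) := by
    refine le_topologicalKrullDim_of_dense e hB.1 hB.2 ?_
    rw [← coe_projSubgroup, htop]
    exact dense_univ
  have hle : m + r ≤ n := by
    have h1 : (m : WithBot ℕ∞) + (r : WithBot ℕ∞) ≤ n := (add_le_add_left hdim _).trans hr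
    exact_mod_cast h1
  have hj : ∀ j, ∃ (N : ℤ) (c : Fin m → ℤ), N ≠ 0 ∧ (∀ i, e i = j → c = Pi.single i N) ∧
      ∀ b ∈ B, N • b j = ∑ i, c i • b (e i) := by
    intro j
    by_cases h : ∃ i, e i = j
    · obtain ⟨i, rfl⟩ := h
      refine ⟨1, Pi.single i 1, one_ne_zero, fun i' hi' => by rw [hinj hi'], fun b _ => ?_⟩
      rw [Finset.sum_eq_single i]
      · simp
      · intro k _ hk
        rw [Pi.single_eq_of_ne hk, zero_zsmul]
      · simp
    · obtain ⟨N, c, hN, hc⟩ := exists_relation hCM hB htop j fun h' => hnot ⟨_, h'⟩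
      exact ⟨N, c, hN, fun i hi => absurd ⟨i, hi⟩ h, hc⟩
  choose N c hN hc hrel using hj
  -- The denominators N_j are replaced by their product, so that all relations share the coefficient
  -- N.
  have hprod : ∀ j, (∏ l ∈ Finset.univ.erase j, N l) * N j = ∏ l, N l := fun j =>
    Finset.prod_erase_mul _ _ (Finset.mem_univ j)
  refine ⟨m, e, ∏ l, N l, fun j i => (∏ l ∈ Finset.univ.erase j, N l) * c j i, hinj, hle,
    Finset.prod_ne_zero_iff.mpr fun l _ => hN l, fun i => ?_, fun b hb j => ?_⟩
  · funext k
    dsimp only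
    rw [hc (e i) i rfl]
    by_cases hk : k = i
    · subst hk
      rw [Pi.single_eq_same, Pi.single_eq_same, hprod]
    · rw [Pi.single_eq_of_ne hk, Pi.single_eq_of_ne hk, mul_zero]
  · rw [← hprod j, mul_zsmul, hrel j b hb, Finset.smul_sum]
    exact Finset.sum_congr rfl fun i _ => (mul_zsmul _ _ _).symm

end EllipticPower

/-! ### Integral matrices with independent rows -/

/-- Multilinear expansion writes det(M Mᵀ) through the maximal minors. If these all vanish, some v ≠
0 has v M Mᵀ = 0, so vM has square length zero over ℤ and vM = 0. -/
theorem Matrix.exists_det_submatrix_ne_zero {J ι : Type*} [Fintype J] [DecidableEq J] [Fintype ι]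
    (M : Matrix J ι ℤ) (hM : ∀ v : J → ℤ, Matrix.vecMul v M = 0 → v = 0) :
    ∃ σ : J → ι, (M.submatrix id σ).det ≠ 0 := by
  classical
  by_contra! h
  have hdet : (M * M.transpose).det = 0 := by
    have h1 : (M * M.transpose : Matrix J J ℤ) =
        fun i => ∑ l, (M i l • fun j => M j l : J → ℤ) := by
      funext i j
      rw [Matrix.mul_apply, Finset.sum_apply]
      rfl
    have h2 : (M * M.transpose).det = Matrix.detRowAlternating.toMultilinearMap
        (fun i => ∑ l, (M i l • fun j => M j l : J → ℤ)) := by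
      rw [← h1]
      rfl
    rw [h2, MultilinearMap.map_sum]
    refine Finset.sum_eq_zero fun σ _ => ?_
    rw [MultilinearMap.map_smul_univ]
    have h3 := h σ
    rw [← Matrix.det_transpose] at h3
    have h4 : Matrix.detRowAlternating.toMultilinearMap (fun i j => M j (σ i)) = 0 := h3
    rw [h4, smul_zero]
  obtain ⟨v, hv, hv0⟩ := Matrix.exists_vecMul_eq_zero_iff.mpr hdet
  apply hv
  apply hM
  rw [← Matrix.vecMul_vecMul] at hv0
  have h5 : dotProduct (Matrix.vecMul v M) (Matrix.vecMul v M) = 0 := by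
    have h6 : dotProduct (Matrix.vecMul (Matrix.vecMul v M) M.transpose) v = 0 := by
      rw [hv0, zero_dotProduct]
    rw [← Matrix.dotProduct_mulVec, Matrix.mulVec_transpose] at h6
    exact h6
  exact dotProduct_self_eq_zero.mp h5

/-- A matrix with independent rows can be brought to a form with a diagonal block that dominates
all other entries. -/
theorem Matrix.exists_mul_dominant {J ι : Type*} [Fintype J] [DecidableEq J] [Fintype ι]
    (M : Matrix J ι ℤ) (hM : ∀ v : J → ℤ, Matrix.vecMul v M = 0 → v = 0) :
    ∃ (T : Matrix J J ℤ) (a : ℤ) (σ : J → ι), a ≠ 0 ∧ (∀ i l, |(T * M) i l| ≤ |a|) ∧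
      ∀ i i', (T * M) i (σ i') = if i = i' then a else 0 := by
  classical
  obtain ⟨σ₀, h₀⟩ := Matrix.exists_det_submatrix_ne_zero M hM
  have : Nonempty (J → ι) := ⟨σ₀⟩
  -- By Cramer's rule the entries of adjugate times M are maximal minors with one column replaced;
  -- choosing the largest minor makes it dominate them all.
  obtain ⟨σ, hσ⟩ := Finite.exists_max fun σ : J → ι => |(M.submatrix id σ).det|
  have hTM : ∀ i l, ((M.submatrix id σ).adjugate * M) i l =
      (M.submatrix id (Function.update σ i l)).det := by
    intro i l
    have h1 : ((M.submatrix id σ).adjugate * M) i l =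
        Matrix.mulVec (M.submatrix id σ).adjugate (fun j => M j l) i := by
      rw [Matrix.mul_apply, Matrix.mulVec, dotProduct]
    rw [h1, ← Matrix.cramer_eq_adjugate_mulVec, Matrix.cramer_apply]
    congr 1
    ext j k
    rw [Matrix.updateCol_apply, Matrix.submatrix_apply, Matrix.submatrix_apply,
      Function.update_apply]
    split_ifs <;> rfl
  refine ⟨(M.submatrix id σ).adjugate, (M.submatrix id σ).det, σ, ?_, fun i l => ?_,
    fun i i' => ?_⟩
  · have := (abs_pos.mpr h₀).trans_le (hσ σ₀)
    exact abs_pos.mp this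
  · rw [hTM]
    exact hσ _
  · have h1 : ((M.submatrix id σ).adjugate * M) i (σ i') =
        ((M.submatrix id σ).adjugate * M.submatrix id σ) i i' := rfl
    rw [h1, Matrix.adjugate_mul, Matrix.smul_apply, Matrix.one_apply]
    split_ifs <;> simp

namespace EllipticPower

variable {W : WeierstrassCurve Qbar} {n : ℕ}

/-! ### Norms and maximal free sets -/

theorem powNorm_le_iff [W.IsElliptic] (d : ℕ) {x : EPow W n} {ε : ℝ} (hε : 0 ≤ ε) :
    powNorm d x ≤ ε ↔ ∀ i, ptNorm d (x i) ≤ ε := by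
  rw [powNorm, Real.sqrt_le_left hε]
  simp only [ptNorm, Real.sqrt_le_left hε]
  rw [powHeight]
  constructor
  · intro h i
    exact (le_ciSup (f := fun i => canonicalHeight d (x i)) (Set.finite_range _).bddAbove i).trans h
  · intro h
    exact Real.iSup_le h (sq_nonneg ε)

/-- Otherwise P and γ would be s + 1 independent elements of a group of rank s. -/
theorem exists_zsmul_eq_sum_of_rank_eq {A : Type*} [AddCommGroup A] {s : ℕ} {M : AddSubgroup A}
    (hrank : Module.rank ℤ M = (s : Cardinal)) {γ : Fin s → A} (hmem : ∀ i, γ i ∈ M)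
    (hγ : LinearIndependent ℤ γ) {P : A} (hP : P ∈ M) :
    ∃ (N : ℤ) (a : Fin s → ℤ), N ≠ 0 ∧ N • P = ∑ k, a k • γ k := by
  by_contra! hcon
  let v : Fin s → M := fun i => ⟨γ i, hmem i⟩
  have hv : LinearIndependent ℤ v := LinearIndependent.of_comp (M.subtype.toIntLinearMap) hγ
  have hind : LinearIndependent ℤ (Fin.cons (⟨P, hP⟩ : M) v : Fin (s + 1) → M) := by
    refine hv.finCons' _ _ ?_
    intro c y hy hc
    by_contra hc0
    obtain ⟨a, ha⟩ := (Submodule.mem_span_range_iff_exists_fun ℤ).mp hy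
    refine hcon c (-a) hc0 ?_
    have h1 := congrArg Subtype.val hc
    have h2 := congrArg Subtype.val ha
    simp only [AddSubgroup.coe_add, AddSubgroup.coe_zsmul, AddSubgroup.val_finsetSum,
      ZeroMemClass.coe_zero] at h1 h2
    rw [eq_neg_of_add_eq_zero_left h1, ← h2, ← Finset.sum_neg_distrib]
    exact Finset.sum_congr rfl fun k _ => (neg_zsmul _ _).symm
  have := hind.cardinal_lift_le_rank
  rw [hrank, Cardinal.mk_fin, Cardinal.lift_natCast, Cardinal.lift_natCast] at this
  have h3 : s + 1 ≤ s := by exact_mod_cast this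
  omega

theorem exists_common_zsmul_eq_sum {s : ℕ} {γ : EPow W s} {ι : Type*} [Fintype ι]
    {y : ι → W.toAffine.Point}
    (h : ∀ j, ∃ (N : ℤ) (a : Fin s → ℤ), N ≠ 0 ∧ N • y j = ∑ k, a k • γ k) :
    ∃ (N : ℤ) (a : ι → Fin s → ℤ), N ≠ 0 ∧ ∀ j, N • y j = ∑ k, a j k • γ k := by
  classical
  choose N a hN ha using h
  refine ⟨∏ j, N j, fun j k => (∏ l ∈ Finset.univ.erase j, N l) * a j k,
    Finset.prod_ne_zero_iff.mpr fun l _ => hN l, fun j => ?_⟩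
  rw [← Finset.prod_erase_mul _ _ (Finset.mem_univ j), mul_zsmul, ha, Finset.smul_sum]
  exact Finset.sum_congr rfl fun i _ => (mul_zsmul _ _ _).symm

theorem CodimGE.of_topologicalKrullDim_le {B : Set (EPow W n)} {m r : ℕ}
    (h : topologicalKrullDim B ≤ m) (hmr : m + r ≤ n) : CodimGE B r := by
  refine (add_le_add_left h (r : WithBot ℕ∞)).trans ?_
  exact_mod_cast hmr

theorem mem_S_iff {r : ℕ} {V F : Set (EPow W n)} {x : EPow W n} :
    x ∈ S r V F ↔ x ∈ V ∧ ∃ B : AddSubgroup (EPow W n), IsAbelianSubvariety B ∧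
      CodimGE (B : Set (EPow W n)) r ∧ ∃ b ∈ B, ∃ f ∈ F, b + f = x := by
  simp only [S, Set.mem_inter_iff, Set.mem_iUnion, Set.mem_add, SetLike.mem_coe, exists_prop]

end EllipticPower

/-! ### Adding a maximal free set to the coordinates -/

theorem sum_mul_zsmul {A ι : Type*} [AddCommGroup A] (t : Finset ι) (u v : ι → ℤ) (x : A) :
    (∑ i ∈ t, u i * v i) • x = ∑ i ∈ t, u i • v i • x := by
  simp only [Finset.sum_smul, mul_smul]

namespace EllipticPower

variable {W : WeierstrassCurve Qbar}

/-- Relations modulo a finitely generated group become relations in `E^(g+s)`. -/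
theorem exists_abelianSubvariety_append [W.IsElliptic] (hCM : NoCM W) {g s r : ℕ}
    {B : AddSubgroup (EPow W g)} (hB : IsAbelianSubvariety B)
    (hr : CodimGE (B : Set (EPow W g)) r) {γ : EPow W s} {y : EPow W g} {M : ℤ} (hM : M ≠ 0)
    {a : Fin g → Fin s → ℤ} (ha : ∀ j, M • y j = ∑ k, a j k • γ k) {b : EPow W g} (hb : b ∈ B) :
    ∃ B' : AddSubgroup (EPow W (g + s)), IsAbelianSubvariety B' ∧
      CodimGE (B' : Set (EPow W (g + s))) r ∧
      ∃ β ∈ B', ∃ N : ℤ, N ≠ 0 ∧ ∀ j, N • ((Fin.append (b + y) γ : EPow W (g + s)) j - β j) = 0 := by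
  obtain ⟨m, e, N, c, -, hle, hN, hce, hrel⟩ := exists_relations hCM hB hr
  let e' : Fin (m + s) → Fin (g + s) :=
    Fin.append (fun i => Fin.castAdd s (e i)) (fun k => Fin.natAdd g k)
  -- The relation M N z_j = M ∑ c_ji z_{e(i)} + ∑ (N a_jk - ∑ c_ji a_{e(i)k}) γ_k: the relation of B
  -- multiplied by M, with y expressed through γ by M y_j = ∑ a_jk γ_k.
  let c' : Fin (g + s) → Fin (m + s) → ℤ :=
    Fin.append (fun j => Fin.append (fun i => M * c j i)
        (fun k => N * a j k - ∑ i, c j i * a (e i) k))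
      (fun k => Pi.single (Fin.natAdd m k) (M * N))
  have hc' : ∀ i, c' (e' i) = Pi.single i (M * N) := by
    intro i
    refine Fin.addCases (fun i => ?_) (fun k => ?_) i
    · simp only [e', c', Fin.append_left, hce]
      funext l
      refine Fin.addCases (fun l => ?_) (fun k => ?_) l
      · rw [Fin.append_left]
        by_cases hl : l = i
        · subst hl
          rw [Pi.single_eq_same, Pi.single_eq_same]
        · rw [Pi.single_eq_of_ne hl, Pi.single_eq_of_ne, mul_zero]
          intro h
          exact hl (Fin.castAdd_injective _ _ h)
      · rw [Fin.append_right, Pi.single_eq_of_ne]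
        · rw [Finset.sum_eq_single i]
          · rw [Pi.single_eq_same, sub_self]
          · intro l _ hl
            rw [Pi.single_eq_of_ne hl, zero_mul]
          · simp
        · intro h
          have := congrArg Fin.val h
          simp at this
          omega
    · simp only [e', c', Fin.append_right]
  obtain ⟨B', hB', hdim, hz⟩ := exists_abelianSubvariety_of_relations (W := W) e' c'
    (mul_ne_zero hM hN) hc'
  refine ⟨B', hB', CodimGE.of_topologicalKrullDim_le hdim (by omega), ?_⟩
  obtain ⟨β, hβ, hβz⟩ := hz (Fin.append (b + y) γ) (by
    intro j
    have hsum : ∀ (u : Fin (m + s) → ℤ),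
        ∑ i, u i • (Fin.append (b + y) γ : EPow W (g + s)) (e' i) =
        ∑ i, u (Fin.castAdd s i) • (b (e i) + y (e i)) + ∑ k, u (Fin.natAdd m k) • γ k := by
      intro u
      rw [Fin.sum_univ_add]
      simp [e']
    rw [hsum]
    refine Fin.addCases (fun j => ?_) (fun k => ?_) j
    · simp only [c', Fin.append_left, Fin.append_right, Pi.add_apply]
      have h1 : ∑ i, (M * c j i) • (b (e i) + y (e i)) =
          (M * N) • b j + ∑ i, c j i • ∑ k, a (e i) k • γ k := by
        rw [mul_zsmul, hrel b hb j, Finset.smul_sum, ← Finset.sum_add_distrib]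
        refine Finset.sum_congr rfl fun i _ => ?_
        rw [← ha, zsmul_add, mul_zsmul, mul_comm, mul_zsmul]
      have h2 : ∑ k, (N * a j k - ∑ i, c j i * a (e i) k) • γ k =
          (M * N) • y j - ∑ i, c j i • ∑ k, a (e i) k • γ k := by
        rw [mul_comm, mul_zsmul, ha, Finset.smul_sum]
        simp only [Finset.smul_sum]
        rw [Finset.sum_comm, ← Finset.sum_sub_distrib]
        refine Finset.sum_congr rfl fun k _ => ?_
        rw [sub_zsmul, mul_zsmul, sum_mul_zsmul, sub_eq_add_neg]
      rw [h1, h2, zsmul_add]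
      abel
    · simp only [c', Fin.append_right]
      rw [Finset.sum_eq_zero, zero_add, Finset.sum_eq_single k]
      · rw [Pi.single_eq_same]
      · intro l _ hl
        rw [Pi.single_eq_of_ne, zero_zsmul]
        intro h
        exact hl (Fin.natAdd_injective _ _ h)
      · simp
      · intro i _
        rw [Pi.single_eq_of_ne, zero_zsmul]
        intro h
        have := congrArg Fin.val h
        simp at this
        omega)
  exact ⟨β, hβ, M * N, mul_ne_zero hM hN, hβz⟩

/-- The s coordinates γ are added as free ones, so the number of relations, and with it the bound on
the codimension, is unchanged. -/
theorem mapsTo_append [W.IsElliptic] (hCM : NoCM W) (d : ℕ) {g r s : ℕ} (C : Set (EPow W g))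
    (Γ : AddSubgroup (EPow W g)) (γ : EPow W s) (hγ : IsMaximalFreeSet (saturatedModule Γ) γ)
    {ε : ℝ} (hε : 0 ≤ ε) :
    Set.MapsTo (fun x : EPow W g => (Fin.append x γ : EPow W (g + s)))
      (S r C (thicken d (Γ : Set (EPow W g)) ε))
      (S r (prodPoint C γ) (smallPoints W (g + s) d ε)) := by
  intro x hx
  obtain ⟨hxC, B, hB, hcod, b, hb, _, ⟨y, hy, ξ, hξ, rfl⟩, hxe⟩ := mem_S_iff.mp hx
  have hyM : ∀ j, ∃ (N : ℤ) (a : Fin s → ℤ), N ≠ 0 ∧ N • y j = ∑ k, a k • γ k := by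
    intro j
    refine exists_zsmul_eq_sum_of_rank_eq hγ.rank_eq hγ.mem hγ.linearIndependent (P := y j) ?_
    exact ⟨1, one_ne_zero, by
      rw [one_zsmul]
      exact AddSubgroup.subset_closure ⟨y, hy, j, rfl⟩⟩
  obtain ⟨M, a, hM, ha⟩ := exists_common_zsmul_eq_sum hyM
  obtain ⟨B', hB', hcod', β, hβ, N, hN, hβN⟩ :=
    exists_abelianSubvariety_append hCM hB hcod hM ha hb
  refine mem_S_iff.mpr ⟨⟨x, hxC, rfl⟩, B', hB', hcod', β, hβ, Fin.append x γ - β, ?_, by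
    rw [add_sub_cancel]⟩
  change powNorm d _ ≤ ε
  rw [powNorm_le_iff d hε]
  have hξ' := (powNorm_le_iff d hε).mp hξ
  intro j
  have hτ := ptNorm_eq_zero_of_zsmul_eq_zero d hN (hβN j)
  -- The error is a torsion point, of norm zero, plus (ξ, 0); this is why the radius stays exactly
  -- ε.
  have hsplit : (Fin.append x γ - β : EPow W (g + s)) j =
      ((Fin.append (b + y) γ : EPow W (g + s)) j - β j) + (Fin.append ξ 0 : EPow W (g + s)) j := by
    have hx' : (Fin.append x γ : EPow W (g + s)) j =
        (Fin.append (b + y) γ : EPow W (g + s)) j + (Fin.append ξ 0 : EPow W (g + s)) j := by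
      rw [← hxe]
      refine Fin.addCases (fun j => ?_) (fun k => ?_) j
      · simp only [Fin.append_left, Pi.add_apply]
        abel
      · simp
    rw [Pi.sub_apply, hx']
    abel
  rw [hsplit]
  refine (ptNorm_add_le d _ _).trans ?_
  rw [hτ, zero_add]
  refine Fin.addCases (fun j => ?_) (fun k => ?_) j
  · rw [Fin.append_left]
    exact hξ' j
  · rw [Fin.append_right, Pi.zero_apply, ptNorm_zero]
    exact hε

theorem append_left_injective {g s : ℕ} (γ : EPow W s) :
    Function.Injective (fun x : EPow W g => (Fin.append x γ : EPow W (g + s))) := by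
  intro x x' h
  funext i
  have := congrFun h (Fin.castAdd s i)
  simpa using this

end EllipticPower

/-! ### Projecting away a free set of coordinates -/

theorem Fin.exists_equiv_sum_of_injective {k n : ℕ} {σ : Fin k → Fin n}
    (hσ : Function.Injective σ) :
    ∃ (q : ℕ) (φ : Fin k ⊕ Fin q ≃ Fin n), q + k = n ∧ ∀ i, φ (Sum.inl i) = σ i := by
  classical
  let φ : Fin k ⊕ Fin (Fintype.card ↥(Set.range σ)ᶜ) ≃ Fin n :=
    (Equiv.sumCongr (Equiv.ofInjective σ hσ) (Fintype.equivFin _).symm).trans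
      (Equiv.Set.sumCompl (Set.range σ))
  refine ⟨_, φ, ?_, fun i => ?_⟩
  · have := Fintype.card_congr φ
    rw [Fintype.card_sum, Fintype.card_fin, Fintype.card_fin, Fintype.card_fin] at this
    omega
  · simp [φ]

namespace EllipticPower

variable {W : WeierstrassCurve Qbar}

/-- An abelian subvariety of codimension at least `r` satisfies `r` independent relations. -/
theorem exists_matrix_of_abelianSubvariety [W.IsElliptic] (hCM : NoCM W) {n r : ℕ}
    {B : AddSubgroup (EPow W n)} (hB : IsAbelianSubvariety B)
    (hr : CodimGE (B : Set (EPow W n)) r) :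
    ∃ (k : ℕ) (A : Matrix (Fin k) (Fin n) ℤ), r ≤ k ∧ (∀ v, Matrix.vecMul v A = 0 → v = 0) ∧
      ∀ b ∈ B, ∀ i, ∑ l, A i l • b l = 0 := by
  classical
  obtain ⟨m, e, N, c, he, hle, hN, -, hrel⟩ := exists_relations hCM hB hr
  obtain ⟨k, φ, hk, hφ⟩ := Fin.exists_equiv_sum_of_injective he
  -- Row i is N times the i-th non-free coordinate minus its expression in the free ones; the block
  -- N on the non-free coordinates gives independence.
  let A : Matrix (Fin k) (Fin n) ℤ := fun i l =>
    Sum.elim (fun t => -c (φ (Sum.inr i)) t) (Pi.single i N : Fin k → ℤ) (φ.symm l)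
  refine ⟨k, A, by omega, fun v hv => ?_, fun b hb i => ?_⟩
  · funext i
    have h := congrFun hv (φ (Sum.inr i))
    rw [Matrix.vecMul, dotProduct, Finset.sum_eq_single i] at h
    · simpa [A, hN] using h
    · intro j _ hj
      simp [A, Pi.single_eq_of_ne hj.symm]
    · simp
  · rw [← φ.sum_comp, Fintype.sum_sum_type, Finset.sum_eq_single_of_mem i (Finset.mem_univ _)]
    · have h1 : ∀ t, A i (φ (Sum.inl t)) • b (φ (Sum.inl t)) =
          -(c (φ (Sum.inr i)) t • b (e t)) := by
        intro t
        simp only [A, Equiv.symm_apply_apply, Sum.elim_inl, neg_zsmul]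
        rw [hφ]
      have h2 : A i (φ (Sum.inr i)) = N := by simp [A]
      rw [Finset.sum_congr rfl fun t _ => h1 t, h2, hrel b hb, Finset.sum_neg_distrib,
        neg_add_cancel]
    · intro j _ hj
      have h2 : A i (φ (Sum.inr j)) = 0 := by simp [A, Pi.single_eq_of_ne hj]
      rw [h2, zero_zsmul]

/-- The solutions of a system of relations with a scalar block lie, up to torsion, in an abelian
subvariety. -/
theorem exists_abelianSubvariety_of_matrix [W.IsElliptic] {n k r : ℕ} (hrk : r ≤ k)
    {L : Matrix (Fin k) (Fin n) ℤ} {a : ℤ} (ha : a ≠ 0) {σ : Fin k → Fin n}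
    (hσ : Function.Injective σ) (hL : ∀ i i', L i (σ i') = if i = i' then a else 0) :
    ∃ B : AddSubgroup (EPow W n), IsAbelianSubvariety B ∧ CodimGE (B : Set (EPow W n)) r ∧
      ∀ w : EPow W n, (∀ i, ∑ l, L i l • w l = 0) → ∃ β ∈ B, ∀ j, a • (w j - β j) = 0 := by
  classical
  obtain ⟨q, φ, hq, hφ⟩ := Fin.exists_equiv_sum_of_injective hσ
  -- The coordinates outside σ are free, and row i is solved for the pivot coordinate σ i.
  let c : Fin n → Fin q → ℤ := fun j =>
    Sum.elim (fun i t => -L i (φ (Sum.inr t))) (fun t => Pi.single t a) (φ.symm j)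
  obtain ⟨B, hB, hdim, hz⟩ := exists_abelianSubvariety_of_relations (W := W)
    (fun t => φ (Sum.inr t)) c ha (fun t => by simp [c])
  refine ⟨B, hB, CodimGE.of_topologicalKrullDim_le hdim (by omega), fun w hw => hz w fun j => ?_⟩
  obtain ⟨j, rfl⟩ := φ.surjective j
  rcases j with i | t
  · have h := hw i
    rw [← φ.sum_comp, Fintype.sum_sum_type,
      Finset.sum_eq_single_of_mem i (Finset.mem_univ _)] at h
    · rw [hφ, hL, if_pos rfl] at h
      rw [hφ, eq_neg_of_add_eq_zero_left h, ← Finset.sum_neg_distrib]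
      refine Finset.sum_congr rfl fun t _ => ?_
      simp only [c, ← hφ, Equiv.symm_apply_apply, Sum.elim_inl, neg_zsmul]
    · intro i' _ hi'
      rw [hφ, hL, if_neg hi'.symm, zero_zsmul]
  · rw [Finset.sum_eq_single_of_mem t (Finset.mem_univ _)]
    · simp [c]
    · intro t' _ ht'
      have : c (φ (Sum.inr t)) t' = 0 := by simp [c, Pi.single_eq_of_ne ht']
      rw [this, zero_zsmul]

/-- Integral combinations of the differences `p_k - ξ_k` control their coefficients. -/
theorem AreConstants.abs_mul_le {d s : ℕ} {p : EPow W s} {c ε₀ : ℝ} (h : AreConstants d p c ε₀)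
    [W.IsElliptic] {ξ : EPow W s} (hξ : ∀ k, ptNorm d (ξ k) ≤ ε₀) (b : Fin s → ℤ) (k : Fin s) :
    √c * (|(b k : ℝ)| * ptNorm d (p k)) ≤ ptNorm d (∑ k, b k • (p k - ξ k)) := by
  -- Inequality (*) with b = 0 and ζ = 0.
  have h1 := h.bound b 0 ⟨k, by simp⟩ ξ 0 hξ (by rw [ptNorm_zero]; exact h.ε₀_pos.le)
  rw [zero_zsmul, sub_zero] at h1
  refine le_of_sq_le_sq ?_ (ptNorm_nonneg _ _)
  refine le_trans ?_ h1
  rw [mul_pow, Real.sq_sqrt h.c_pos.le]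
  refine mul_le_mul_of_nonneg_left ?_ h.c_pos.le
  rw [mul_pow]
  exact Finset.single_le_sum (f := fun i => |(b i : ℝ)| ^ 2 * ptNorm d (p i) ^ 2)
    (fun i _ => by positivity) (Finset.mem_univ k)

end EllipticPower

theorem sum_sum_mul_zsmul {A ι κ : Type*} [AddCommGroup A] [Fintype ι] [Fintype κ] (v : ι → ℤ)
    (M : Matrix ι κ ℤ) (y : κ → A) :
    ∑ l, (∑ i, v i * M i l) • y l = ∑ i, v i • ∑ l, M i l • y l := by
  simp only [sum_mul_zsmul, Finset.smul_sum]
  exact Finset.sum_comm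

namespace EllipticPower

variable {W : WeierstrassCurve Qbar}

/-- Relations between the coordinates of a point close to `(x, p)` can be solved for coordinates of
`x`, with a dominant scalar block. -/
theorem exists_dominant_relations [W.IsElliptic] (hCM : NoCM W) {d : ℕ} (hd : 0 < d) {g s r : ℕ}
    {p : EPow W s} (hp : LinearIndependent ℤ p) {c ε₀ : ℝ} (hc : AreConstants d p c ε₀)
    {B : AddSubgroup (EPow W (g + s))} (hB : IsAbelianSubvariety B)
    (hr : CodimGE (B : Set (EPow W (g + s))) r) {x ξ' : EPow W g} {ξ'' : EPow W s}
    (hξ : ∀ k, ptNorm d (ξ'' k) ≤ ε₀) {b : EPow W (g + s)} (hb : b ∈ B)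
    (hb' : ∀ l, b (Fin.castAdd s l) = x l - ξ' l) (hb'' : ∀ k, b (Fin.natAdd g k) = p k - ξ'' k) :
    ∃ (k : ℕ) (L : Matrix (Fin k) (Fin g) ℤ) (Φ : Matrix (Fin k) (Fin s) ℤ) (a : ℤ)
      (σ : Fin k → Fin g), r ≤ k ∧ a ≠ 0 ∧ (∀ i l, |L i l| ≤ |a|) ∧
      (∀ i i', L i (σ i') = if i = i' then a else 0) ∧
      ∀ i, ∑ l, L i l • (x l - ξ' l) + ∑ k, Φ i k • (p k - ξ'' k) = 0 := by
  obtain ⟨k, A, hrk, hA, hrel⟩ := exists_matrix_of_abelianSubvariety hCM hB hr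
  let M : Matrix (Fin k) (Fin g) ℤ := fun i l => A i (Fin.castAdd s l)
  let Ψ : Matrix (Fin k) (Fin s) ℤ := fun i l => A i (Fin.natAdd g l)
  have hMΨ : ∀ i, ∑ l, M i l • (x l - ξ' l) + ∑ k, Ψ i k • (p k - ξ'' k) = 0 := by
    intro i
    have h := hrel b hb i
    rw [Fin.sum_univ_add] at h
    simpa only [hb', hb''] using h
  have hcomb : ∀ v : Fin k → ℤ, ∑ l, (∑ i, v i * M i l) • (x l - ξ' l) +
      ∑ k, (∑ i, v i * Ψ i k) • (p k - ξ'' k) = 0 := by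
    intro v
    rw [sum_sum_mul_zsmul v M fun l => x l - ξ' l, sum_sum_mul_zsmul v Ψ fun k => p k - ξ'' k,
      ← Finset.sum_add_distrib]
    refine Finset.sum_eq_zero fun i _ => ?_
    rw [← zsmul_add, hMΨ, zsmul_zero]
  -- A combination v killing M leaves a relation between the p_k - ξ''_k alone; (*) and ‖p_k‖ > 0
  -- make it trivial, so v kills the whole matrix A.
  have hM : ∀ v, Matrix.vecMul v M = 0 → v = 0 := by
    intro v hv
    have hv' : ∀ l, ∑ i, v i * M i l = 0 := fun l => congrFun hv l
    have h := hcomb v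
    simp only [hv', zero_zsmul, Finset.sum_const_zero, zero_add] at h
    have hΨ : ∀ t, ∑ i, v i * Ψ i t = 0 := by
      intro t
      have h1 := hc.abs_mul_le hξ (fun t => ∑ i, v i * Ψ i t) t
      rw [h, ptNorm_zero] at h1
      have h2 := ptNorm_pos_of_linearIndependent hd hp t
      have h3 : 0 < √c := Real.sqrt_pos.mpr hc.c_pos
      by_contra hne
      have h4 : (0 : ℝ) < |((∑ i, v i * Ψ i t : ℤ) : ℝ)| := abs_pos.mpr (by exact_mod_cast hne)
      have h5 := mul_pos h3 (mul_pos h4 h2)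
      exact absurd h1 (not_le.mpr h5)
    apply hA
    funext l
    exact Fin.addCases (fun l => hv' l) (fun t => hΨ t) l
  obtain ⟨T, a, σ, ha, hle, hdiag⟩ := Matrix.exists_mul_dominant M hM
  exact ⟨k, T * M, T * Ψ, a, σ, hrk, ha, hle, hdiag, fun i => hcomb (T i)⟩

theorem ptNorm_sum_zsmul_le [W.IsElliptic] (d : ℕ) {n : ℕ} {b : Fin n → ℤ} {y : EPow W n}
    {a K : ℝ} (hb : ∀ i, |(b i : ℝ)| ≤ a) (hy : ∀ i, ptNorm d (y i) ≤ K) :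
    ptNorm d (∑ i, b i • y i) ≤ n * (a * K) := by
  refine (ptNorm_sum_le _ _ _).trans ?_
  have h : ∀ i ∈ Finset.univ, ptNorm d (b i • y i) ≤ a * K := by
    intro i _
    rw [ptNorm_zsmul]
    exact mul_le_mul (hb i) (hy i) (ptNorm_nonneg _ _) ((abs_nonneg _).trans (hb i))
  simpa using Finset.sum_le_card_nsmul _ _ _ h

/-- The coefficients of the `p_k` in a relation are bounded in terms of the other ones. -/
theorem AreConstants.abs_le_mul_div [W.IsElliptic] {d : ℕ} (hd : 0 < d) {g s : ℕ} {p : EPow W s}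
    (hp : LinearIndependent ℤ p) {c ε₀ : ℝ} (hc : AreConstants d p c ε₀) {x ξ' : EPow W g}
    {ξ'' : EPow W s} (hξ : ∀ k, ptNorm d (ξ'' k) ≤ ε₀) {K ε a : ℝ}
    (hx : ∀ l, ptNorm d (x l) ≤ K) (hξ' : ∀ l, ptNorm d (ξ' l) ≤ ε) {u : Fin g → ℤ}
    (hu : ∀ l, |(u l : ℝ)| ≤ a) {v : Fin s → ℤ}
    (h : ∑ l, u l • (x l - ξ' l) + ∑ k, v k • (p k - ξ'' k) = 0) (k : Fin s) :
    |(v k : ℝ)| ≤ a * (g * (K + ε) / (√c * ⨅ i, ptNorm d (p i))) := by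
  have : Nonempty (Fin s) := ⟨k⟩
  have hc0 : 0 < √c := Real.sqrt_pos.mpr hc.c_pos
  obtain ⟨k₀, hk₀⟩ := exists_eq_ciInf_of_finite (f := fun i => ptNorm d (p i))
  have hinf : 0 < ⨅ i, ptNorm d (p i) := by
    rw [← hk₀]
    exact ptNorm_pos_of_linearIndependent hd hp k₀
  have hle : ⨅ i, ptNorm d (p i) ≤ ptNorm d (p k) := ciInf_le (Set.finite_range _).bddBelow k
  have h1 := hc.abs_mul_le hξ v k
  rw [eq_neg_of_add_eq_zero_right h, ptNorm_neg] at h1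
  have h2 := ptNorm_sum_zsmul_le d (y := fun l => x l - ξ' l) hu
    fun l => (ptNorm_sub_le d _ _).trans (add_le_add (hx l) (hξ' l))
  rw [← mul_div_assoc, le_div_iff₀ (mul_pos hc0 hinf)]
  calc |(v k : ℝ)| * (√c * ⨅ i, ptNorm d (p i))
      ≤ |(v k : ℝ)| * (√c * ptNorm d (p k)) := by gcongr
    _ = √c * (|(v k : ℝ)| * ptNorm d (p k)) := by ring
    _ ≤ g * (a * (K + ε)) := h1.trans h2
    _ = a * (g * (K + ε)) := by ring

theorem ptNorm_le_of_zsmul_eq [W.IsElliptic] (d : ℕ) {a : ℤ} (ha : a ≠ 0) {P Q : W.toAffine.Point}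
    (h : a • P = Q) {K : ℝ} (hQ : ptNorm d Q ≤ |(a : ℝ)| * K) : ptNorm d P ≤ K := by
  rw [← h, ptNorm_zsmul] at hQ
  exact le_of_mul_le_mul_left hQ (abs_pos.mpr (by exact_mod_cast ha))

theorem ptNorm_le_setNorm [W.IsElliptic] {d n : ℕ} {V : Set (EPow W n)}
    (hV : HasBoundedHeight d V) {z : EPow W n} (hz : z ∈ V) (i : Fin n) :
    ptNorm d (z i) ≤ setNorm d V := by
  have h : powNorm d z ≤ setNorm d V :=
    Real.sqrt_le_sqrt (le_csSup hV ⟨z, hz, rfl⟩)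
  exact (powNorm_le_iff d (Real.sqrt_nonneg _)).mp h i

theorem CodimGE.mono {n r r' : ℕ} {B : Set (EPow W n)} (h : CodimGE B r) (hr : r' ≤ r) :
    CodimGE B r' := by
  refine le_trans ?_ h
  gcongr

theorem S_mono {n r r' : ℕ} (hr : r' ≤ r) (V : Set (EPow W n)) {F F' : Set (EPow W n)}
    (hF : F ⊆ F') : S r V F ⊆ S r' V F' := by
  intro x hx
  obtain ⟨hxV, B, hB, hcod, b, hb, f, hf, h⟩ := mem_S_iff.mp hx
  exact mem_S_iff.mpr ⟨hxV, B, hB, hcod.mono hr, b, hb, f, hF hf, h⟩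

/-- Solving relations with a scalar block modulo the division group of `p`. -/
theorem exists_mem_groupPow_add [W.IsElliptic] (d : ℕ) {g s k r : ℕ} (hrk : r ≤ k) {a : ℤ}
    (ha : a ≠ 0) {L : Matrix (Fin k) (Fin g) ℤ} {σ : Fin k → Fin g}
    (hdiag : ∀ i i', L i (σ i') = if i = i' then a else 0) {Φ : Matrix (Fin k) (Fin s) ℤ}
    {x ξ' : EPow W g} {p ξ'' : EPow W s}
    (hrel : ∀ i, ∑ l, L i l • (x l - ξ' l) + ∑ k, Φ i k • (p k - ξ'' k) = 0) {K : ℝ} (hK : 0 ≤ K)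
    (hbound : ∀ i, ptNorm d (∑ l, L i l • ξ' l + ∑ k, Φ i k • ξ'' k) ≤ |(a : ℝ)| * K) :
    ∃ B : AddSubgroup (EPow W g), IsAbelianSubvariety B ∧ CodimGE (B : Set (EPow W g)) r ∧
      ∃ b ∈ B, ∃ y ∈ groupPow (pointDivisionGroup p) g, ∃ η ∈ smallPoints W g d K,
        b + (y + η) = x := by
  classical
  have hσ : Function.Injective σ := by
    intro i i' h
    have h1 := hdiag i i
    rw [h, hdiag, if_pos rfl] at h1
    by_contra hne
    rw [if_neg hne] at h1
    exact ha h1.symm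
  -- A vector supported on the pivot coordinates only meets the scalar block of L.
  have hsum : ∀ (y : EPow W g), (∀ l, l ∉ Set.range σ → y l = 0) → ∀ i,
      ∑ l, L i l • y l = a • y (σ i) := by
    intro y hy i
    rw [Finset.sum_eq_single (σ i), hdiag, if_pos rfl]
    · intro l _ hl
      by_cases hr : l ∈ Set.range σ
      · obtain ⟨i', rfl⟩ := hr
        rw [hdiag, if_neg (fun h => hl (by rw [h])), zero_zsmul]
      · rw [hy l hr, zsmul_zero]
    · simp
  have hext : ∀ f : Fin k → W.toAffine.Point, ∃ y : EPow W g,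
      (∀ l, l ∉ Set.range σ → y l = 0) ∧ ∀ i, a • y (σ i) = f i := by
    intro f
    choose y hy using fun i => exists_zsmul_eq ha (f i)
    refine ⟨Function.extend σ y 0, fun l hl => ?_, fun i => ?_⟩
    · rw [Function.extend_apply' _ _ _ hl, Pi.zero_apply]
    · rw [hσ.extend_apply, hy]
  -- The relation reads Lx = -Φp + (Lξ' + Φξ''). Its two parts are divided by a separately at the
  -- pivots: y absorbs the part from p, η the small part, so x - y - η is a solution of L.
  obtain ⟨y, hy0, hy⟩ := hext fun i => -∑ k, Φ i k • p k
  obtain ⟨η, hη0, hη⟩ := hext fun i => ∑ l, L i l • ξ' l + ∑ k, Φ i k • ξ'' k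
  obtain ⟨B, hB, hcod, hz⟩ := exists_abelianSubvariety_of_matrix (W := W) hrk ha hσ hdiag
  obtain ⟨b, hb, hτ⟩ := hz (x - y - η) (by
    intro i
    have h1 : ∑ l, L i l • (x - y - η) l =
        ∑ l, L i l • x l - ∑ l, L i l • y l - ∑ l, L i l • η l := by
      rw [← Finset.sum_sub_distrib, ← Finset.sum_sub_distrib]
      refine Finset.sum_congr rfl fun l _ => ?_
      rw [Pi.sub_apply, Pi.sub_apply, zsmul_sub, zsmul_sub]
    have h2 := hrel i
    simp only [zsmul_sub, Finset.sum_sub_distrib] at h2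
    rw [h1, hsum y hy0, hsum η hη0, hy, hη, ← h2]
    abel)
  -- The small point used is x - y - b, which differs from η by torsion and so has coordinates of
  -- the same norm.
  refine ⟨B, hB, hcod, b, hb, y, fun l => ?_, x - y - b, ?_, by abel⟩
  · by_cases hl : l ∈ Set.range σ
    · obtain ⟨i, rfl⟩ := hl
      refine ⟨a, ha, ?_⟩
      rw [hy]
      have hmem : ∀ k, p k ∈ AddSubgroup.closure (Set.range p) := fun k =>
        AddSubgroup.subset_closure (Set.mem_range_self k)
      exact neg_mem (sum_mem fun k _ => AddSubgroup.zsmul_mem _ (hmem k) _)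
    · rw [hy0 l hl]
      exact zero_mem _
  · change powNorm d _ ≤ K
    rw [powNorm_le_iff d hK]
    intro l
    have h1 : (x - y - b) l = η l + ((x - y - η) l - b l) := by
      simp only [Pi.sub_apply]
      abel
    have h2 := ptNorm_add_le d (η l) ((x - y - η) l - b l)
    rw [ptNorm_eq_zero_of_zsmul_eq_zero d ha (hτ l), add_zero] at h2
    rw [h1]
    refine h2.trans ?_
    by_cases hl : l ∈ Set.range σ
    · obtain ⟨i, rfl⟩ := hl
      exact ptNorm_le_of_zsmul_eq d ha (hη i) (hbound i)
    · rw [hη0 l hl, ptNorm_zero]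
      exact hK

/-- The structure `AreConstants` carries the square c_p² of the constant in (*), hence the square
root in K₄. -/
theorem mapsTo_projFirst [W.IsElliptic] (hCM : NoCM W) {d : ℕ} (hd : 0 < d) {g r s : ℕ}
    (C : Set (EPow W g)) {p : EPow W s} (hp : LinearIndependent ℤ p) {c ε₀ : ℝ}
    (hc : AreConstants d p c ε₀) {K ε : ℝ} (hε : 0 ≤ ε) (hε₀ : ε ≤ ε₀)
    (hK : ∀ z ∈ S r (prodPoint C p) (smallPoints W (g + s) d ε), ∀ j, ptNorm d (z j) ≤ K) :
    Set.MapsTo (fun z : EPow W (g + s) => projFirst z)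
      (S r (prodPoint C p) (smallPoints W (g + s) d ε))
      (S r C (thicken d (groupPow (pointDivisionGroup p) g) (ε * K₄ d g p K (√c) ε))) := by
  intro z hz
  obtain ⟨⟨x, hx, rfl⟩, B, hB, hcod, b, hb, ξ, hξ, hbξ⟩ := mem_S_iff.mp hz
  have hproj : projFirst (Fin.append x p : EPow W (g + s)) = x := by
    funext l
    simp [projFirst]
  have hK' : ∀ l, ptNorm d (x l) ≤ K := by
    intro l
    simpa using hK _ hz (Fin.castAdd s l)
  have hξ' := (powNorm_le_iff d hε).mp hξ
  have hb1 : ∀ l, b (Fin.castAdd s l) = x l - ξ (Fin.castAdd s l) := by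
    intro l
    have h := congrFun hbξ (Fin.castAdd s l)
    simp only [Fin.append_left, Pi.add_apply] at h
    rw [← h, add_sub_cancel_right]
  have hb2 : ∀ k, b (Fin.natAdd g k) = p k - ξ (Fin.natAdd g k) := by
    intro k
    have h := congrFun hbξ (Fin.natAdd g k)
    simp only [Fin.append_right, Pi.add_apply] at h
    rw [← h, add_sub_cancel_right]
  obtain ⟨k, L, Φ, a, σ, hrk, ha, hle, hdiag, hrel⟩ :=
    exists_dominant_relations hCM hd hp hc hB hcod (ξ' := fun l => ξ (Fin.castAdd s l))
      (ξ'' := fun k => ξ (Fin.natAdd g k)) (fun k => (hξ' _).trans hε₀) hb hb1 hb2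
  have hL : ∀ i l, |(L i l : ℝ)| ≤ |(a : ℝ)| := fun i l => by exact_mod_cast hle i l
  -- For s = 0 the infimum over the empty family is 0, so κ is 0 by the convention on division, as
  -- prescribed.
  set κ := (g * (K + ε) / (√c * ⨅ i, ptNorm d (p i)) : ℝ) with hκ
  have hΦ : ∀ i t, |(Φ i t : ℝ)| ≤ |(a : ℝ)| * κ := fun i t =>
    hc.abs_le_mul_div hd hp (fun k => (hξ' _).trans hε₀) hK' (fun l => hξ' _) (hL i) (hrel i) t
  have hK4 : K₄ d g p K (√c) ε = (g + s) * max 1 κ := rfl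
  have hK4nn : 0 ≤ ε * K₄ d g p K (√c) ε := by
    rw [hK4]
    positivity
  obtain ⟨B', hB', hcod', b', hb', y, hy, η, hη, hsum⟩ :=
    exists_mem_groupPow_add d hrk ha hdiag hrel hK4nn (by
      intro i
      refine (ptNorm_add_le d _ _).trans ?_
      have h1 := ptNorm_sum_zsmul_le d (y := fun l => ξ (Fin.castAdd s l)) (hL i) fun l => hξ' _
      have h2 := ptNorm_sum_zsmul_le d (y := fun l => ξ (Fin.natAdd g l)) (hΦ i) fun l => hξ' _
      refine (add_le_add h1 h2).trans ?_
      rw [hK4]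
      -- The entries of L contribute g and those of Φ contribute s κ, in units of |a| ε; bounding
      -- both 1 and κ by their maximum gives K₄.
      calc (g * (|(a : ℝ)| * ε) + s * (|(a : ℝ)| * κ * ε) : ℝ)
          = |(a : ℝ)| * (ε * (g * 1 + s * κ)) := by ring
        _ ≤ |(a : ℝ)| * (ε * (g * max 1 κ + s * max 1 κ)) := by
          gcongr
          · exact le_max_left _ _
          · exact le_max_right _ _
        _ = |(a : ℝ)| * (ε * ((g + s) * max 1 κ)) := by ring)
  dsimp only
  rw [hproj]
  exact mem_S_iff.mpr ⟨hx, B', hB', hcod', b', hb', y + η, ⟨y, hy, η, hη, rfl⟩, hsum⟩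

theorem injOn_projFirst {g s : ℕ} (C : Set (EPow W g)) (p : EPow W s) :
    Set.InjOn (fun z : EPow W (g + s) => projFirst z) (prodPoint C p) := by
  rintro _ ⟨x, -, rfl⟩ _ ⟨x', -, rfl⟩ h
  have hx : x = x' := by
    funext l
    simpa [projFirst] using congrFun h l
  rw [hx]

end EllipticPower

/-! ### Assembly of the two statements -/

theorem mainTheorem7 (W : WeierstrassCurve Qbar) [W.IsElliptic] (hCM : NoCM W)
    (d : ℕ) (hd : 3 ≤ d) (g r : ℕ) (hr : 1 ≤ r)
    (C : Set (EPow W g)) (hC : IsCurve C) (hCt : IsTransverse C) :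
    (∀ Γ : AddSubgroup (EPow W g), Module.rank ℤ Γ < Cardinal.aleph0 →
      ∀ (s : ℕ) (γ : EPow W s), IsMaximalFreeSet (saturatedModule Γ) γ →
      ∀ ε : ℝ, 0 ≤ ε →
        Set.MapsTo (fun x : EPow W g => Fin.append x γ)
          (S r C (thicken d (Γ : Set (EPow W g)) ε))
          (S r (prodPoint C γ) (smallPoints W (g + s) d ε)) ∧
        Set.InjOn (fun x : EPow W g => Fin.append x γ)
          (S r C (thicken d (Γ : Set (EPow W g)) ε))) ∧
    (∀ (s : ℕ) (p : EPow W s), LinearIndependent ℤ p →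
      (∃ c₂ εp : ℝ, AreConstants d p c₂ εp) ∧
      ∀ c₂ εp : ℝ, AreConstants d p c₂ εp →
      ∀ ε₃ : ℝ, 0 < ε₃ →
        HasBoundedHeight d (S 2 (prodPoint C p) (smallPoints W (g + s) d ε₃)) →
      ∀ K₃ : ℝ, K₃ = setNorm d (S 2 (prodPoint C p) (smallPoints W (g + s) d ε₃)) →
      ∀ ε : ℝ, 0 ≤ ε → ε ≤ min εp ε₃ → 2 ≤ r →
        Set.MapsTo (fun z : EPow W (g + s) => projFirst z)
          (S r (prodPoint C p) (smallPoints W (g + s) d ε))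
          (S r C (thicken d (groupPow (pointDivisionGroup p) g) (ε * K₄ d g p K₃ (√c₂) ε))) ∧
        Set.InjOn (fun z : EPow W (g + s) => projFirst z)
          (S r (prodPoint C p) (smallPoints W (g + s) d ε))) := by
  have hd0 : 0 < d := by omega
  refine ⟨fun Γ _ s γ hγ ε hε =>
    ⟨mapsTo_append hCM d C Γ γ hγ hε, (append_left_injective γ).injOn⟩,
    fun s p hp => ⟨exists_areConstants hd0 hp, ?_⟩⟩
  intro c₂ εp hc ε₃ _ hbdd K₃ hK₃ ε hε hle h2r
  refine ⟨mapsTo_projFirst hCM hd0 C hp hc hε (hle.trans (min_le_left _ _)) fun z hz j => ?_,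
    (injOn_projFirst C p).mono Set.inter_subset_left⟩
  rw [hK₃]
  -- As r ≥ 2 and ε ≤ ε₃, the set in question lies in the one whose norm is K₃.
  refine ptNorm_le_setNorm hbdd (S_mono h2r _ (fun ξ hξ => ?_) hz) j
  exact le_trans hξ (hle.trans (min_le_right _ _))
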